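/- Let $q>0$ be real, $q\neq1$, and put $h=\sqrt q-1/\sqrt q$. All indices run over $\{-,0,+\}$. Let $(g_{ij})=(g^{ij})$ be the matrix whose only nonzero entries are $g_{-+}=1/\sqrt q$, $g_{00}=1$, $g_{+-}=\sqrt q$. Let $\mathcal P_a$ be the orthogonal projector of $\mathbb C^3\otimes\mathbb C^3$ onto the span of the coefficient vectors of the three quadratic relations $$x^-x^0-q\,x^0x^-,\qquad x^+x^0-q^{-1}x^0x^+,\qquad x^+x^--x^-x^+-h\,(x^0)^2 .$$ Let $\mathcal P_t{}^{ij}_{kl}=g^{ij}g_{kl}/(g^{mn}g_{mn})$, $\mathcal P_s=1-\mathcal P_a-\mathcal P_t$, and let $\hat R=q\mathcal P_s-q^{-1}\mathcal P_a+q^{-2}\mathcal P_t$ be the braid matrix of $SO_q(3)$. Let $\mathcal A$ be the unital complex algebra generated by $x^-,x^0,x^+$ subject to the three relations above, in which moreover $r^2=g_{ij}x^ix^j$ is made invertible, extended by an invertible dilatation generator $\Lambda$ with $x^i\Lambda=q\Lambda x^i$. Let $\Omega^1(\mathcal A)$ be the $\mathcal A$-bimodule generated by the differentials $df$, $f\in\mathcal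 A$, where $d$ is a $\mathbb C$-linear derivation, subject to $x^i\xi^j=q\hat R^{ij}_{kl}\,\xi^kx^l$ and $d\Lambda=0$, where $\xi^i=dx^i$. Put $\theta=(q-1)^{-1}q^2r^{-2}x^i\xi^jg_{ij}$. A metric is an $\mathcal A$-bilinear map $g:\Omega^1(\mathcal A)\otimes_{\mathcal A}\Omega^1(\mathcal A)\to\mathcal A$. A linear connection is a $\mathbb C$-linear map $D:\Omega^1(\mathcal A)\to\Omega^1(\mathcal A)\otimes_{\mathcal A}\Omega^1(\mathcal A)$ with an $\mathcal A$-bilinear map $\sigma$ of $\Omega^1(\mathcal A)\otimes_{\mathcal A}\Omega^1(\mathcal A)$ into itself such that $D(f\xi)=df\otimes\xi+fD\xi$ and $D(\xi f)=\sigma(\xi\otimes df)+(D\xi)f$. Put $D_2(\xi\otimes\eta)=D\xi\otimes\eta+\sigma_{12}(\xi\otimes D\eta)$; compatibility of $D$ with $g$ means $g_{23}\circ D_2=d\circ g$, where $g_{23}(\alpha\otimes\beta\otimes\gamma)=\alpha\, g(\beta\otimes\gamma)$. Then there is a nonzero metric $g_0$ with $$g_0(\xi^i\otimes\xi^j)=g^{ij}\,r^2\Lambda^2,$$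 and it is the only metric up to normalization: every metric is a complex multiple of $g_0$. Moreover, for $S=(q\hat R)^{\pm1}$, with respectively $\kappa=q^{\pm2}$, there is exactly one linear connection $(D_{(0)},\sigma_0)$ with $\sigma_0(\xi^i\otimes\xi^j)=S^{ij}{}_{hk}\,\xi^h\otimes\xi^k$ and $D_{(0)}\xi=-\theta\otimes\xi+\sigma_0(\xi\otimes\theta)$, and it is compatible with $g_0$ only up to the conformal factor $\kappa$: $$S^{ij}{}_{hk}\,g^{kl}\,S^{mn}{}_{jl}=q^{\pm2}\,g^{im}\,\delta^n_h,$$ $$g_{0,23}\,\sigma_{0,12}\,\sigma_{0,23}(\omega\otimes\zeta)=\kappa\, g_0(\omega)\,\zeta,\qquad g_{0,23}(D_2\,\omega)=d\,g_0(\omega)+(\kappa-1)\,g_0(\omega)\,\theta$$ for all $\omega\in\Omega^1(\mathcal A)\otimes_{\mathcal A}\Omega^1(\mathcal A)$ and $\zeta\in\Omega^1(\mathcal A)$, while $g_{0,23}\circ D_2\neq d\circ g_0$. -/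

import Mathlib

open scoped TensorProduct

noncomputable section

set_option linter.unusedSectionVars false

/-! ## Bimodules over a complex algebra

A bimodule `M` over `A` carries a left action `a • m` and a right action
`m · a`, written `MulOpposite.op a • m`. -/

section Bimodules

variable (A : Type) [Ring A] [Algebra ℂ A]
variable (M : Type) [AddCommGroup M] [Module ℂ M] [Module A M] [Module Aᵐᵒᵖ M]
  [IsScalarTower ℂ A M] [IsScalarTower ℂ Aᵐᵒᵖ M] [SMulCommClass A Aᵐᵒᵖ M]
variable (N : Type) [AddCommGroup N] [Module ℂ N] [Module A N] [Module Aᵐᵒᵖ N]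
  [IsScalarTower ℂ A N] [IsScalarTower ℂ Aᵐᵒᵖ N] [SMulCommClass A Aᵐᵒᵖ N]
variable (P : Type) [AddCommGroup P] [Module ℂ P] [Module A P] [Module Aᵐᵒᵖ P]
  [IsScalarTower ℂ A P] [IsScalarTower ℂ Aᵐᵒᵖ P] [SMulCommClass A Aᵐᵒᵖ P]

/-- Maps of bimodules, that is `A`-bilinear maps. -/
@[ext]
structure BimodHom extends M →ₗ[A] N where
  map_right : ∀ (m : M) (a : A),
    toLinearMap (MulOpposite.op a • m) = MulOpposite.op a • toLinearMap m

instance BimodHom.instCoeFun : CoeFun (BimodHom A M N) (fun _ => M → N) :=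
  ⟨fun f => f.toLinearMap⟩

/-- The elements `m a ⊗ n - m ⊗ a n` span the kernel of `M ⊗_ℂ N → M ⊗_A N`. -/
def balancedSub : Submodule ℂ (M ⊗[ℂ] N) :=
  Submodule.span ℂ {t | ∃ (m : M) (a : A) (n : N),
    t = (MulOpposite.op a • m) ⊗ₜ[ℂ] n - m ⊗ₜ[ℂ] (a • n)}

/-- The tensor product `M ⊗_A N` of bimodules over the (noncommutative) algebra `A`. -/
def BTensor : Type := (M ⊗[ℂ] N) ⧸ balancedSub A M N

namespace BTensor

instance instAddCommGroup : AddCommGroup (BTensor A M N) :=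
  inferInstanceAs (AddCommGroup ((M ⊗[ℂ] N) ⧸ balancedSub A M N))

instance instModuleC : Module ℂ (BTensor A M N) :=
  inferInstanceAs (Module ℂ ((M ⊗[ℂ] N) ⧸ balancedSub A M N))

variable {M N P}

/-- The bilinear map `(m, n) ↦ m ⊗ n`. -/
def mk : M →ₗ[ℂ] N →ₗ[ℂ] BTensor A M N :=
  (TensorProduct.mk ℂ M N).compr₂ (balancedSub A M N).mkQ

theorem mk_balanced (m : M) (a : A) (n : N) :
    mk A (MulOpposite.op a • m) n = mk A m (a • n) :=
  (Submodule.Quotient.eq _).2 (Submodule.subset_span ⟨m, a, n, rfl⟩)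

variable {A}

/-- The universal property of `M ⊗_A N`. -/
def lift {Q : Type} [AddCommGroup Q] [Module ℂ Q] (f : M →ₗ[ℂ] N →ₗ[ℂ] Q)
    (hf : ∀ m (a : A) n, f (MulOpposite.op a • m) n = f m (a • n)) :
    BTensor A M N →ₗ[ℂ] Q :=
  (balancedSub A M N).liftQ (TensorProduct.lift f) (by
    refine Submodule.span_le.2 ?_
    rintro _ ⟨m, a, n, rfl⟩
    simp [hf])

@[simp]
theorem lift_mk {Q : Type} [AddCommGroup Q] [Module ℂ Q] (f : M →ₗ[ℂ] N →ₗ[ℂ] Q)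
    (hf : ∀ m (a : A) n, f (MulOpposite.op a • m) n = f m (a • n)) (m : M) (n : N) :
    lift f hf (mk A m n) = f m n := by
  change TensorProduct.lift f (m ⊗ₜ n) = f m n
  simp

theorem hom_ext {Q : Type} [AddCommGroup Q] [Module ℂ Q] {f g : BTensor A M N →ₗ[ℂ] Q}
    (h : ∀ m n, f (mk A m n) = g (mk A m n)) : f = g :=
  Submodule.linearMap_qext _ (TensorProduct.ext' h)

variable (A M N)

/-- Left multiplication `m ⊗ n ↦ a m ⊗ n`. -/
def leftAct (a : A) : BTensor A M N →ₗ[ℂ] BTensor A M N :=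
  lift ((mk A).comp (Algebra.lsmul ℂ ℂ M a)) (by
    intro m b n
    simp only [LinearMap.comp_apply, Algebra.lsmul_coe]
    rw [smul_comm, mk_balanced])

/-- Right multiplication `m ⊗ n ↦ m ⊗ n a`. -/
def rightAct (a : Aᵐᵒᵖ) : BTensor A M N →ₗ[ℂ] BTensor A M N :=
  lift ((mk A).compl₂ (Algebra.lsmul ℂ ℂ N a)) (by
    intro m b n
    simp only [LinearMap.compl₂_apply, Algebra.lsmul_coe]
    rw [mk_balanced, smul_comm b a n])

/-- The left action of `A` on `M ⊗_A N`, as a ring homomorphism. -/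
def leftHom : A →+* Module.End ℂ (BTensor A M N) where
  toFun := leftAct A M N
  map_one' := hom_ext fun m n => by simp [leftAct]
  map_mul' a b := hom_ext fun m n => by simp [leftAct]
  map_zero' := hom_ext fun m n => by simp [leftAct]
  map_add' a b := hom_ext fun m n => by simp [leftAct]

/-- The right action of `A` on `M ⊗_A N`, as a ring homomorphism. -/
def rightHom : Aᵐᵒᵖ →+* Module.End ℂ (BTensor A M N) where
  toFun := rightAct A M N
  map_one' := hom_ext fun m n => by simp [rightAct]
  map_mul' a b := hom_ext fun m n => by simp [rightAct]
  map_zero' := hom_ext fun m n => by simp [rightAct]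
  map_add' a b := hom_ext fun m n => by simp [rightAct]

instance instModuleLeft : Module A (BTensor A M N) :=
  Module.compHom _ (leftHom A M N)

instance instModuleRight : Module Aᵐᵒᵖ (BTensor A M N) :=
  Module.compHom _ (rightHom A M N)

variable {M N}

theorem smul_mk (a : A) (m : M) (n : N) : a • mk A m n = mk A (a • m) n := by
  change leftAct A M N a (mk A m n) = _
  simp [leftAct]

theorem op_smul_mk (a : Aᵐᵒᵖ) (m : M) (n : N) : a • mk A m n = mk A m (a • n) := by
  change rightAct A M N a (mk A m n) = _
  simp [rightAct]

variable (M N)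

instance instTowerLeft : IsScalarTower ℂ A (BTensor A M N) where
  smul_assoc c a t := by
    change leftAct A M N (c • a) t = (c • leftAct A M N a) t
    congr 1
    exact hom_ext fun m n => by simp [leftAct]

instance instTowerRight : IsScalarTower ℂ Aᵐᵒᵖ (BTensor A M N) where
  smul_assoc c a t := by
    change rightAct A M N (c • a) t = (c • rightAct A M N a) t
    congr 1
    exact hom_ext fun m n => by simp [rightAct]

instance instSMulComm : SMulCommClass A Aᵐᵒᵖ (BTensor A M N) where
  smul_comm a b t := by
    change (leftAct A M N a ∘ₗ rightAct A M N b) t = (rightAct A M N b ∘ₗ leftAct A M N a) t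
    congr 1
    exact hom_ext fun m n => by simp [leftAct, rightAct]

variable {M N} {A}

/-- The associator `M ⊗_A (N ⊗_A P) → (M ⊗_A N) ⊗_A P`. -/
def assocInv : BTensor A M (BTensor A N P) →ₗ[ℂ] BTensor A (BTensor A M N) P :=
  lift (LinearMap.mk₂ ℂ
      (fun (m : M) (t : BTensor A N P) =>
        lift (A := A) (Q := BTensor A (BTensor A M N) P) ((mk A).comp (mk A m))
          (by
            intro n a p
            simp only [LinearMap.comp_apply]
            rw [← op_smul_mk, mk_balanced]) t)
      (by
        intro m m' t
        rw [← LinearMap.add_apply]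
        congr 1
        exact hom_ext fun n p => by simp)
      (by
        intro c m t
        rw [← LinearMap.smul_apply]
        congr 1
        exact hom_ext fun n p => by simp)
      (by intros; simp) (by intros; simp))
    (by
      intro m a t
      simp only [LinearMap.mk₂_apply]
      change _ = ((lift (A := A) (Q := BTensor A (BTensor A M N) P) ((mk A).comp (mk A m))
        (by
          intro n a p
          simp only [LinearMap.comp_apply]
          rw [← op_smul_mk, mk_balanced])) ∘ₗ leftAct A N P a) t
      congr 1
      exact hom_ext fun n p => by simp [leftAct, mk_balanced])

@[simp]
theorem assocInv_mk (m : M) (n : N) (p : P) :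
    assocInv (mk A m (mk A n p)) = mk A (mk A m n) p := by
  simp [assocInv]

/-- The map `m ⊗ n ↦ (p ↦ m ⊗ (n ⊗ p))`. -/
def assocAux : BTensor A M N →ₗ[ℂ] P →ₗ[ℂ] BTensor A M (BTensor A N P) :=
  lift (A := A) (Q := P →ₗ[ℂ] BTensor A M (BTensor A N P))
    (LinearMap.mk₂ ℂ (fun (m : M) (n : N) => (mk A m).comp (mk A n))
      (by intros; ext; simp) (by intros; ext; simp)
      (by intros; ext; simp) (by intros; ext; simp))
    (by
      intro m a n
      ext p
      simp [mk_balanced, smul_mk])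

/-- The associator `(M ⊗_A N) ⊗_A P → M ⊗_A (N ⊗_A P)`. -/
def assoc : BTensor A (BTensor A M N) P →ₗ[ℂ] BTensor A M (BTensor A N P) :=
  lift assocAux (by
    intro t a p
    change (assocAux.flip p ∘ₗ rightAct A M N (MulOpposite.op a)) t = assocAux.flip (a • p) t
    congr 1
    exact hom_ext fun m n => by simp [assocAux, rightAct, mk_balanced])

@[simp]
theorem assoc_mk (m : M) (n : N) (p : P) :
    assoc (mk A (mk A m n) p) = mk A m (mk A n p) := by
  simp [assoc, assocAux]

/-- `f ⊗ 1`. -/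
def mapLeft {M' : Type} [AddCommGroup M'] [Module ℂ M'] [Module A M'] [Module Aᵐᵒᵖ M']
    [IsScalarTower ℂ A M'] [IsScalarTower ℂ Aᵐᵒᵖ M'] [SMulCommClass A Aᵐᵒᵖ M']
    (f : BimodHom A M M') : BTensor A M N →ₗ[ℂ] BTensor A M' N :=
  lift ((mk A).comp (f.toLinearMap.restrictScalars ℂ)) (by
    intro m a n
    simp [f.map_right, mk_balanced])

@[simp]
theorem mapLeft_mk {M' : Type} [AddCommGroup M'] [Module ℂ M'] [Module A M'] [Module Aᵐᵒᵖ M']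
    [IsScalarTower ℂ A M'] [IsScalarTower ℂ Aᵐᵒᵖ M'] [SMulCommClass A Aᵐᵒᵖ M']
    (f : BimodHom A M M') (m : M) (n : N) : mapLeft f (mk A m n) = mk A (f m) n :=
  lift_mk _ _ m n

/-- `1 ⊗ f`. -/
def mapRight {N' : Type} [AddCommGroup N'] [Module ℂ N'] [Module A N'] [Module Aᵐᵒᵖ N']
    [IsScalarTower ℂ A N'] [IsScalarTower ℂ Aᵐᵒᵖ N'] [SMulCommClass A Aᵐᵒᵖ N']
    (f : BimodHom A N N') : BTensor A M N →ₗ[ℂ] BTensor A M N' :=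
  lift ((mk A).compl₂ (f.toLinearMap.restrictScalars ℂ)) (by
    intro m a n
    simp [mk_balanced])

end BTensor

end Bimodules

/-! ## Metrics and linear connections

Here `M` is the bimodule of 1-forms over `A`, and `d : A → M` is the differential. -/

section Connections

variable (A : Type) [Ring A] [Algebra ℂ A]
variable (M : Type) [AddCommGroup M] [Module ℂ M] [Module A M] [Module Aᵐᵒᵖ M]
  [IsScalarTower ℂ A M] [IsScalarTower ℂ Aᵐᵒᵖ M] [SMulCommClass A Aᵐᵒᵖ M]

/-- A metric is an `A`-bilinear map `M ⊗_A M → A`. -/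
abbrev Metric : Type := BimodHom A (BTensor A M M) A

variable {A M}

/-- `g₂₃ : M ⊗_A M ⊗_A M → M`, `α ⊗ β ⊗ γ ↦ α · g(β ⊗ γ)`. -/
def Metric.g₂₃ (g : Metric A M) : BTensor A (BTensor A M M) M →ₗ[ℂ] M :=
  (BTensor.lift (A := A) (M := M) (N := A)
      (LinearMap.mk₂ ℂ (fun (m : M) (a : A) => MulOpposite.op a • m)
        (by intros; simp) (by intros; exact smul_comm _ _ _)
        (by intros; simp [add_smul]) (by intros; simp))
      (by intros; simp [mul_smul])) ∘ₗ
    BTensor.mapRight g ∘ₗ BTensor.assoc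

/-- A linear connection with its generalized flip. -/
@[ext]
structure LinearConnection (d : A →ₗ[ℂ] M) where
  D : M →ₗ[ℂ] BTensor A M M
  σ : BimodHom A (BTensor A M M) (BTensor A M M)
  left_leibniz : ∀ (f : A) (ξ : M), D (f • ξ) = BTensor.mk A (d f) ξ + f • D ξ
  right_leibniz : ∀ (f : A) (ξ : M),
    D (MulOpposite.op f • ξ) = σ (BTensor.mk A ξ (d f)) + MulOpposite.op f • D ξ

namespace LinearConnection

variable {d : A →ₗ[ℂ] M} (C : LinearConnection d)

/-- `σ₁₂` on `M ⊗_A M ⊗_A M`. -/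
def σ₁₂ : BTensor A (BTensor A M M) M →ₗ[ℂ] BTensor A (BTensor A M M) M :=
  BTensor.mapLeft C.σ

/-- `σ₂₃` on `M ⊗_A M ⊗_A M`. -/
def σ₂₃ : BTensor A (BTensor A M M) M →ₗ[ℂ] BTensor A (BTensor A M M) M :=
  BTensor.assocInv ∘ₗ BTensor.mapRight C.σ ∘ₗ BTensor.assoc

/-- The extension `D₂ (ξ ⊗ η) = D ξ ⊗ η + σ₁₂ (ξ ⊗ D η)` of `D` to `M ⊗_A M`. -/
def D₂ : BTensor A M M →ₗ[ℂ] BTensor A (BTensor A M M) M :=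
  BTensor.lift
    ((BTensor.mk A).comp C.D + ((BTensor.mk A).compl₂ C.D).compr₂ (C.σ₁₂ ∘ₗ BTensor.assocInv))
    (by
      intro ξ f η
      have key : BTensor.assocInv (BTensor.mk A ξ (f • C.D η)) =
          BTensor.assocInv (BTensor.mk A (MulOpposite.op f • ξ) (C.D η)) := by
        rw [BTensor.mk_balanced]
      simp only [LinearMap.add_apply, LinearMap.comp_apply, LinearMap.compr₂_apply,
        LinearMap.compl₂_apply, C.left_leibniz, C.right_leibniz, map_add, key,
        BTensor.assocInv_mk, σ₁₂, BTensor.mapLeft_mk]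
      rw [BTensor.mk_balanced A (C.D ξ) f η]
      abel)

/-- Metric compatibility: `g₂₃ ∘ D₂ = d ∘ g`. -/
def IsCompatible (g : Metric A M) : Prop :=
  ∀ ω : BTensor A M M, g.g₂₃ (C.D₂ ω) = d (g ω)

end LinearConnection

end Connections

/-! ## The quantum Euclidean space and its differential calculus

The index set `{-, 0, +}` is `Fin 3`, with `0 : Fin 3` for `-`, `1 : Fin 3` for `0` and
`2 : Fin 3` for `+`. -/

namespace QEuclid

variable (q : ℝ)

/-- `√q` as a complex number. -/
def sq : ℂ := ((Real.sqrt q : ℝ) : ℂ)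

/-- `h = √q - 1/√q`. -/
def h : ℂ := sq q - (sq q)⁻¹

/-- The covariant metric matrix `g_{ij} = g^{ij}`. -/
def gMat : Matrix (Fin 3) (Fin 3) ℂ :=
  !![0, 0, (sq q)⁻¹;
     0, 1, 0;
     sq q, 0, 0]

/-- Coefficient vectors of the three quadratic relations
`x⁻ x⁰ - q x⁰ x⁻`, `x⁺ x⁰ - q⁻¹ x⁰ x⁺`, `x⁺ x⁻ - x⁻ x⁺ - h (x⁰)²`; they are pairwise orthogonal. -/
def antiVec : Fin 3 → Fin 3 × Fin 3 → ℂ :=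
  ![Pi.single (0, 1) 1 - Pi.single (1, 0) (q : ℂ),
    Pi.single (2, 1) 1 - Pi.single (1, 2) (q : ℂ)⁻¹,
    Pi.single (2, 0) 1 - Pi.single (0, 2) 1 - Pi.single (1, 1) (h q)]

/-- The projector `P_a`: the orthogonal projector onto the span of the relations. -/
def Pa : Matrix (Fin 3 × Fin 3) (Fin 3 × Fin 3) ℂ :=
  ∑ a, (antiVec q a ⬝ᵥ antiVec q a)⁻¹ • Matrix.vecMulVec (antiVec q a) (antiVec q a)

/-- The trace projector `P_t`, proportional to `g^{ij} g_{kl}`. -/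
def Pt : Matrix (Fin 3 × Fin 3) (Fin 3 × Fin 3) ℂ :=
  Matrix.of fun ij kl => (∑ m, ∑ n, gMat q m n * gMat q m n)⁻¹ *
    (gMat q ij.1 ij.2 * gMat q kl.1 kl.2)

/-- The symmetric trace-free projector `P_s`. -/
def Ps : Matrix (Fin 3 × Fin 3) (Fin 3 × Fin 3) ℂ := 1 - Pa q - Pt q

/-- The braid matrix of `SO_q(3)`; `Rhat q (i, j) (h, k)` is `R̂^{ij}_{hk}`. -/
def Rhat : Matrix (Fin 3 × Fin 3) (Fin 3 × Fin 3) ℂ :=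
  (q : ℂ) • Ps q - (q : ℂ)⁻¹ • Pa q + ((q : ℂ) ^ 2)⁻¹ • Pt q

/-- Generators: coordinates `x^i`, the inverse of `r²`, the dilatation `Λ` and its inverse. -/
inductive Gen : Type
  | x (i : Fin 3)
  | rInv
  | lam
  | lamInv

/-- A generator in the free algebra. -/
abbrev ι (s : Gen) : FreeAlgebra ℂ Gen := FreeAlgebra.ι ℂ s

/-- `r² = g_{ij} x^i x^j` in the free algebra. -/
def freeR2 : FreeAlgebra ℂ Gen := ∑ i, ∑ j, gMat q i j • (ι (.x i) * ι (.x j))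

/-- Defining relations of the algebra. -/
inductive Rel : FreeAlgebra ℂ Gen → FreeAlgebra ℂ Gen → Prop
  | minus_zero : Rel (ι (.x 0) * ι (.x 1)) ((q : ℂ) • (ι (.x 1) * ι (.x 0)))
  | plus_zero : Rel (ι (.x 2) * ι (.x 1)) ((q : ℂ)⁻¹ • (ι (.x 1) * ι (.x 2)))
  | plus_minus : Rel (ι (.x 2) * ι (.x 0) - ι (.x 0) * ι (.x 2)) (h q • ι (.x 1) ^ 2)
  | r2_rInv : Rel (freeR2 q * ι .rInv) 1
  | rInv_r2 : Rel (ι .rInv * freeR2 q) 1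
  | x_lam (i : Fin 3) : Rel (ι (.x i) * ι .lam) ((q : ℂ) • (ι .lam * ι (.x i)))
  | lam_lamInv : Rel (ι .lam * ι .lamInv) 1
  | lamInv_lam : Rel (ι .lamInv * ι .lam) 1

/-- The algebra of functions on the quantum Euclidean space `ℝ_q³`, with `r⁻²` and extended by
the dilatation generator and its inverse. -/
def Alg : Type := RingQuot (Rel q)

instance instRingAlg : Ring (Alg q) := inferInstanceAs (Ring (RingQuot (Rel q)))

instance instAlgebraAlg : Algebra ℂ (Alg q) := inferInstanceAs (Algebra ℂ (RingQuot (Rel q)))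

/-- The class of a generator. -/
def gen (s : Gen) : Alg q := RingQuot.mkAlgHom ℂ (Rel q) (ι s)

/-- The coordinate `x^i`. -/
def x (i : Fin 3) : Alg q := gen q (.x i)

/-- The dilatation generator `Λ`. -/
def lam : Alg q := gen q .lam

/-- `r² = g_{ij} x^i x^j`. -/
def r2 : Alg q := ∑ i, ∑ j, gMat q i j • (x q i * x q j)

/-- `r⁻²`. -/
def rInv2 : Alg q := gen q .rInv

/-- The enveloping algebra; its left modules are the bimodules over `Alg q`. -/
def Env : Type := Alg q ⊗[ℂ] (Alg q)ᵐᵒᵖ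

instance instRingEnv : Ring (Env q) := inferInstanceAs (Ring (Alg q ⊗[ℂ] (Alg q)ᵐᵒᵖ))

instance instAlgebraEnv : Algebra ℂ (Env q) :=
  inferInstanceAs (Algebra ℂ (Alg q ⊗[ℂ] (Alg q)ᵐᵒᵖ))

/-- Left multiplication by an element of the algebra. -/
def inL : Alg q →ₐ[ℂ] Env q :=
  (Algebra.TensorProduct.includeLeft : Alg q →ₐ[ℂ] Alg q ⊗[ℂ] (Alg q)ᵐᵒᵖ)

/-- Right multiplication by an element of the algebra. -/
def inR : (Alg q)ᵐᵒᵖ →ₐ[ℂ] Env q :=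
  (Algebra.TensorProduct.includeRight : (Alg q)ᵐᵒᵖ →ₐ[ℂ] Alg q ⊗[ℂ] (Alg q)ᵐᵒᵖ)

theorem inL_mul_inR (a : Alg q) (b : (Alg q)ᵐᵒᵖ) : inL q a * inR q b = inR q b * inL q a := by
  change (a ⊗ₜ[ℂ] (1 : (Alg q)ᵐᵒᵖ)) * ((1 : Alg q) ⊗ₜ[ℂ] b) =
    ((1 : Alg q) ⊗ₜ[ℂ] b) * (a ⊗ₜ[ℂ] (1 : (Alg q)ᵐᵒᵖ))
  simp [Algebra.TensorProduct.tmul_mul_tmul]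

/-- The symbol `d f` in the free bimodule on all such symbols. -/
abbrev symb (f : Alg q) : Alg q →₀ Env q := Finsupp.single f 1

/-- Defining relations of the bimodule of 1-forms: `d` is a `ℂ`-linear derivation,
`x^i dx^j = q R̂^{ij}_{kl} dx^k x^l`, and `dΛ = 0`. -/
inductive FormRel : (Alg q →₀ Env q) → Prop
  | add (f g : Alg q) : FormRel (symb q (f + g) - symb q f - symb q g)
  | smul (c : ℂ) (f : Alg q) : FormRel (symb q (c • f) - c • symb q f)
  | leibniz (f g : Alg q) :
      FormRel (symb q (f * g) - inR q (.op g) • symb q f - inL q f • symb q g)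
  | comm (i j : Fin 3) :
      FormRel (inL q (x q i) • symb q (x q j) -
        ∑ k, ∑ l, ((q : ℂ) * Rhat q (i, j) (k, l)) • inR q (.op (x q l)) • symb q (x q k))
  | lam : FormRel (symb q (lam q))

/-- The sub-bimodule spanned by the relations. -/
def formSub : Submodule (Env q) (Alg q →₀ Env q) := Submodule.span (Env q) {t | FormRel q t}

/-- The bimodule `Ω¹` of 1-forms. -/
def Form : Type := (Alg q →₀ Env q) ⧸ formSub q

instance instAddCommGroupForm : AddCommGroup (Form q) :=
  inferInstanceAs (AddCommGroup ((Alg q →₀ Env q) ⧸ formSub q))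

instance instModuleEnv : Module (Env q) (Form q) :=
  inferInstanceAs (Module (Env q) ((Alg q →₀ Env q) ⧸ formSub q))

instance instModuleC : Module ℂ (Form q) :=
  Module.compHom _ (algebraMap ℂ (Env q))

instance instModuleLeft : Module (Alg q) (Form q) :=
  Module.compHom _ (inL q).toRingHom

instance instModuleRight : Module (Alg q)ᵐᵒᵖ (Form q) :=
  Module.compHom _ (inR q).toRingHom

instance instTowerLeft : IsScalarTower ℂ (Alg q) (Form q) where
  smul_assoc c a t := by
    change inL q (c • a) • t = algebraMap ℂ (Env q) c • inL q a • t
    rw [← mul_smul, ← Algebra.smul_def, map_smul]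

instance instTowerRight : IsScalarTower ℂ (Alg q)ᵐᵒᵖ (Form q) where
  smul_assoc c a t := by
    change inR q (c • a) • t = algebraMap ℂ (Env q) c • inR q a • t
    rw [← mul_smul, ← Algebra.smul_def, map_smul]

instance instSMulComm : SMulCommClass (Alg q) (Alg q)ᵐᵒᵖ (Form q) where
  smul_comm a b t := by
    change inL q a • inR q b • t = inR q b • inL q a • t
    rw [← mul_smul, ← mul_smul, inL_mul_inR]

/-- The projection from the free bimodule. -/
def formMk : (Alg q →₀ Env q) →ₗ[Env q] Form q := (formSub q).mkQ

theorem formMk_eq_zero {t : Alg q →₀ Env q} (ht : FormRel q t) : formMk q t = 0 :=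
  (Submodule.Quotient.mk_eq_zero _).2 (Submodule.subset_span ht)

/-- The differential. -/
def d : Alg q →ₗ[ℂ] Form q where
  toFun f := formMk q (symb q f)
  map_add' f g := by
    have := formMk_eq_zero q (FormRel.add f g)
    rwa [sub_sub, map_sub, map_add, sub_eq_zero] at this
  map_smul' c f := by
    change _ = algebraMap ℂ (Env q) c • formMk q (symb q f)
    have := formMk_eq_zero q (FormRel.smul c f)
    rwa [map_sub, sub_eq_zero, ← algebraMap_smul (Env q) c (symb q f), map_smul] at this

/-- `ξ^i = dx^i`. -/
def xi (i : Fin 3) : Form q := d q (x q i)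

/-- The tensor product of two 1-forms over the algebra. -/
abbrev tens (ξ η : Form q) : BTensor (Alg q) (Form q) (Form q) := BTensor.mk (Alg q) ξ η

/-- The `Dirac operator' `θ = (q - 1)⁻¹ q² r⁻² x^i ξ^j g_{ij}`. -/
def theta : Form q :=
  (((q : ℂ) - 1)⁻¹ * (q : ℂ) ^ 2) • ∑ i, ∑ j, gMat q i j • (rInv2 q * x q i) • xi q j

/-- `C` is the connection `D₍₀₎` attached to the matrix `S`:
`σ₀ (ξ^i ⊗ ξ^j) = S^{ij}_{hk} ξ^h ⊗ ξ^k` and `D₍₀₎ ξ = -θ ⊗ ξ + σ₀ (ξ ⊗ θ)`. -/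
def IsD0 (S : Matrix (Fin 3 × Fin 3) (Fin 3 × Fin 3) ℂ) (C : LinearConnection (d q)) : Prop :=
  (∀ i j, C.σ (tens q (xi q i) (xi q j)) =
    ∑ h, ∑ k, S (i, j) (h, k) • tens q (xi q h) (xi q k)) ∧
  ∀ ξ, C.D ξ = -tens q (theta q) ξ + C.σ (tens q ξ (theta q))

end QEuclid

end

/-!
Let `ξ^-, ξ^0, ξ^+` be the differentials of the coordinates. The relation `x^i ξ^j = q R̂ ξ x`
says how a coordinate moves past a differential, `Λ` moves past it with the factor `q⁻¹`, and
these rules respect all relations of the function algebra `A`; they therefore define a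
homomorphism `comm : A → M₃(A)` with `a ξ^j = ∑ₖ ξ^k comm(a)_{kj}`. On the free right module `⊕ₖ
ξ^k A`, with the left action through `comm`, the commutator with `θ` is a derivation that kills
`Λ` and sends `x^i` to `ξ^i`. By the universal property this gives coordinates on the 1-forms
(`coord`), whence the 1-forms are this free module (`eq_sum_xi`), and the differential is the
commutator with `θ` (`d_eq_commutator`). In the same way the tensor square is free on the `ξ^i ⊗
ξ^j` (`eq_sum_xiTens`), and a bimodule map out of it is the same as a family of values that obeys
the commutation rules of the basis (`tensLift`).

*Existence.* The values `g^{ij} r² Λ²` obey these rules because the metric matrix is invariant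
under two successive braidings (`gMat_invariant`), and the values `S^{ij}_{hk} ξ^h ⊗ ξ^k` with `S
= (q R̂)^{±1}` obey them by the braid relation (`qRhat_braid`). This gives the metric `metric₀`
and the flip `flip₀`. Since `d` is the commutator with `θ`, the formula `D ξ = -θ ⊗ ξ + σ(ξ ⊗ θ)`
is then automatically a connection (`commutatorConnection`). In `D₂(ξ ⊗ η)` the two middle terms
cancel and `-θ ⊗ ξ ⊗ η + σ₁₂ σ₂₃ (ξ ⊗ η ⊗ θ)` remains. Moving the metric matrix through `S`
produces `κ = q^{±2}` (`metric_through_qRhat`), so that `g₂₃ D₂ ω = -θ g(ω) + κ g(ω) θ = d g(ω) +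
(κ - 1) g(ω) θ`. The defect does not vanish: `r² Λ²` is invertible, `κ ≠ 1`, and `θ ≠ 0`.

*Uniqueness of the metric.* The commutation rules of a metric `g` with `Λ`, `r²`, `x⁰` and `x⁺`
are solved in the basis of monomials `(x⁰)^b r^{2n} v^k Λ^m`, where `v^k` is a power of `x⁺` or of
`x⁻`. Left multiplications are realised by explicit operators on the space `Mon` with this basis
(`rep`), which is faithful (`monCoord_injective`); right multiplications are the operators that
commute with them. Every component of `g` turns out to have degree two in the coordinates and in
`Λ`. The rule for `x⁺` kills the components of positive weight (`metric_eq_zero_of_plusFactor`),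
the rules for `x⁰` then express all components by `g(ξ⁰ ⊗ ξ⁰)` as in `g^{ij}`
(`metric_eq_smul_gMat`), and this last component must be a multiple of `r² Λ²` (`eq_smul_weight`).
-/

noncomputable section

set_option linter.unusedSectionVars false

namespace QEuclid

variable (q : ℝ)

/-! ### The braid matrix in coordinates -/

/-- The nonzero entries of `q R̂`: the entry of `qRhatTable q i j` at `(k, l)` is
`q R̂^{ij}_{kl}`. -/
def qRhatTable : Fin 3 → Fin 3 → Matrix (Fin 3) (Fin 3) ℂ :=
  ![![!![(q : ℂ) ^ 2, 0, 0; 0, 0, 0; 0, 0, 0],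
      !![0, (q : ℂ) ^ 2 - 1, 0; (q : ℂ), 0, 0; 0, 0, 0],
      !![0, 0, h q ^ 2 * (q + 1); 0, -(h q * (q + 1)), 0; 1, 0, 0]],
    ![!![0, (q : ℂ), 0; 0, 0, 0; 0, 0, 0],
      !![0, 0, -(h q * (q + 1)); 0, (q : ℂ), 0; 0, 0, 0],
      !![0, 0, 0; 0, 0, (q : ℂ) ^ 2 - 1; 0, (q : ℂ), 0]],
    ![!![0, 0, 1; 0, 0, 0; 0, 0, 0],
      !![0, 0, 0; 0, 0, (q : ℂ); 0, 0, 0],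
      !![0, 0, 0; 0, 0, 0; 0, 0, (q : ℂ) ^ 2]]]

/-- The entries of `(q R̂)⁻¹`, indexed as in `qRhatTable`. -/
def qRhatInvTable : Fin 3 → Fin 3 → Matrix (Fin 3) (Fin 3) ℂ :=
  ![![!![((q : ℂ) ^ 2)⁻¹, 0, 0; 0, 0, 0; 0, 0, 0],
      !![0, 0, 0; (q : ℂ)⁻¹, 0, 0; 0, 0, 0],
      !![0, 0, 0; 0, 0, 0; 1, 0, 0]],
    ![!![0, (q : ℂ)⁻¹, 0; ((q : ℂ) ^ 2)⁻¹ - 1, 0, 0; 0, 0, 0],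
      !![0, 0, 0; 0, (q : ℂ)⁻¹, 0; h q * (1 + q) * (q : ℂ)⁻¹, 0, 0],
      !![0, 0, 0; 0, 0, 0; 0, (q : ℂ)⁻¹, 0]],
    ![!![0, 0, 1; 0, h q * (1 + q) * (q : ℂ)⁻¹, 0; h q ^ 2 * (1 + q) * (q : ℂ)⁻¹, 0, 0],
      !![0, 0, 0; 0, 0, (q : ℂ)⁻¹; 0, ((q : ℂ) ^ 2)⁻¹ - 1, 0],
      !![0, 0, 0; 0, 0, 0; 0, 0, ((q : ℂ) ^ 2)⁻¹]]]

/-- The matrix on pairs of indices with the given table of entries. -/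
def pairMatrix (t : Fin 3 → Fin 3 → Matrix (Fin 3) (Fin 3) ℂ) :
    Matrix (Fin 3 × Fin 3) (Fin 3 × Fin 3) ℂ :=
  Matrix.of fun ij kl => t ij.1 ij.2 kl.1 kl.2

/-- The three coefficient vectors as matrices. -/
def antiTable : Fin 3 → Matrix (Fin 3) (Fin 3) ℂ :=
  ![!![0, 1, 0; -(q : ℂ), 0, 0; 0, 0, 0],
    !![0, 0, 0; 0, 0, -(q : ℂ)⁻¹; 0, 1, 0],
    !![0, 0, -1; 0, -h q, 0; 1, 0, 0]]

section Scalars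

variable {q}

theorem sq_sq (hq : 0 < q) : sq q ^ 2 = (q : ℂ) := by
  rw [sq, ← Complex.ofReal_pow, Real.sq_sqrt hq.le]

theorem sq_ne_zero (hq : 0 < q) : sq q ≠ 0 :=
  Complex.ofReal_ne_zero.2 (Real.sqrt_pos.2 hq).ne'

theorem q_ne_zero (hq : 0 < q) : (q : ℂ) ≠ 0 := Complex.ofReal_ne_zero.2 hq.ne'

theorem q_sub_one_ne_zero (hq1 : q ≠ 1) : (q : ℂ) - 1 ≠ 0 :=
  sub_ne_zero.2 (by exact_mod_cast hq1)

theorem q_add_one_ne_zero (hq : 0 < q) : (q : ℂ) + 1 ≠ 0 := by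
  exact_mod_cast (by positivity : q + 1 ≠ 0)

theorem sq_add_inv_ne_zero (hq : 0 < q) : sq q + (sq q)⁻¹ ≠ 0 := by
  have h0 := sq_ne_zero hq
  have h1 := q_add_one_ne_zero hq
  rw [← sq_sq hq] at h1
  intro h
  field_simp at h
  rw [mul_zero] at h
  exact h1 h

theorem q_zpow_injective (hq : 0 < q) (hq1 : q ≠ 1) {m n : ℤ} (h : (q : ℂ) ^ m = (q : ℂ) ^ n) :
    m = n := by
  refine zpow_right_injective₀ hq hq1 ?_
  exact_mod_cast h

theorem dot_antiVec_zero : antiVec q 0 ⬝ᵥ antiVec q 0 = 1 + (q : ℂ) ^ 2 := by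
  simp [antiVec, dotProduct, Fintype.sum_prod_type, Fin.sum_univ_three, Pi.single_apply]
  ring

theorem dot_antiVec_one : antiVec q 1 ⬝ᵥ antiVec q 1 = 1 + ((q : ℂ)⁻¹) ^ 2 := by
  simp [antiVec, dotProduct, Fintype.sum_prod_type, Fin.sum_univ_three, Pi.single_apply]
  ring

theorem dot_antiVec_two : antiVec q 2 ⬝ᵥ antiVec q 2 = 2 + h q ^ 2 := by
  simp [antiVec, dotProduct, Fintype.sum_prod_type, Fin.sum_univ_three, Pi.single_apply]
  ring

theorem antiVec_eq (q : ℝ) (a i j : Fin 3) : antiVec q a (i, j) = antiTable q a i j := by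
  fin_cases a <;> fin_cases i <;> fin_cases j <;> simp [antiVec, antiTable]

theorem smul_Rhat (hq : 0 < q) : (q : ℂ) • Rhat q = pairMatrix (qRhatTable q) := by
  have h0 := sq_ne_zero hq
  have e := sq_sq hq
  have e' : sq q ^ 4 = (q : ℂ) ^ 2 := by rw [← e]; ring
  have h1 : 1 + sq q ^ 4 ≠ 0 := by
    rw [e']; exact_mod_cast (by positivity : 1 + q ^ 2 ≠ 0)
  have h2 : 1 + sq q ^ 2 + sq q ^ 4 ≠ 0 := by
    rw [e', e]; exact_mod_cast (by positivity : 1 + q + q ^ 2 ≠ 0)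
  have h3 : (2 + (sq q - (sq q)⁻¹) ^ 2)⁻¹ = sq q ^ 2 * (1 + sq q ^ 4)⁻¹ := by
    rw [show 2 + (sq q - (sq q)⁻¹) ^ 2 = (1 + sq q ^ 4) * (sq q ^ 2)⁻¹ by field_simp; ring,
      mul_inv, inv_inv, mul_comm]
  have h4 : (1 + ((sq q ^ 2)⁻¹) ^ 2)⁻¹ = sq q ^ 4 * (1 + sq q ^ 4)⁻¹ := by
    rw [show 1 + ((sq q ^ 2)⁻¹) ^ 2 = (1 + sq q ^ 4) * (sq q ^ 4)⁻¹ by field_simp; ring,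
      mul_inv, inv_inv, mul_comm]
  have h5 : (1 + (sq q ^ 2) ^ 2)⁻¹ = (1 + sq q ^ 4)⁻¹ := by ring_nf
  have ht : (∑ m, ∑ n, gMat q m n * gMat q m n)⁻¹ =
      sq q ^ 2 * (1 + sq q ^ 2 + sq q ^ 4)⁻¹ := by
    rw [show ∑ m, ∑ n, gMat q m n * gMat q m n =
        (1 + sq q ^ 2 + sq q ^ 4) * (sq q ^ 2)⁻¹ by
      simp [gMat, Fin.sum_univ_three]; field_simp, mul_inv, inv_inv, mul_comm]
  obtain ⟨u, hu⟩ : ∃ u, u = (1 + sq q ^ 4)⁻¹ := ⟨_, rfl⟩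
  obtain ⟨v, hv⟩ : ∃ v, v = (1 + sq q ^ 2 + sq q ^ 4)⁻¹ := ⟨_, rfl⟩
  have key : ∀ i j k l, ((q : ℂ) • Rhat q) (i, j) (k, l) = qRhatTable q i j k l := by
    intro i j k l
    have e1 : Rhat q (i, j) (k, l) =
      (q : ℂ) * (if i = k ∧ j = l then 1 else 0) - (q + (q : ℂ)⁻¹) *
        (u * (antiTable q 0 i j * antiTable q 0 k l) +
        sq q ^ 4 * u * (antiTable q 1 i j * antiTable q 1 k l) +
        sq q ^ 2 * u * (antiTable q 2 i j * antiTable q 2 k l)) +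
        (((q : ℂ) ^ 2)⁻¹ - q) * (sq q ^ 2 * v * (gMat q i j * gMat q k l)) := by
      simp only [Rhat, Ps, Pa, Pt, Fin.sum_univ_three (f := fun a =>
        (antiVec q a ⬝ᵥ antiVec q a)⁻¹ •
        Matrix.vecMulVec (antiVec q a) (antiVec q a)), dot_antiVec_zero, dot_antiVec_one,
        dot_antiVec_two, ht, Matrix.smul_apply, Matrix.sub_apply, Matrix.add_apply,
        Matrix.vecMulVec_apply, Matrix.of_apply, smul_eq_mul, antiVec_eq, Matrix.one_apply,
        Prod.mk.injEq, ← hv]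
      simp only [h, ← e, h3, h4, h5, ← hu]
      ring
    rw [Matrix.smul_apply, smul_eq_mul, e1]
    clear e1 ht h3 h4 h5 e'
    rw [hu, hv, ← e]
    fin_cases i <;> fin_cases j <;> fin_cases k <;> fin_cases l <;>
      simp only [qRhatTable, antiTable, gMat, h, ← e, Matrix.cons_val, Matrix.of_apply, Fin.isValue,
        Fin.reduceFinMk, Fin.zero_eta, Fin.mk_one, Fin.reduceEq, and_true, and_false, ite_true,
        ite_false, mul_zero, zero_mul, add_zero, sub_zero]
    all_goals first | rfl | (field_simp; done) | (field_simp; ring)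
  ext ⟨i, j⟩ ⟨k, l⟩
  exact key i j k l

theorem pairMatrix_mul_inv (hq : 0 < q) :
    pairMatrix (qRhatTable q) * pairMatrix (qRhatInvTable q) = 1 := by
  have h0 := q_ne_zero hq
  have key : ∀ i j k l, (pairMatrix (qRhatTable q) * pairMatrix (qRhatInvTable q)) (i, j) (k, l) =
      if i = k ∧ j = l then 1 else 0 := by
    intro i j k l
    simp only [Matrix.mul_apply, Fintype.sum_prod_type, Fin.sum_univ_three, pairMatrix,
      Matrix.of_apply]
    fin_cases i <;> fin_cases j <;> fin_cases k <;> fin_cases l <;>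
      simp only [qRhatTable, qRhatInvTable, Matrix.cons_val, Matrix.of_apply, Fin.isValue,
        Fin.reduceFinMk, Fin.zero_eta, Fin.mk_one, Fin.reduceEq, and_true, and_false, ite_true,
        ite_false, mul_zero, zero_mul, add_zero, zero_add, mul_one, one_mul]
    all_goals first | rfl | (field_simp; done) | (field_simp; ring)
  ext ⟨i, j⟩ ⟨k, l⟩
  rw [key, Matrix.one_apply]
  simp only [Prod.mk.injEq]

theorem inv_smul_Rhat (hq : 0 < q) :
    ((q : ℂ) • Rhat q)⁻¹ = pairMatrix (qRhatInvTable q) := by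
  rw [smul_Rhat hq]
  exact Matrix.inv_eq_right_inv (pairMatrix_mul_inv hq)

/-- Moving the metric matrix through `S = (q R̂)^{±1}` costs the factor `q^{±2}`. -/
theorem metric_through_qRhat (hq : 0 < q) (i a m n : Fin 3) :
    ∑ j, ∑ k, ∑ l, qRhatTable q i j a k * gMat q k l * qRhatTable q m n j l =
      (q : ℂ) ^ 2 * gMat q i m * (if n = a then 1 else 0) := by
  have h0 := sq_ne_zero hq
  have e := sq_sq hq
  simp only [Fin.sum_univ_three]
  fin_cases i <;> fin_cases a <;> fin_cases m <;> fin_cases n <;>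
    simp only [qRhatTable, gMat, h, ← e, Matrix.cons_val, Matrix.of_apply, Fin.isValue,
      Fin.reduceFinMk, Fin.zero_eta, Fin.mk_one, Fin.reduceEq, ite_true,
      ite_false, mul_zero, zero_mul, add_zero, zero_add, mul_one, one_mul]
  all_goals first | rfl | (field_simp; done) | (field_simp; ring)

theorem metric_through_qRhatInv (hq : 0 < q) (i a m n : Fin 3) :
    ∑ j, ∑ k, ∑ l, qRhatInvTable q i j a k * gMat q k l * qRhatInvTable q m n j l =
      ((q : ℂ) ^ 2)⁻¹ * gMat q i m * (if n = a then 1 else 0) := by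
  have h0 := sq_ne_zero hq
  have e := sq_sq hq
  simp only [Fin.sum_univ_three]
  fin_cases i <;> fin_cases a <;> fin_cases m <;> fin_cases n <;>
    simp only [qRhatInvTable, gMat, h, ← e, Matrix.cons_val, Matrix.of_apply, Fin.isValue,
      Fin.reduceFinMk, Fin.zero_eta, Fin.mk_one, Fin.reduceEq, ite_true,
      ite_false, mul_zero, zero_mul, add_zero, zero_add, mul_one, one_mul]
  all_goals first | rfl | (field_simp; done) | (field_simp; ring)

end Scalars

end QEuclid

namespace QEuclid

variable (q : ℝ)

/-! ### Relations in the function algebra -/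

/-- The inverse dilatation generator `Λ⁻¹`. -/
def lamInv : Alg q := gen q .lamInv

theorem minus_zero : x q 0 * x q 1 = (q : ℂ) • (x q 1 * x q 0) := by
  have := RingQuot.mkAlgHom_rel ℂ (Rel.minus_zero (q := q))
  rwa [map_mul, map_smul, map_mul] at this

theorem plus_zero : x q 2 * x q 1 = (q : ℂ)⁻¹ • (x q 1 * x q 2) := by
  have := RingQuot.mkAlgHom_rel ℂ (Rel.plus_zero (q := q))
  rwa [map_mul, map_smul, map_mul] at this

theorem plus_minus : x q 2 * x q 0 = x q 0 * x q 2 + h q • (x q 1 * x q 1) := by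
  have := RingQuot.mkAlgHom_rel ℂ (Rel.plus_minus (q := q))
  rw [map_sub, map_mul, map_mul, map_smul, map_pow, _root_.sq] at this
  exact sub_eq_iff_eq_add'.1 this

theorem mkAlgHom_freeR2 : RingQuot.mkAlgHom ℂ (Rel q) (freeR2 q) = r2 q := by
  simp only [freeR2, map_sum, map_smul, map_mul]
  rfl

theorem r2_mul_rInv2 : r2 q * rInv2 q = 1 := by
  have := RingQuot.mkAlgHom_rel ℂ (Rel.r2_rInv (q := q))
  rwa [map_mul, mkAlgHom_freeR2, map_one] at this

theorem rInv2_mul_r2 : rInv2 q * r2 q = 1 := by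
  have := RingQuot.mkAlgHom_rel ℂ (Rel.rInv_r2 (q := q))
  rwa [map_mul, mkAlgHom_freeR2, map_one] at this

theorem x_mul_lam (i : Fin 3) : x q i * lam q = (q : ℂ) • (lam q * x q i) := by
  have := RingQuot.mkAlgHom_rel ℂ (Rel.x_lam (q := q) i)
  rwa [map_mul, map_smul, map_mul] at this

theorem lam_mul_lamInv : lam q * lamInv q = 1 := by
  have := RingQuot.mkAlgHom_rel ℂ (Rel.lam_lamInv (q := q))
  rwa [map_mul, map_one] at this

theorem lamInv_mul_lam : lamInv q * lam q = 1 := by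
  have := RingQuot.mkAlgHom_rel ℂ (Rel.lamInv_lam (q := q))
  rwa [map_mul, map_one] at this

theorem r2_eq : r2 q = (sq q)⁻¹ • (x q 0 * x q 2) + x q 1 * x q 1 + sq q • (x q 2 * x q 0) := by
  simp [r2, gMat, Fin.sum_univ_three]

variable {q}

/-- A property of elements that is inherited by linear combinations, products and two-sided
inverses holds everywhere as soon as it holds for the coordinates and for `Λ`. -/
theorem alg_induction {P : Alg q → Prop} (hx : ∀ i, P (x q i)) (hlam : P (lam q))
    (hC : ∀ c : ℂ, P (algebraMap ℂ (Alg q) c)) (hadd : ∀ a b, P a → P b → P (a + b))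
    (hmul : ∀ a b, P a → P b → P (a * b)) (hinv : ∀ a b, a * b = 1 → b * a = 1 → P a → P b)
    (a : Alg q) : P a := by
  have hr : P (r2 q) := by
    rw [r2_eq]
    have hs : ∀ (c : ℂ) a, P a → P (c • a) := fun c a ha => by
      rw [Algebra.smul_def]; exact hmul _ _ (hC c) ha
    exact hadd _ _ (hadd _ _ (hs _ _ (hmul _ _ (hx _) (hx _))) (hmul _ _ (hx _) (hx _)))
      (hs _ _ (hmul _ _ (hx _) (hx _)))
  obtain ⟨b, rfl⟩ := RingQuot.mkAlgHom_surjective ℂ (Rel q) a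
  induction b using FreeAlgebra.induction with
  | grade0 r => rw [AlgHom.commutes]; exact hC r
  | grade1 s =>
    cases s with
    | x i => exact hx i
    | rInv => exact hinv _ (rInv2 q) (r2_mul_rInv2 q) (rInv2_mul_r2 q) hr
    | lam => exact hlam
    | lamInv => exact hinv _ (lamInv q) (lam_mul_lamInv q) (lamInv_mul_lam q) hlam
  | mul a b ha hb => rw [map_mul]; exact hmul _ _ ha hb
  | add a b ha hb => rw [map_add]; exact hadd _ _ ha hb

theorem r2_eq_ordered (hq : 0 < q) :
    r2 q = (sq q + (sq q)⁻¹) • (x q 0 * x q 2) + (q : ℂ) • (x q 1 * x q 1) := by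
  have h0 := sq_ne_zero hq
  rw [r2_eq, plus_minus, h, ← sq_sq hq]
  match_scalars <;> field_simp <;> ring

theorem minus_mul_plus (hq : 0 < q) :
    x q 0 * x q 2 = (sq q + (sq q)⁻¹)⁻¹ • (r2 q - (q : ℂ) • (x q 1 * x q 1)) := by
  rw [r2_eq_ordered hq, add_sub_cancel_right, inv_smul_smul₀ (sq_add_inv_ne_zero hq)]

theorem plus_mul_minus (hq : 0 < q) :
    x q 2 * x q 0 = (sq q + (sq q)⁻¹)⁻¹ • (r2 q - (q : ℂ)⁻¹ • (x q 1 * x q 1)) := by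
  have h0 := sq_ne_zero hq
  have h1 := sq_add_inv_ne_zero hq
  have h2 : (q : ℂ) + 1 ≠ 0 := q_add_one_ne_zero hq
  rw [← sq_sq hq] at h2
  rw [plus_minus, minus_mul_plus hq, h, ← sq_sq hq]
  match_scalars <;> field_simp <;> ring

/-- `r²` is central among the coordinates. -/
theorem x_mul_r2 (hq : 0 < q) (i : Fin 3) : x q i * r2 q = r2 q * x q i := by
  have h0 := sq_ne_zero hq
  have q0 := q_ne_zero hq
  have h1 := sq_add_inv_ne_zero hq
  fin_cases i
  · change x q 0 * r2 q = r2 q * x q 0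
    have e1 : r2 q = (sq q + (sq q)⁻¹) • (x q 2 * x q 0) + (q : ℂ)⁻¹ • (x q 1 * x q 1) := by
      rw [plus_mul_minus hq, smul_inv_smul₀ h1]; abel
    rw [show x q 0 * r2 q = x q 0 * ((sq q + (sq q)⁻¹) • (x q 2 * x q 0) +
      (q : ℂ)⁻¹ • (x q 1 * x q 1)) by rw [← e1], r2_eq_ordered hq, mul_add, add_mul]
    simp only [mul_smul_comm, smul_mul_assoc, ← mul_assoc, minus_zero]
    simp only [mul_assoc, minus_zero, mul_smul_comm, smul_smul]
    rw [inv_mul_cancel_left₀ q0]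
  · change x q 1 * r2 q = r2 q * x q 1
    rw [r2_eq_ordered hq, mul_add, add_mul]
    simp only [mul_smul_comm, smul_mul_assoc, mul_assoc, plus_zero]
    simp only [← mul_assoc, minus_zero, smul_mul_assoc, smul_smul, inv_mul_cancel₀ q0, one_smul]
  · change x q 2 * r2 q = r2 q * x q 2
    have e1 : r2 q = (sq q + (sq q)⁻¹) • (x q 2 * x q 0) + (q : ℂ)⁻¹ • (x q 1 * x q 1) := by
      rw [plus_mul_minus hq, smul_inv_smul₀ h1]; abel
    rw [show r2 q * x q 2 = ((sq q + (sq q)⁻¹) • (x q 2 * x q 0) +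
      (q : ℂ)⁻¹ • (x q 1 * x q 1)) * x q 2 by rw [← e1], r2_eq_ordered hq, mul_add, add_mul]
    simp only [mul_smul_comm, smul_mul_assoc, ← mul_assoc, plus_zero]
    simp only [mul_assoc, plus_zero, mul_smul_comm, smul_smul]
    rw [mul_inv_cancel_left₀ q0]

/-- An equation `a r = c • r b` transfers to the two-sided inverse `t` of `r`. -/
theorem inverse_q_commute {a b r t : Alg q} {c : ℂ} (hc : c ≠ 0) (hrt : r * t = 1) (htr : t * r = 1)
    (h : a * r = c • (r * b)) : b * t = c⁻¹ • (t * a) := by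
  have : t * (a * r) * t = t * (c • (r * b)) * t := by rw [h]
  rw [mul_assoc t, mul_assoc a, hrt, mul_one, mul_smul_comm, smul_mul_assoc, ← mul_assoc t r, htr,
    one_mul] at this
  rw [this, inv_smul_smul₀ hc]

theorem x_mul_rInv2 (hq : 0 < q) (i : Fin 3) : x q i * rInv2 q = rInv2 q * x q i := by
  simpa using inverse_q_commute one_ne_zero (r2_mul_rInv2 q) (rInv2_mul_r2 q)
    (a := x q i) (b := x q i) (by rw [one_smul, x_mul_r2 hq])

theorem r2_mul_lam : r2 q * lam q = ((q : ℂ) ^ 2) • (lam q * r2 q) := by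
  simp only [r2, Finset.sum_mul, Finset.mul_sum, Finset.smul_sum, smul_mul_assoc, mul_smul_comm]
  refine Finset.sum_congr rfl fun i _ => Finset.sum_congr rfl fun j _ => ?_
  rw [mul_assoc, x_mul_lam, mul_smul_comm, ← mul_assoc, x_mul_lam, smul_mul_assoc, mul_assoc,
    smul_smul, smul_smul, smul_smul]
  ring_nf

theorem rInv2_mul_lam (hq : 0 < q) : rInv2 q * lam q = ((q : ℂ) ^ 2)⁻¹ • (lam q * rInv2 q) := by
  have q0 := q_ne_zero hq
  have : lam q * rInv2 q = ((q : ℂ) ^ 2) • (rInv2 q * lam q) := by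
    have h := inverse_q_commute (c := ((q : ℂ) ^ 2)⁻¹) (a := lam q) (b := lam q)
      (by positivity) (r2_mul_rInv2 q) (rInv2_mul_r2 q)
      (by rw [r2_mul_lam, inv_smul_smul₀ (pow_ne_zero 2 q0)])
    rwa [inv_inv] at h
  rw [this, inv_smul_smul₀ (pow_ne_zero 2 q0)]

end QEuclid

namespace QEuclid

variable (q : ℝ)

/-! ### Commuting functions past differentials -/

/-- The matrices with `x^i ξ^j = ∑ₖ ξ^k (commX q i)_{kj}`. -/
def commX : Fin 3 → Matrix (Fin 3) (Fin 3) (Alg q) :=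
  ![!![(q : ℂ) ^ 2 • x q 0, ((q : ℂ) ^ 2 - 1) • x q 1, (h q ^ 2 * (q + 1)) • x q 2;
       0, (q : ℂ) • x q 0, (-(h q * (q + 1))) • x q 1;
       0, 0, x q 0],
    !![(q : ℂ) • x q 1, (-(h q * (q + 1))) • x q 2, 0;
       0, (q : ℂ) • x q 1, ((q : ℂ) ^ 2 - 1) • x q 2;
       0, 0, (q : ℂ) • x q 1],
    !![x q 2, 0, 0;
       0, (q : ℂ) • x q 2, 0;
       0, 0, (q : ℂ) ^ 2 • x q 2]]

theorem commX_apply (i k j : Fin 3) :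
    commX q i k j = ∑ l, qRhatTable q i j k l • x q l := by
  rw [Fin.sum_univ_three]
  fin_cases i <;> fin_cases k <;> fin_cases j <;>
    simp only [commX, qRhatTable, Matrix.cons_val, Matrix.of_apply, Fin.isValue, Fin.reduceFinMk,
      Fin.zero_eta, Fin.mk_one, zero_smul, one_smul, add_zero, zero_add]

variable {q}

theorem commX_minus_zero (hq : 0 < q) :
    commX q 0 * commX q 1 = (q : ℂ) • (commX q 1 * commX q 0) := by
  have h0 := sq_ne_zero hq
  ext i j
  rw [Matrix.smul_apply, Matrix.mul_apply, Matrix.mul_apply, Fin.sum_univ_three, Fin.sum_univ_three]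
  fin_cases i <;> fin_cases j <;>
    simp only [commX, Matrix.cons_val, Matrix.of_apply, Fin.isValue, Fin.reduceFinMk, Fin.zero_eta,
      Fin.mk_one, mul_zero, zero_mul, add_zero, zero_add, smul_zero, smul_mul_assoc, mul_smul_comm,
      minus_zero, plus_zero, plus_minus, h, ← sq_sq hq]
  all_goals first
    | (match_scalars; field_simp; done)
    | (match_scalars <;> field_simp <;> ring)

theorem commX_plus_zero (hq : 0 < q) :
    commX q 2 * commX q 1 = (q : ℂ)⁻¹ • (commX q 1 * commX q 2) := by
  have h0 := q_ne_zero hq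
  ext i j
  rw [Matrix.smul_apply, Matrix.mul_apply, Matrix.mul_apply, Fin.sum_univ_three, Fin.sum_univ_three]
  fin_cases i <;> fin_cases j <;>
    simp only [commX, Matrix.cons_val, Matrix.of_apply, Fin.isValue, Fin.reduceFinMk, Fin.zero_eta,
      Fin.mk_one, mul_zero, zero_mul, add_zero, zero_add, smul_zero, smul_mul_assoc, mul_smul_comm,
      plus_zero]
  all_goals match_scalars; field_simp

theorem commX_plus_minus (hq : 0 < q) :
    commX q 2 * commX q 0 = commX q 0 * commX q 2 + h q • (commX q 1 * commX q 1) := by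
  have h0 := sq_ne_zero hq
  ext i j
  rw [Matrix.add_apply, Matrix.smul_apply, Matrix.mul_apply, Matrix.mul_apply, Matrix.mul_apply,
    Fin.sum_univ_three, Fin.sum_univ_three, Fin.sum_univ_three]
  fin_cases i <;> fin_cases j <;>
    simp only [commX, Matrix.cons_val, Matrix.of_apply, Fin.isValue, Fin.reduceFinMk, Fin.zero_eta,
      Fin.mk_one, mul_zero, zero_mul, add_zero, zero_add, smul_zero, smul_mul_assoc, mul_smul_comm,
      plus_zero, plus_minus, h, ← sq_sq hq]
  all_goals first
    | (match_scalars; field_simp; done)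
    | (match_scalars <;> field_simp <;> ring)

theorem commX_r2 (hq : 0 < q) :
    ∑ i, ∑ j, gMat q i j • (commX q i * commX q j) =
      Matrix.diagonal fun _ => (q : ℂ) ^ 2 • r2 q := by
  have h0 := sq_ne_zero hq
  have e : ∑ i, ∑ j, gMat q i j • (commX q i * commX q j) = (sq q)⁻¹ • (commX q 0 * commX q 2) +
      commX q 1 * commX q 1 + sq q • (commX q 2 * commX q 0) := by
    simp [gMat, Fin.sum_univ_three]
  rw [e, r2_eq]
  ext i j
  simp only [Matrix.add_apply, Matrix.smul_apply, Matrix.mul_apply, Fin.sum_univ_three,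
    Matrix.diagonal_apply]
  fin_cases i <;> fin_cases j <;>
    simp only [commX, Matrix.cons_val, Matrix.of_apply, Fin.isValue, Fin.reduceFinMk, Fin.zero_eta,
      Fin.mk_one, mul_zero, zero_mul, add_zero, zero_add, smul_zero, smul_mul_assoc, mul_smul_comm,
      plus_zero, plus_minus, h, ← sq_sq hq, Fin.reduceEq, ite_true, ite_false]
  all_goals first
    | (match_scalars; field_simp; done)
    | (match_scalars <;> field_simp <;> ring)


/-- The value on a generator of the homomorphism `comm`. -/
def commGen (q : ℝ) : Gen → Matrix (Fin 3) (Fin 3) (Alg q)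
  | .x i => commX q i
  | .rInv => Matrix.diagonal fun _ => ((q : ℂ) ^ 2)⁻¹ • rInv2 q
  | .lam => Matrix.diagonal fun _ => (q : ℂ)⁻¹ • lam q
  | .lamInv => Matrix.diagonal fun _ => (q : ℂ) • lamInv q

theorem commX_lam (hq : 0 < q) (i : Fin 3) :
    commX q i * commGen q .lam = (q : ℂ) • (commGen q .lam * commX q i) := by
  have h0 := q_ne_zero hq
  ext k j
  simp only [commGen, Matrix.mul_diagonal, Matrix.diagonal_mul, Matrix.smul_apply, commX_apply,
    Finset.sum_mul, Finset.mul_sum, smul_mul_assoc, mul_smul_comm, x_mul_lam, Finset.smul_sum]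
  refine Finset.sum_congr rfl fun l _ => ?_
  match_scalars
  ring

theorem commGen_freeR2 (hq : 0 < q) : FreeAlgebra.lift ℂ (commGen q) (freeR2 q) =
    Matrix.diagonal fun _ => (q : ℂ) ^ 2 • r2 q := by
  rw [← commX_r2 hq]
  simp only [freeR2, map_sum, map_smul, map_mul, FreeAlgebra.lift_ι_apply, commGen]

/-- The homomorphism `φ` with `a ξ^j = ∑ₖ ξ^k φ(a)_{kj}`: it describes the left action of functions
on the right module with basis `ξ^-, ξ^0, ξ^+`. -/
def comm (hq : 0 < q) : Alg q →ₐ[ℂ] Matrix (Fin 3) (Fin 3) (Alg q) :=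
  RingQuot.liftAlgHom ℂ ⟨FreeAlgebra.lift ℂ (commGen q), by
    have h0 := q_ne_zero hq
    intro a b hab
    cases hab with
    | minus_zero =>
      simp only [map_mul, map_smul, FreeAlgebra.lift_ι_apply]
      exact commX_minus_zero hq
    | plus_zero =>
      simp only [map_mul, map_smul, FreeAlgebra.lift_ι_apply]
      exact commX_plus_zero hq
    | plus_minus =>
      simp only [map_mul, map_smul, map_sub, FreeAlgebra.lift_ι_apply, commGen,
        commX_plus_minus hq, _root_.sq]
      abel
    | r2_rInv =>
      rw [map_mul, commGen_freeR2 hq, FreeAlgebra.lift_ι_apply, commGen,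
        Matrix.diagonal_mul_diagonal, map_one, ← Matrix.diagonal_one]
      congr 1
      ext
      rw [smul_mul_smul_comm, r2_mul_rInv2, mul_inv_cancel₀ (pow_ne_zero 2 h0), one_smul]
    | rInv_r2 =>
      rw [map_mul, commGen_freeR2 hq, FreeAlgebra.lift_ι_apply, commGen,
        Matrix.diagonal_mul_diagonal, map_one, ← Matrix.diagonal_one]
      congr 1
      ext
      rw [smul_mul_smul_comm, rInv2_mul_r2, inv_mul_cancel₀ (pow_ne_zero 2 h0), one_smul]
    | x_lam i =>
      simp only [map_mul, map_smul, FreeAlgebra.lift_ι_apply]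
      exact commX_lam hq i
    | lam_lamInv =>
      rw [map_mul, FreeAlgebra.lift_ι_apply, FreeAlgebra.lift_ι_apply, commGen, commGen,
        Matrix.diagonal_mul_diagonal, map_one, ← Matrix.diagonal_one]
      congr 1
      ext
      rw [smul_mul_smul_comm, lam_mul_lamInv, inv_mul_cancel₀ h0, one_smul]
    | lamInv_lam =>
      rw [map_mul, FreeAlgebra.lift_ι_apply, FreeAlgebra.lift_ι_apply, commGen, commGen,
        Matrix.diagonal_mul_diagonal, map_one, ← Matrix.diagonal_one]
      congr 1
      ext
      rw [smul_mul_smul_comm, lamInv_mul_lam, mul_inv_cancel₀ h0, one_smul]⟩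

theorem comm_gen (hq : 0 < q) (s : Gen) : comm hq (gen q s) = commGen q s :=
  (RingQuot.liftAlgHom_mkAlgHom_apply ..).trans (FreeAlgebra.lift_ι_apply ..)

theorem comm_x (hq : 0 < q) (i : Fin 3) : comm hq (x q i) = commX q i := comm_gen hq _

theorem comm_lam (hq : 0 < q) :
    comm hq (lam q) = Matrix.diagonal fun _ => (q : ℂ)⁻¹ • lam q := comm_gen hq _

theorem comm_rInv2 (hq : 0 < q) :
    comm hq (rInv2 q) = Matrix.diagonal fun _ => ((q : ℂ) ^ 2)⁻¹ • rInv2 q := comm_gen hq _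

theorem comm_r2 (hq : 0 < q) : comm hq (r2 q) = Matrix.diagonal fun _ => (q : ℂ) ^ 2 • r2 q := by
  rw [← commX_r2 hq]
  simp only [r2, map_sum, map_smul, map_mul, comm_x]

/-! ### The differential as a commutator -/

/-- The covectors `x_k = g_{kl} x^l`. -/
def xLow (q : ℝ) : Fin 3 → Alg q := ![(sq q)⁻¹ • x q 2, x q 1, sq q • x q 0]

theorem xLow_apply (k : Fin 3) : xLow q k = ∑ l, gMat q k l • x q l := by
  rw [Fin.sum_univ_three]
  fin_cases k <;>
    simp only [xLow, gMat, Matrix.cons_val, Matrix.of_apply, Fin.isValue, Fin.reduceFinMk,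
      Fin.zero_eta, Fin.mk_one, zero_smul, one_smul, add_zero, zero_add]

theorem sum_commX_mul_xLow (hq : 0 < q) (i k : Fin 3) :
    ∑ j, commX q i k j * xLow q j =
      xLow q k * x q i + if k = i then ((q : ℂ) * (q - 1)) • r2 q else 0 := by
  have h0 := sq_ne_zero hq
  rw [Fin.sum_univ_three, r2_eq]
  fin_cases i <;> fin_cases k <;>
    simp only [commX, xLow, Matrix.cons_val, Matrix.of_apply, Fin.isValue, Fin.reduceFinMk,
      Fin.zero_eta, Fin.mk_one, zero_mul, add_zero, smul_mul_assoc,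
      mul_smul_comm, minus_zero, plus_zero, plus_minus, h, ← sq_sq hq, Fin.reduceEq, ite_true,
      ite_false]
  all_goals match_scalars <;> field_simp <;> ring

/-- The coefficients of `θ = ∑ₖ ξ^k θ_k`. -/
def thetaCoord (q : ℝ) (k : Fin 3) : Alg q :=
  (((q : ℂ) - 1)⁻¹ * (q : ℂ)⁻¹) • (xLow q k * rInv2 q)

/-- The commutator `f θ - θ f` in terms of the basis `ξ^k`. -/
def dCoord (hq : 0 < q) : Alg q →ₗ[ℂ] (Fin 3 → Alg q) where
  toFun f k := ∑ j, comm hq f k j * thetaCoord q j - thetaCoord q k * f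
  map_add' f g := by
    ext k
    simp only [map_add, Matrix.add_apply, add_mul, mul_add, Finset.sum_add_distrib, Pi.add_apply]
    abel
  map_smul' c f := by
    ext k
    simp only [map_smul, Matrix.smul_apply, smul_mul_assoc, mul_smul_comm, ← Finset.smul_sum,
      Pi.smul_apply, RingHom.id_apply, smul_sub]

theorem dCoord_apply (hq : 0 < q) (f : Alg q) (k : Fin 3) :
    dCoord hq f k = ∑ j, comm hq f k j * thetaCoord q j - thetaCoord q k * f := rfl

theorem dCoord_mul (hq : 0 < q) (f g : Alg q) (k : Fin 3) :
    dCoord hq (f * g) k = ∑ j, comm hq f k j * dCoord hq g j + dCoord hq f k * g := by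
  simp only [dCoord_apply, map_mul, Matrix.mul_apply, mul_sub, sub_mul, Finset.sum_sub_distrib,
    Finset.sum_mul, Finset.mul_sum, mul_assoc]
  rw [Finset.sum_comm]
  abel

theorem dCoord_x (hq : 0 < q) (hq1 : q ≠ 1) (i k : Fin 3) :
    dCoord hq (x q i) k = if k = i then 1 else 0 := by
  have h0 := q_ne_zero hq
  have h1 := q_sub_one_ne_zero hq1
  simp only [dCoord_apply, comm_x, thetaCoord, mul_smul_comm, smul_mul_assoc, ← Finset.smul_sum,
    ← mul_assoc, ← Finset.sum_mul, sum_commX_mul_xLow hq]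
  rw [mul_assoc (xLow q k), ← x_mul_rInv2 hq, ← mul_assoc, ← smul_sub, ← sub_mul,
    add_sub_cancel_left]
  split_ifs
  · rw [smul_mul_assoc, r2_mul_rInv2, smul_smul]
    convert one_smul ℂ _
    field_simp
  · simp

theorem xLow_mul_lam (k : Fin 3) : xLow q k * lam q = (q : ℂ) • (lam q * xLow q k) := by
  simp only [xLow_apply, Finset.sum_mul, Finset.mul_sum, smul_mul_assoc, mul_smul_comm, x_mul_lam,
    Finset.smul_sum]
  exact Finset.sum_congr rfl fun l _ => smul_comm _ _ _

theorem dCoord_lam (hq : 0 < q) (k : Fin 3) : dCoord hq (lam q) k = 0 := by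
  have h0 := q_ne_zero hq
  rw [dCoord_apply, comm_lam, Finset.sum_eq_single k]
  · rw [Matrix.diagonal_apply_eq, thetaCoord, mul_smul_comm, smul_mul_assoc, smul_mul_assoc,
      mul_assoc (xLow q k), rInv2_mul_lam hq, mul_smul_comm, ← mul_assoc, ← mul_assoc,
      xLow_mul_lam, smul_mul_assoc]
    match_scalars
    field_simp
    ring
  · intro j _ hj
    rw [Matrix.diagonal_apply_ne _ hj.symm, zero_mul]
  · simp

end QEuclid

namespace QEuclid

variable {q : ℝ}

/-! ### Coordinates of 1-forms -/

/-- Left multiplication by a function, in terms of the basis `ξ^k`. -/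
def leftEnd (hq : 0 < q) : Alg q →ₐ[ℂ] Module.End ℂ (Fin 3 → Alg q) where
  toFun a :=
    { toFun := fun v => (comm hq a).mulVec v
      map_add' := fun v w => Matrix.mulVec_add _ _ _
      map_smul' := fun c v => Matrix.mulVec_smul _ _ _ }
  map_one' := by ext v; simp
  map_mul' a b := LinearMap.ext fun v => by simp
  map_zero' := by ext v; simp
  map_add' a b := by ext v; simp [Matrix.add_mulVec]
  commutes' c := by
    ext v
    simp [Algebra.algebraMap_eq_smul_one, Matrix.smul_mulVec]

/-- Right multiplication by a function, in terms of the basis `ξ^k`. -/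
def rightEnd (q : ℝ) : (Alg q)ᵐᵒᵖ →ₐ[ℂ] Module.End ℂ (Fin 3 → Alg q) where
  toFun b :=
    { toFun := fun v k => v k * b.unop
      map_add' := fun v w => by ext; simp [add_mul]
      map_smul' := fun c v => by ext; simp }
  map_one' := by ext v; simp
  map_mul' a b := LinearMap.ext fun v => funext fun k => by simp [mul_assoc]
  map_zero' := by ext v; simp
  map_add' a b := by ext v; simp [mul_add]
  commutes' c := by
    ext v
    simp [Algebra.algebraMap_eq_smul_one]

theorem commute_leftEnd_rightEnd (hq : 0 < q) (a : Alg q) (b : (Alg q)ᵐᵒᵖ) :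
    Commute (leftEnd hq a) (rightEnd q b) := by
  refine LinearMap.ext fun v => funext fun k => ?_
  simp [leftEnd, rightEnd, Matrix.mulVec, dotProduct, Finset.sum_mul, mul_assoc]

/-- The action of the enveloping algebra on coordinates of 1-forms. -/
def envEnd (hq : 0 < q) : Env q →ₐ[ℂ] Module.End ℂ (Fin 3 → Alg q) :=
  Algebra.TensorProduct.lift (leftEnd hq) (rightEnd q) (commute_leftEnd_rightEnd hq)

theorem envEnd_inL (hq : 0 < q) (a : Alg q) : envEnd hq (inL q a) = leftEnd hq a := by
  change Algebra.TensorProduct.lift _ _ _ (a ⊗ₜ 1) = _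
  rw [Algebra.TensorProduct.lift_tmul, map_one, mul_one]

theorem envEnd_inR (hq : 0 < q) (b : (Alg q)ᵐᵒᵖ) : envEnd hq (inR q b) = rightEnd q b := by
  change Algebra.TensorProduct.lift _ _ _ (1 ⊗ₜ b) = _
  rw [Algebra.TensorProduct.lift_tmul, map_one, one_mul]

/-- The bimodule of coordinate vectors: the free right module `⊕ₖ ξ^k A`, with the left action
given by `comm`. -/
def Coord (_hq : 0 < q) : Type := Fin 3 → Alg q

instance (hq : 0 < q) : AddCommGroup (Coord hq) := inferInstanceAs (AddCommGroup (Fin 3 → Alg q))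

instance (hq : 0 < q) : Module ℂ (Coord hq) := inferInstanceAs (Module ℂ (Fin 3 → Alg q))

instance (hq : 0 < q) : Module (Env q) (Coord hq) :=
  Module.compHom (Fin 3 → Alg q) (envEnd hq).toRingHom

/-- A coordinate vector as an element of the bimodule `Coord`. -/
def toCoord (hq : 0 < q) : (Fin 3 → Alg q) ≃ₗ[ℂ] Coord hq := LinearEquiv.refl ℂ (Fin 3 → Alg q)

/-- The map of free bimodules underlying the coordinate map. -/
def preCoord (hq : 0 < q) : (Alg q →₀ Env q) →ₗ[Env q] Coord hq :=
  Finsupp.linearCombination (Env q) fun f => toCoord hq (dCoord hq f)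

theorem preCoord_symb (hq : 0 < q) (f : Alg q) :
    preCoord hq (symb q f) = toCoord hq (dCoord hq f) := by
  rw [preCoord, Finsupp.linearCombination_single, one_smul]

theorem toCoord_inL (hq : 0 < q) (a : Alg q) (v : Fin 3 → Alg q) :
    inL q a • toCoord hq v = toCoord hq ((comm hq a).mulVec v) := by
  change envEnd hq (inL q a) v = _
  rw [envEnd_inL]
  rfl

theorem toCoord_inR (hq : 0 < q) (b : Alg q) (v : Fin 3 → Alg q) :
    inR q (.op b) • toCoord hq v = toCoord hq fun k => v k * b := by
  change envEnd hq (inR q (.op b)) v = _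
  rw [envEnd_inR]
  rfl

theorem coord_algebraMap (hq : 0 < q) (c : ℂ) (v : Coord hq) :
    algebraMap ℂ (Env q) c • v = c • v := by
  change envEnd hq (algebraMap ℂ (Env q) c) v = c • (toCoord hq).symm v
  rw [AlgHom.commutes]
  rfl

theorem preCoord_smul (hq : 0 < q) (c : ℂ) (t : Alg q →₀ Env q) :
    preCoord hq (c • t) = c • preCoord hq t := by
  rw [← algebraMap_smul (Env q) c t, map_smul, coord_algebraMap]

theorem preCoord_rel (hq : 0 < q) (hq1 : q ≠ 1) {t : Alg q →₀ Env q} (ht : FormRel q t) :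
    preCoord hq t = 0 := by
  cases ht with
  | add f g => simp only [map_sub, preCoord_symb, map_add, add_sub_cancel_left, sub_self]
  | smul c f =>
    rw [map_sub, preCoord_smul, preCoord_symb, preCoord_symb, map_smul, map_smul, sub_self]
  | leibniz f g =>
    simp only [map_sub, map_smul, preCoord_symb, toCoord_inL, toCoord_inR]
    refine (toCoord hq).symm.injective ?_
    simp only [map_sub, LinearEquiv.symm_apply_apply, map_zero]
    funext k
    simp only [Pi.sub_apply, dCoord_mul, Matrix.mulVec, dotProduct, Pi.zero_apply]
    abel
  | comm i j =>
    simp only [map_sub, map_smul, map_sum, preCoord_smul, preCoord_symb, toCoord_inL, toCoord_inR]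
    refine (toCoord hq).symm.injective ?_
    simp only [map_sub, map_sum, map_smul, LinearEquiv.symm_apply_apply, map_zero]
    funext k
    simp only [Pi.sub_apply, Matrix.mulVec, dotProduct, Pi.zero_apply]
    simp only [dCoord_x hq hq1, Finset.sum_apply, Pi.smul_apply, comm_x, mul_ite, mul_one, mul_zero,
      Finset.sum_ite_eq', Finset.mem_univ, if_true, ite_mul, one_mul, zero_mul, smul_ite, smul_zero]
    rw [Finset.sum_comm]
    simp only [Finset.sum_ite_eq, Finset.mem_univ, if_true, commX_apply]
    rw [sub_eq_zero]
    refine Finset.sum_congr rfl fun l _ => ?_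
    congr 1
    exact (congrFun (congrFun (smul_Rhat hq) (i, j)) (k, l)).symm
  | lam =>
    rw [preCoord_symb, map_eq_zero_iff _ (toCoord hq).injective]
    exact funext fun k => dCoord_lam hq k

/-- The coordinate map as a map of bimodules. -/
def envCoord (hq : 0 < q) (hq1 : q ≠ 1) : Form q →ₗ[Env q] Coord hq :=
  (formSub q).liftQ (preCoord hq)
    (Submodule.span_le.2 fun _ ht => preCoord_rel hq hq1 ht)

/-- The coordinates of a 1-form with respect to the right basis `ξ^k`. -/
def coord (hq : 0 < q) (hq1 : q ≠ 1) : Form q →ₗ[ℂ] (Fin 3 → Alg q) where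
  toFun ω := (toCoord hq).symm (envCoord hq hq1 ω)
  map_add' ω η := by rw [map_add, map_add]
  map_smul' c ω := by
    change (toCoord hq).symm (envCoord hq hq1 (algebraMap ℂ (Env q) c • ω)) = _
    rw [map_smul, coord_algebraMap, map_smul]
    rfl

variable (hq : 0 < q) (hq1 : q ≠ 1)

theorem coord_smul (a : Alg q) (ω : Form q) (k : Fin 3) :
    coord hq hq1 (a • ω) k = ∑ j, comm hq a k j * coord hq hq1 ω j := by
  change (toCoord hq).symm (envCoord hq hq1 (inL q a • ω)) k = _
  rw [map_smul, ← (toCoord hq).apply_symm_apply (envCoord hq hq1 ω), toCoord_inL]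
  rfl

theorem coord_op_smul (a : Alg q) (ω : Form q) (k : Fin 3) :
    coord hq hq1 (MulOpposite.op a • ω) k = coord hq hq1 ω k * a := by
  change (toCoord hq).symm (envCoord hq hq1 (inR q (.op a) • ω)) k = _
  rw [map_smul, ← (toCoord hq).apply_symm_apply (envCoord hq hq1 ω), toCoord_inR]
  rfl

theorem coord_d (f : Alg q) : coord hq hq1 (d q f) = dCoord hq f := preCoord_symb hq f

theorem coord_xi (i k : Fin 3) : coord hq hq1 (xi q i) k = if k = i then 1 else 0 := by
  rw [xi, coord_d, dCoord_x hq hq1]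

/-! ### The forms `ξ^k` are a basis of the right module of 1-forms -/

theorem d_mul (f g : Alg q) : d q (f * g) = MulOpposite.op g • d q f + f • d q g := by
  have := formMk_eq_zero q (FormRel.leibniz f g)
  rw [map_sub, map_sub, sub_sub, sub_eq_zero] at this
  exact this

theorem d_lam : d q (lam q) = 0 := formMk_eq_zero q FormRel.lam

theorem d_algebraMap (c : ℂ) : d q (algebraMap ℂ (Alg q) c) = 0 := by
  have h := d_mul (q := q) 1 1
  rw [mul_one, MulOpposite.op_one, one_smul, one_smul, left_eq_add] at h
  rw [Algebra.algebraMap_eq_smul_one, map_smul, h, smul_zero]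

theorem formMk_smul (c : ℂ) (t : Alg q →₀ Env q) : formMk q (c • t) = c • formMk q t := by
  rw [← algebraMap_smul (Env q) c t, map_smul]
  rfl

theorem x_smul_xi (hq : 0 < q) (i j : Fin 3) :
    x q i • xi q j = ∑ k, MulOpposite.op (commX q i k j) • xi q k := by
  have := formMk_eq_zero q (FormRel.comm i j)
  rw [map_sub, sub_eq_zero, map_smul, map_sum] at this
  refine (show x q i • xi q j = _ from this).trans (Finset.sum_congr rfl fun k _ => ?_)
  rw [map_sum, commX_apply, Finset.op_sum, Finset.sum_smul]
  refine Finset.sum_congr rfl fun l _ => ?_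
  rw [formMk_smul, map_smul, MulOpposite.op_smul, smul_assoc]
  congr 1
  exact congrFun (congrFun (smul_Rhat hq) (i, j)) (k, l)

theorem xi_lam (i : Fin 3) :
    MulOpposite.op (lam q) • xi q i = (q : ℂ) • lam q • xi q i := by
  have h := congrArg (d q) (x_mul_lam q i)
  rwa [d_mul, d_lam, smul_zero, add_zero, map_smul, d_mul, d_lam, smul_zero, zero_add] at h

section Generators

variable {n : Type} [Fintype n] [DecidableEq n]
variable {Q : Type} [AddCommGroup Q] [Module ℂ Q] [Module (Alg q) Q] [Module (Alg q)ᵐᵒᵖ Q]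
  [IsScalarTower ℂ (Alg q) Q] [IsScalarTower ℂ (Alg q)ᵐᵒᵖ Q] [SMulCommClass (Alg q) (Alg q)ᵐᵒᵖ Q]

/-- If the coordinates and `Λ` move past the elements `t j` of a bimodule as prescribed by the
matrices of a homomorphism, then so do all functions. -/
theorem smul_eq_sum_of_generators (φ : Alg q →ₐ[ℂ] Matrix n n (Alg q)) (t : n → Q)
    (hx : ∀ i j, x q i • t j = ∑ k, MulOpposite.op (φ (x q i) k j) • t k)
    (hlam : ∀ j, lam q • t j = ∑ k, MulOpposite.op (φ (lam q) k j) • t k) (a : Alg q) (j : n) :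
    a • t j = ∑ k, MulOpposite.op (φ a k j) • t k := by
  revert j
  induction a using alg_induction with
  | hx i => exact hx i
  | hlam => exact hlam
  | hC c =>
    intro j
    rw [AlgHom.commutes, Algebra.algebraMap_eq_smul_one, Algebra.algebraMap_eq_smul_one,
      Finset.sum_eq_single j]
    · rw [Matrix.smul_apply, Matrix.one_apply_eq, smul_assoc, one_smul, MulOpposite.op_smul,
        smul_assoc, MulOpposite.op_one, one_smul]
    · intro k _ hk
      rw [Matrix.smul_apply, Matrix.one_apply_ne hk, smul_zero, MulOpposite.op_zero, zero_smul]
    · simp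
  | hadd a b ha hb =>
    intro j
    simp only [add_smul, ha, hb, map_add, Matrix.add_apply, MulOpposite.op_add,
      Finset.sum_add_distrib]
  | hmul a b ha hb =>
    intro j
    rw [mul_smul, hb, Finset.smul_sum]
    simp only [smul_comm a, ha, map_mul, Matrix.mul_apply, Finset.smul_sum, Finset.op_sum,
      Finset.sum_smul, MulOpposite.op_mul, mul_smul]
    exact Finset.sum_comm
  | hinv a b hab hba ha =>
    intro j
    have h1 : ∀ i, ∑ k, MulOpposite.op (φ a k i) • b • t k = t i := by
      intro i
      simp only [← smul_comm b, ← Finset.smul_sum]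
      rw [← ha, ← mul_smul, hba, one_smul]
    have h2 : ∑ k, ∑ i, MulOpposite.op (φ a k i * φ b i j) • b • t k = b • t j := by
      simp only [← Finset.sum_smul, ← Finset.op_sum, ← Matrix.mul_apply, ← map_mul, hab,
        map_one]
      rw [Finset.sum_eq_single j]
      · rw [Matrix.one_apply_eq, MulOpposite.op_one, one_smul]
      · intro k _ hk
        rw [Matrix.one_apply_ne hk, MulOpposite.op_zero, zero_smul]
      · simp
    rw [← h2, Finset.sum_comm]
    refine Finset.sum_congr rfl fun i _ => ?_
    conv_rhs => rw [← h1 i, Finset.smul_sum]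
    simp only [MulOpposite.op_mul, mul_smul]

end Generators

theorem smul_xi (hq : 0 < q) (a : Alg q) (j : Fin 3) :
    a • xi q j = ∑ k, MulOpposite.op (comm hq a k j) • xi q k := by
  refine smul_eq_sum_of_generators (comm hq) (xi q) (fun i j => ?_) (fun j => ?_) a j
  · rw [comm_x, x_smul_xi hq]
  · rw [comm_lam, Finset.sum_eq_single j]
    · rw [Matrix.diagonal_apply_eq, MulOpposite.op_smul, smul_assoc, xi_lam,
        inv_smul_smul₀ (q_ne_zero hq)]
    · intro k _ hk
      rw [Matrix.diagonal_apply_ne _ hk, MulOpposite.op_zero, zero_smul]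
    · simp

/-- The 1-form with the same coordinates as `ω` in the span of the `ξ^k`. -/
def expansion : Form q →ₗ[ℂ] Form q where
  toFun ω := ∑ k, MulOpposite.op (coord hq hq1 ω k) • xi q k
  map_add' ω η := by
    simp only [map_add, Pi.add_apply, MulOpposite.op_add, add_smul, Finset.sum_add_distrib]
  map_smul' c ω := by
    simp only [map_smul, Pi.smul_apply, MulOpposite.op_smul, smul_assoc, Finset.smul_sum,
      RingHom.id_apply]

theorem expansion_apply (ω : Form q) :
    expansion hq hq1 ω = ∑ k, MulOpposite.op (coord hq hq1 ω k) • xi q k := rfl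

theorem expansion_smul (a : Alg q) (ω : Form q) :
    expansion hq hq1 (a • ω) = a • expansion hq hq1 ω := by
  simp only [expansion_apply, coord_smul, Finset.smul_sum, smul_comm a, smul_xi hq, Finset.op_sum,
    Finset.sum_smul, MulOpposite.op_mul, mul_smul]
  exact Finset.sum_comm

theorem expansion_op_smul (a : Alg q) (ω : Form q) :
    expansion hq hq1 (MulOpposite.op a • ω) = MulOpposite.op a • expansion hq hq1 ω := by
  simp only [expansion_apply, coord_op_smul, Finset.smul_sum, MulOpposite.op_mul, mul_smul]

theorem expansion_xi (i : Fin 3) : expansion hq hq1 (xi q i) = xi q i := by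
  rw [expansion_apply, Finset.sum_eq_single i]
  · rw [coord_xi, if_pos rfl, MulOpposite.op_one, one_smul]
  · intro k _ hk
    rw [coord_xi, if_neg hk, MulOpposite.op_zero, zero_smul]
  · simp

theorem expansion_d (f : Alg q) : expansion hq hq1 (d q f) = d q f := by
  induction f using alg_induction with
  | hx i => exact expansion_xi hq hq1 i
  | hlam => rw [d_lam, map_zero]
  | hC c => rw [d_algebraMap, map_zero]
  | hadd a b ha hb => rw [map_add, map_add, ha, hb]
  | hmul a b ha hb => rw [d_mul, map_add, expansion_smul, expansion_op_smul, ha, hb]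
  | hinv a b hab hba ha =>
    have e1 : MulOpposite.op b • d q a + a • d q b = 0 := by
      rw [← d_mul, hab, ← map_one (algebraMap ℂ (Alg q)), d_algebraMap]
    have e2 : d q b = -(b • MulOpposite.op b • d q a) := by
      have := congrArg (b • ·) e1
      simp only [smul_add, ← mul_smul b a, hba, one_smul, smul_zero] at this
      rw [eq_neg_iff_add_eq_zero, add_comm]
      exact this
    rw [e2, map_neg, expansion_smul, expansion_op_smul, ha]

theorem env_induction {P : Env q → Prop} (hzero : P 0)
    (hmul : ∀ a b, P (inL q a * inR q (.op b))) (hadd : ∀ e f, P e → P f → P (e + f))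
    (e : Env q) : P e := by
  refine TensorProduct.induction_on (motive := P) e hzero (fun a b => ?_) hadd
  have : (a ⊗ₜ b : Alg q ⊗[ℂ] (Alg q)ᵐᵒᵖ) =
      (a ⊗ₜ[ℂ] (1 : (Alg q)ᵐᵒᵖ)) * ((1 : Alg q) ⊗ₜ[ℂ] b) := by
    rw [Algebra.TensorProduct.tmul_mul_tmul, mul_one, one_mul]
  exact (congrArg P this).mpr (hmul a b.unop)

theorem expansion_eq (ω : Form q) : expansion hq hq1 ω = ω := by
  have key : ∀ (e : Env q) (ω : Form q), expansion hq hq1 ω = ω →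
      expansion hq hq1 (e • ω) = e • ω := by
    intro e ω hω
    induction e using env_induction with
    | hzero => rw [zero_smul, map_zero]
    | hmul a b =>
      rw [mul_smul]
      refine (expansion_smul hq hq1 a (MulOpposite.op b • ω)).trans ?_
      rw [expansion_op_smul, hω]
      rfl
    | hadd e f he hf => rw [add_smul, map_add, he, hf]
  obtain ⟨t, rfl⟩ : ∃ t, formMk q t = ω := Submodule.mkQ_surjective (formSub q) ω
  induction t using Finsupp.induction_linear with
  | zero => rw [map_zero, map_zero]
  | add s t hs ht => rw [map_add, map_add, hs, ht]
  | single f e =>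
    have : formMk q (Finsupp.single f e) = e • d q f := by
      rw [show Finsupp.single f e = e • symb q f by
        rw [Finsupp.smul_single, smul_eq_mul, mul_one], map_smul]
      rfl
    rw [this]
    exact key e _ (expansion_d hq hq1 f)

theorem eq_sum_xi (ω : Form q) : ω = ∑ k, MulOpposite.op (coord hq hq1 ω k) • xi q k :=
  (expansion_eq hq hq1 ω).symm

theorem coord_injective : Function.Injective (coord hq hq1) := by
  intro ω η h
  rw [eq_sum_xi hq hq1 ω, eq_sum_xi hq hq1 η, h]

/-! ### The Dirac operator generates the differential -/

theorem sum_gMat_commX (hq : 0 < q) (k : Fin 3) :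
    ∑ i, ∑ j, gMat q i j • commX q i k j = (q : ℂ)⁻¹ • xLow q k := by
  have h0 := sq_ne_zero hq
  simp only [Fin.sum_univ_three]
  fin_cases k <;>
    simp only [commX, xLow, gMat, Matrix.cons_val, Matrix.of_apply, Fin.isValue, Fin.reduceFinMk,
      Fin.zero_eta, Fin.mk_one, zero_smul, one_smul, smul_zero, add_zero, zero_add, h, ← sq_sq hq]
  all_goals match_scalars <;> field_simp <;> ring

theorem xLow_mul_rInv2 (hq : 0 < q) (k : Fin 3) : xLow q k * rInv2 q = rInv2 q * xLow q k := by
  simp only [xLow_apply, Finset.sum_mul, Finset.mul_sum, smul_mul_assoc, mul_smul_comm,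
    x_mul_rInv2 hq]

theorem coord_theta (k : Fin 3) : coord hq hq1 (theta q) k = thetaCoord q k := by
  have h0 := q_ne_zero hq
  have e : coord hq hq1 (theta q) k = (((q : ℂ) - 1)⁻¹ * (q : ℂ) ^ 2) •
      ∑ i, ∑ j, gMat q i j • (((q : ℂ) ^ 2)⁻¹ • rInv2 q * commX q i k j) := by
    simp only [theta, map_smul, map_sum, Pi.smul_apply, Finset.sum_apply, coord_smul, coord_xi,
      mul_ite, mul_one, mul_zero, Finset.sum_ite_eq', Finset.mem_univ, if_true, map_mul, comm_x,
      comm_rInv2, Matrix.diagonal_mul]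
  rw [e, thetaCoord, xLow_mul_rInv2 hq]
  simp only [← mul_smul_comm, ← Finset.mul_sum, sum_gMat_commX hq]
  simp only [mul_smul_comm, smul_mul_assoc, smul_smul]
  congr 1
  field_simp

/-- The differential is the commutator with `θ`. -/
theorem d_eq_commutator (hq : 0 < q) (hq1 : q ≠ 1) (f : Alg q) :
    d q f = f • theta q - MulOpposite.op f • theta q := by
  apply coord_injective hq hq1
  funext k
  rw [coord_d, map_sub, Pi.sub_apply, coord_smul, coord_op_smul, dCoord_apply]
  simp only [coord_theta]

end QEuclid

namespace QEuclid

/-! ### The braid relation in coordinates -/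

section Braid

variable {q : ℝ}

/-- The metric matrix is invariant under the commutation matrices of pairs of differentials. -/
theorem gMat_invariant (hq : 0 < q) (m c j l : Fin 3) :
    ∑ i, ∑ k, gMat q i k * (∑ b, qRhatTable q m j i b * qRhatTable q b l k c) =
      (q : ℂ) ^ 2 * gMat q j l * (if m = c then 1 else 0) := by
  have h0 := sq_ne_zero hq
  have e := sq_sq hq
  simp only [Fin.sum_univ_three]
  fin_cases m <;> fin_cases c <;> fin_cases j <;> fin_cases l <;>
    simp only [qRhatTable, gMat, h, ← e, Matrix.cons_val, Matrix.of_apply, Fin.isValue,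
      Fin.reduceFinMk, Fin.zero_eta, Fin.mk_one, Fin.reduceEq, ite_true,
      ite_false, mul_zero, zero_mul, add_zero, zero_add, mul_one, one_mul]
  all_goals first | rfl | (field_simp; done) | (field_simp; ring)

set_option maxHeartbeats 4000000 in
/-- The braid relation for `q R̂`, arranged as the statement that `q R̂` commutes with the matrices
that move a coordinate past a pair of differentials. -/
theorem qRhat_braid (hq : 0 < q) (m c i k j l : Fin 3) :
    ∑ a, ∑ d, (∑ b, qRhatTable q m a i b * qRhatTable q b d k c) * qRhatTable q j l a d =
    ∑ a, ∑ d, qRhatTable q a d i k * (∑ b, qRhatTable q m j a b * qRhatTable q b l d c) := by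
  have h0 := sq_ne_zero hq
  have e := sq_sq hq
  simp only [Fin.sum_univ_three]
  fin_cases m <;> fin_cases c <;> fin_cases i <;> fin_cases k <;> fin_cases j <;> fin_cases l <;>
    simp only [qRhatTable, h, ← e, Matrix.cons_val, Matrix.of_apply, Fin.isValue,
      Fin.reduceFinMk, Fin.zero_eta, Fin.mk_one,
      mul_zero, zero_mul, add_zero, zero_add, mul_one, one_mul]
  all_goals first | (field_simp; done) | (field_simp; ring)

end Braid

end QEuclid

namespace QEuclid

variable {q : ℝ} (hq : 0 < q) (hq1 : q ≠ 1)

/-! ### The basis `ξ^i ⊗ ξ^j` of the tensor square -/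

/-- The homomorphism `Φ` with `a (ξ^j ⊗ ξ^l) = ∑ (ξ^i ⊗ ξ^k) Φ(a)_{(i,k),(j,l)}`. -/
def comm2 : Alg q →ₐ[ℂ] Matrix (Fin 3 × Fin 3) (Fin 3 × Fin 3) (Alg q) :=
  (Matrix.compAlgEquiv (Fin 3) (Fin 3) (Alg q) ℂ).toAlgHom.comp ((comm hq).mapMatrix.comp (comm hq))

theorem comm2_apply (a : Alg q) (i k j l : Fin 3) :
    comm2 hq a (i, k) (j, l) = comm hq (comm hq a i j) k l := rfl

/-- The basis element `ξ^i ⊗ ξ^k`. -/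
def xiTens (q : ℝ) (p : Fin 3 × Fin 3) : BTensor (Alg q) (Form q) (Form q) :=
  tens q (xi q p.1) (xi q p.2)

theorem smul_xiTens (a : Alg q) (p : Fin 3 × Fin 3) :
    a • xiTens q p = ∑ r, MulOpposite.op (comm2 hq a r p) • xiTens q r := by
  simp only [xiTens, tens, BTensor.smul_mk, BTensor.op_smul_mk, smul_xi hq a, map_sum,
    LinearMap.sum_apply, BTensor.mk_balanced, smul_xi hq (comm hq a _ _), Fintype.sum_prod_type]
  rfl

/-- The coordinates of an element of the tensor square with respect to the basis `ξ^i ⊗ ξ^k`. -/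
def tensCoord : BTensor (Alg q) (Form q) (Form q) →ₗ[ℂ] (Fin 3 × Fin 3 → Alg q) :=
  BTensor.lift
    (LinearMap.mk₂ ℂ (fun ω η p => coord hq hq1 (coord hq hq1 ω p.1 • η) p.2)
      (by intros; ext; simp [add_smul]) (by intros; ext; simp)
      (by intros; ext; simp) (by
        intro c ω η
        ext p
        rw [← algebraMap_smul (Alg q) c η, smul_smul, ← Algebra.commutes, ← smul_smul,
          algebraMap_smul, map_smul]
        rfl))
    (by
      intro ω a η
      ext p
      simp only [LinearMap.mk₂_apply, coord_op_smul, mul_smul])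

theorem tensCoord_mk (ω η : Form q) (p : Fin 3 × Fin 3) :
    tensCoord hq hq1 (tens q ω η) p = coord hq hq1 (coord hq hq1 ω p.1 • η) p.2 := by
  rw [tensCoord, tens, BTensor.lift_mk]
  rfl

theorem eq_sum_xiTens (τ : BTensor (Alg q) (Form q) (Form q)) :
    τ = ∑ p, MulOpposite.op (tensCoord hq hq1 τ p) • xiTens q p := by
  let E : BTensor (Alg q) (Form q) (Form q) →ₗ[ℂ] BTensor (Alg q) (Form q) (Form q) :=
    { toFun := fun τ => ∑ p, MulOpposite.op (tensCoord hq hq1 τ p) • xiTens q p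
      map_add' := fun τ τ' => by
        simp only [map_add, Pi.add_apply, MulOpposite.op_add, add_smul, Finset.sum_add_distrib]
      map_smul' := fun c τ => by
        simp only [map_smul, Pi.smul_apply, MulOpposite.op_smul, smul_assoc, Finset.smul_sum,
          RingHom.id_apply] }
  have : LinearMap.id = E := by
    refine BTensor.hom_ext fun ω η => ?_
    change tens q ω η = ∑ p, MulOpposite.op (tensCoord hq hq1 (tens q ω η) p) • xiTens q p
    simp only [tensCoord_mk, xiTens, tens, BTensor.op_smul_mk, Fintype.sum_prod_type, ← map_sum]
    simp only [← eq_sum_xi hq hq1, ← BTensor.mk_balanced, ← LinearMap.sum_apply, ← map_sum]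
  exact LinearMap.congr_fun this τ

theorem tensCoord_smul (a : Alg q) (τ : BTensor (Alg q) (Form q) (Form q)) (p : Fin 3 × Fin 3) :
    tensCoord hq hq1 (a • τ) p = ∑ r, comm2 hq a p r * tensCoord hq hq1 τ r := by
  let f : BTensor (Alg q) (Form q) (Form q) →ₗ[ℂ] Alg q :=
    LinearMap.proj p ∘ₗ tensCoord hq hq1 ∘ₗ BTensor.leftAct (Alg q) (Form q) (Form q) a
  let g : BTensor (Alg q) (Form q) (Form q) →ₗ[ℂ] Alg q :=
    ∑ r, LinearMap.mulLeft ℂ (comm2 hq a p r) ∘ₗ LinearMap.proj r ∘ₗ tensCoord hq hq1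
  have hg : ∀ τ, g τ = ∑ r, comm2 hq a p r * tensCoord hq hq1 τ r := fun τ => by
    simp [g, LinearMap.sum_apply]
  have hfg : f = g := by
    refine BTensor.hom_ext fun ω η => ?_
    rw [hg]
    change tensCoord hq hq1 (a • tens q ω η) p = _
    rw [tens, BTensor.smul_mk]
    change tensCoord hq hq1 (tens q (a • ω) η) p =
      ∑ r, comm2 hq a p r * tensCoord hq hq1 (tens q ω η) r
    rw [tensCoord_mk, coord_smul hq hq1 a ω, Finset.sum_smul, map_sum, Finset.sum_apply,
      Fintype.sum_prod_type]
    refine Finset.sum_congr rfl fun j _ => ?_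
    rw [mul_smul, coord_smul]
    exact Finset.sum_congr rfl fun l _ => by rw [tensCoord_mk]; rfl
  rw [← hg, ← hfg]
  rfl

theorem tensCoord_op_smul (a : Alg q) (τ : BTensor (Alg q) (Form q) (Form q))
    (p : Fin 3 × Fin 3) :
    tensCoord hq hq1 (MulOpposite.op a • τ) p = tensCoord hq hq1 τ p * a := by
  let f : BTensor (Alg q) (Form q) (Form q) →ₗ[ℂ] Alg q := LinearMap.proj p ∘ₗ
    tensCoord hq hq1 ∘ₗ BTensor.rightAct (Alg q) (Form q) (Form q) (MulOpposite.op a)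
  let g : BTensor (Alg q) (Form q) (Form q) →ₗ[ℂ] Alg q :=
    LinearMap.mulRight ℂ a ∘ₗ LinearMap.proj p ∘ₗ tensCoord hq hq1
  have hfg : f = g := by
    refine BTensor.hom_ext fun ω η => ?_
    change tensCoord hq hq1 (MulOpposite.op a • tens q ω η) p = tensCoord hq hq1 (tens q ω η) p * a
    rw [tens, BTensor.op_smul_mk]
    change tensCoord hq hq1 (tens q ω (MulOpposite.op a • η)) p = _
    rw [tensCoord_mk, smul_comm, coord_op_smul, tensCoord_mk]
  exact LinearMap.congr_fun hfg τ

theorem tensCoord_xiTens (r p : Fin 3 × Fin 3) :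
    tensCoord hq hq1 (xiTens q r) p = if p = r then 1 else 0 := by
  obtain ⟨i, k⟩ := r
  obtain ⟨j, l⟩ := p
  rw [xiTens, tensCoord_mk, coord_xi]
  by_cases h1 : j = i
  · simp [h1, coord_xi]
  · simp [h1]

section Lift

variable {Q : Type} [AddCommGroup Q] [Module ℂ Q] [Module (Alg q) Q] [Module (Alg q)ᵐᵒᵖ Q]
  [IsScalarTower ℂ (Alg q) Q] [IsScalarTower ℂ (Alg q)ᵐᵒᵖ Q] [SMulCommClass (Alg q) (Alg q)ᵐᵒᵖ Q]

/-- The bimodule map with prescribed values `t` on the basis `ξ^i ⊗ ξ^k`; it exists as soon as `t`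
satisfies the commutation rules of the basis. -/
def tensLift (t : Fin 3 × Fin 3 → Q)
    (ht : ∀ a p, a • t p = ∑ r, MulOpposite.op (comm2 hq a r p) • t r) :
    BimodHom (Alg q) (BTensor (Alg q) (Form q) (Form q)) Q where
  toFun τ := ∑ p, MulOpposite.op (tensCoord hq hq1 τ p) • t p
  map_add' τ τ' := by
    simp only [map_add, Pi.add_apply, MulOpposite.op_add, add_smul, Finset.sum_add_distrib]
  map_smul' a τ := by
    simp only [tensCoord_smul, Finset.op_sum, Finset.sum_smul, MulOpposite.op_mul, mul_smul,
      Finset.smul_sum, RingHom.id_apply, smul_comm a, ht]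
    exact Finset.sum_comm
  map_right τ a := by
    change ∑ p, MulOpposite.op (tensCoord hq hq1 (MulOpposite.op a • τ) p) • t p =
      MulOpposite.op a • ∑ p, MulOpposite.op (tensCoord hq hq1 τ p) • t p
    simp only [tensCoord_op_smul, MulOpposite.op_mul, mul_smul, Finset.smul_sum]

theorem tensLift_xiTens (t : Fin 3 × Fin 3 → Q)
    (ht : ∀ a p, a • t p = ∑ r, MulOpposite.op (comm2 hq a r p) • t r) (r : Fin 3 × Fin 3) :
    tensLift hq hq1 t ht (xiTens q r) = t r := by
  change ∑ p, MulOpposite.op (tensCoord hq hq1 (xiTens q r) p) • t p = _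
  rw [Finset.sum_eq_single r]
  · rw [tensCoord_xiTens, if_pos rfl, MulOpposite.op_one, one_smul]
  · intro k _ hk
    rw [tensCoord_xiTens, if_neg hk, MulOpposite.op_zero, zero_smul]
  · simp

theorem bimodHom_apply_eq_sum (f : BimodHom (Alg q) (BTensor (Alg q) (Form q) (Form q)) Q)
    (τ : BTensor (Alg q) (Form q) (Form q)) :
    f τ = ∑ p, MulOpposite.op (tensCoord hq hq1 τ p) • f (xiTens q p) := by
  conv_lhs => rw [eq_sum_xiTens hq hq1 τ, map_sum]
  exact Finset.sum_congr rfl fun p _ => f.map_right _ _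

end Lift

end QEuclid

namespace QEuclid

variable {q : ℝ}

/-! ### The metric and the generalized flip -/

theorem comm2_x (hq : 0 < q) (m i k j l : Fin 3) : comm2 hq (x q m) (i, k) (j, l) =
    ∑ c, (∑ b, qRhatTable q m j i b * qRhatTable q b l k c) • x q c := by
  simp only [comm2_apply, comm_x, commX_apply, map_sum, map_smul, Matrix.sum_apply,
    Matrix.smul_apply, Finset.smul_sum, Finset.sum_smul, smul_smul]
  exact Finset.sum_comm

theorem comm2_lam (hq : 0 < q) (r p : Fin 3 × Fin 3) :
    comm2 hq (lam q) r p = if r = p then ((q : ℂ) ^ 2)⁻¹ • lam q else 0 := by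
  obtain ⟨i, k⟩ := r
  obtain ⟨j, l⟩ := p
  rw [comm2_apply, comm_lam, Matrix.diagonal_apply]
  by_cases h1 : i = j
  · rw [if_pos h1, map_smul, comm_lam, Matrix.smul_apply, Matrix.diagonal_apply]
    by_cases h2 : k = l
    · rw [if_pos h2, if_pos (by rw [h1, h2]), smul_smul, ← mul_inv, _root_.sq]
    · rw [if_neg h2, if_neg (fun h => h2 (congrArg Prod.snd h)), smul_zero]
  · rw [if_neg h1, if_neg (fun h => h1 (congrArg Prod.fst h)), map_zero]
    rfl

/-- The conformal factor `r² Λ²`. -/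
def weight (q : ℝ) : Alg q := r2 q * lam q ^ 2

theorem x_mul_weight (hq : 0 < q) (i : Fin 3) :
    x q i * weight q = (q : ℂ) ^ 2 • (weight q * x q i) := by
  rw [weight, ← mul_assoc, x_mul_r2 hq, mul_assoc, _root_.sq (lam q), ← mul_assoc (x q i),
    x_mul_lam, smul_mul_assoc, mul_assoc (lam q), x_mul_lam, _root_.sq (q : ℂ)]
  simp only [mul_assoc, mul_smul_comm, smul_smul]

theorem lam_mul_weight (hq : 0 < q) :
    lam q * weight q = ((q : ℂ) ^ 2)⁻¹ • (weight q * lam q) := by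
  have h0 := q_ne_zero hq
  have : weight q * lam q = (q : ℂ) ^ 2 • (lam q * weight q) := by
    rw [weight, mul_assoc, ← pow_succ, pow_succ', ← mul_assoc, r2_mul_lam, smul_mul_assoc,
      mul_assoc]
  rw [this, inv_smul_smul₀ (pow_ne_zero 2 h0)]

theorem comm_weight (hq : 0 < q) : comm hq (weight q) = Matrix.diagonal fun _ => weight q := by
  have h0 := q_ne_zero hq
  rw [weight, map_mul, map_pow, comm_r2, comm_lam, Matrix.diagonal_pow,
    Matrix.diagonal_mul_diagonal]
  congr 1
  funext i
  simp only [Pi.pow_apply, smul_pow, smul_mul_smul_comm]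
  convert one_smul ℂ _
  field_simp

theorem weight_smul_xi (hq : 0 < q) (i : Fin 3) :
    weight q • xi q i = MulOpposite.op (weight q) • xi q i := by
  rw [smul_xi hq, comm_weight, Finset.sum_eq_single i]
  · rw [Matrix.diagonal_apply_eq]
  · intro k _ hk
    rw [Matrix.diagonal_apply_ne _ hk, MulOpposite.op_zero, zero_smul]
  · simp

theorem smul_gMat_weight (hq : 0 < q) (a : Alg q) (p : Fin 3 × Fin 3) :
    a • (gMat q p.1 p.2 • weight q) =
      ∑ r, MulOpposite.op (comm2 hq a r p) • (gMat q r.1 r.2 • weight q) := by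
  have h0 := q_ne_zero hq
  refine smul_eq_sum_of_generators (comm2 hq) (fun p => gMat q p.1 p.2 • weight q)
    (fun m p => ?_) (fun p => ?_) a p
  · obtain ⟨j, l⟩ := p
    simp only [Fintype.sum_prod_type, comm2_x, op_smul_eq_mul, smul_eq_mul, mul_smul_comm,
      Finset.mul_sum, smul_mul_assoc, Finset.smul_sum, smul_smul]
    have e : ∀ c, ∑ i, ∑ k, ((∑ b, qRhatTable q m j i b * qRhatTable q b l k c) * gMat q i k) •
        (weight q * x q c) =
        if m = c then ((q : ℂ) ^ 2 * gMat q j l) • (weight q * x q c) else 0 := by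
      intro c
      simp only [← Finset.sum_smul, mul_comm _ (gMat q _ _), gMat_invariant hq]
      split_ifs <;> simp
    calc gMat q j l • (x q m * weight q)
        = ((q : ℂ) ^ 2 * gMat q j l) • (weight q * x q m) := by
          rw [x_mul_weight hq, smul_smul, mul_comm]
      _ = ∑ c, ∑ i, ∑ k, ((∑ b, qRhatTable q m j i b * qRhatTable q b l k c) * gMat q i k) •
          (weight q * x q c) := by
          simp only [e, Finset.sum_ite_eq, Finset.mem_univ, if_true]
      _ = _ := by
          rw [Finset.sum_comm]
          refine Finset.sum_congr rfl fun i _ => ?_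
          rw [Finset.sum_comm]
          refine Finset.sum_congr rfl fun k _ => Finset.sum_congr rfl fun c _ => ?_
          rw [mul_comm, Finset.mul_sum]
  · rw [Finset.sum_eq_single p]
    · rw [comm2_lam, if_pos rfl, op_smul_eq_mul, smul_eq_mul, mul_smul_comm, lam_mul_weight hq,
        mul_smul_comm, smul_mul_assoc, smul_comm]
    · intro r _ hr
      rw [comm2_lam, if_neg hr, MulOpposite.op_zero, zero_smul]
    · simp

/-- The metric `g₀` with `g₀ (ξ^i ⊗ ξ^j) = g^{ij} r² Λ²`. -/
def metric₀ (hq : 0 < q) (hq1 : q ≠ 1) : Metric (Alg q) (Form q) :=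
  tensLift hq hq1 (fun p => gMat q p.1 p.2 • weight q) (smul_gMat_weight hq)

theorem metric₀_xiTens (hq : 0 < q) (hq1 : q ≠ 1) (p : Fin 3 × Fin 3) :
    metric₀ hq hq1 (xiTens q p) = gMat q p.1 p.2 • weight q := tensLift_xiTens hq hq1 _ _ p

/-- A complex matrix as the matrix over `Alg q` acting on columns of coordinates. -/
def scalarMat (S : Matrix (Fin 3 × Fin 3) (Fin 3 × Fin 3) ℂ) :
    Matrix (Fin 3 × Fin 3) (Fin 3 × Fin 3) (Alg q) :=
  S.transpose.map (algebraMap ℂ (Alg q))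

theorem scalarMat_mul (S T : Matrix (Fin 3 × Fin 3) (Fin 3 × Fin 3) ℂ) :
    scalarMat (q := q) S * scalarMat T = scalarMat (T * S) := by
  rw [scalarMat, scalarMat, scalarMat, Matrix.transpose_mul, Matrix.map_mul]

theorem scalarMat_one : scalarMat (q := q) 1 = 1 := by
  rw [scalarMat, Matrix.transpose_one, Matrix.map_one _ (map_zero _) (map_one _)]

theorem commute_comm2_qRhat (hq : 0 < q) (a : Alg q) :
    Commute (comm2 hq a) (scalarMat (pairMatrix (qRhatTable q))) := by
  induction a using alg_induction with
  | hx m =>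
    ext ⟨i, k⟩ ⟨j, l⟩
    rw [Matrix.mul_apply, Matrix.mul_apply]
    simp only [Fintype.sum_prod_type, comm2_x, scalarMat, Matrix.map_apply, Matrix.transpose_apply,
      pairMatrix, Matrix.of_apply, ← Algebra.commutes (R := ℂ) (A := Alg q), ← Algebra.smul_def,
      Finset.smul_sum, smul_smul]
    have e : ∀ F : Fin 3 → Fin 3 → Fin 3 → ℂ, ∑ a, ∑ d, ∑ c, F a d c • x q c =
        ∑ c, (∑ a, ∑ d, F a d c) • x q c := by
      intro F
      simp only [Finset.sum_smul]
      rw [Finset.sum_comm]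
      conv_lhs => enter [2, d]; rw [Finset.sum_comm]
      rw [Finset.sum_comm]
      exact Finset.sum_congr rfl fun c _ => Finset.sum_comm
    rw [e, e]
    refine Finset.sum_congr rfl fun c _ => ?_
    rw [← qRhat_braid hq m c i k j l]
    simp only [mul_comm]
  | hlam =>
    ext r p
    rw [Matrix.mul_apply, Matrix.mul_apply]
    simp only [comm2_lam, ite_mul, zero_mul, mul_ite, mul_zero, Finset.sum_ite_eq,
      Finset.sum_ite_eq', Finset.mem_univ, if_true]
    exact (Algebra.commutes (R := ℂ) (A := Alg q) _ _).symm
  | hC c => rw [AlgHom.commutes]; exact Algebra.commute_algebraMap_left _ _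
  | hadd a b ha hb => rw [map_add]; exact ha.add_left hb
  | hmul a b ha hb => rw [map_mul]; exact ha.mul_left hb
  | hinv a b hab hba ha =>
    let u : (Matrix (Fin 3 × Fin 3) (Fin 3 × Fin 3) (Alg q))ˣ :=
      ⟨comm2 hq a, comm2 hq b, by rw [← map_mul, hab, map_one], by rw [← map_mul, hba, map_one]⟩
    exact Commute.units_inv_left (u := u) ha

theorem commute_comm2_qRhatInv (hq : 0 < q) (a : Alg q) :
    Commute (comm2 hq a) (scalarMat (pairMatrix (qRhatInvTable q))) := by
  let u : (Matrix (Fin 3 × Fin 3) (Fin 3 × Fin 3) (Alg q))ˣ :=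
    ⟨scalarMat (pairMatrix (qRhatTable q)), scalarMat (pairMatrix (qRhatInvTable q)),
      by rw [scalarMat_mul, mul_eq_one_comm.1 (pairMatrix_mul_inv hq), scalarMat_one],
      by rw [scalarMat_mul, pairMatrix_mul_inv hq, scalarMat_one]⟩
  exact Commute.units_inv_right (u := u) (commute_comm2_qRhat hq a)

variable (hq : 0 < q) (hq1 : q ≠ 1)

/-- The generalized flip `σ (ξ^i ⊗ ξ^j) = S^{ij}_{hk} ξ^h ⊗ ξ^k`. -/
def flip₀ (S : Matrix (Fin 3 × Fin 3) (Fin 3 × Fin 3) ℂ)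
    (hS : ∀ a, Commute (comm2 hq a) (scalarMat S)) :
    BimodHom (Alg q) (BTensor (Alg q) (Form q) (Form q)) (BTensor (Alg q) (Form q) (Form q)) :=
  tensLift hq hq1 (fun p => ∑ r, S p r • xiTens q r) (by
    intro a p
    have hl : a • ∑ r, S p r • xiTens q r =
        ∑ u, MulOpposite.op ((comm2 hq a * scalarMat S :
          Matrix (Fin 3 × Fin 3) (Fin 3 × Fin 3) (Alg q)) u p) • xiTens q u := by
      simp only [Finset.smul_sum, smul_comm a, smul_xiTens hq, Matrix.mul_apply, scalarMat,
        Matrix.map_apply, Matrix.transpose_apply, ← Algebra.commutes (R := ℂ) (A := Alg q),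
        ← Algebra.smul_def, Finset.op_sum, Finset.sum_smul, MulOpposite.op_smul, smul_assoc]
      exact Finset.sum_comm
    have hr : ∑ r, MulOpposite.op (comm2 hq a r p) • ∑ u, S r u • xiTens q u =
        ∑ u, MulOpposite.op ((scalarMat S * comm2 hq a :
          Matrix (Fin 3 × Fin 3) (Fin 3 × Fin 3) (Alg q)) u p) • xiTens q u := by
      simp only [Finset.smul_sum, Matrix.mul_apply, scalarMat,
        Matrix.map_apply, Matrix.transpose_apply,
        ← Algebra.smul_def, Finset.op_sum, Finset.sum_smul, MulOpposite.op_smul, smul_assoc]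
      rw [Finset.sum_comm]
      refine Finset.sum_congr rfl fun u _ => Finset.sum_congr rfl fun r _ => ?_
      rw [smul_comm]
    rw [hl, hr, (hS a).eq])

theorem flip₀_xiTens (S : Matrix (Fin 3 × Fin 3) (Fin 3 × Fin 3) ℂ)
    (hS : ∀ a, Commute (comm2 hq a) (scalarMat S)) (p : Fin 3 × Fin 3) :
    flip₀ hq hq1 S hS (xiTens q p) = ∑ r, S p r • xiTens q r := tensLift_xiTens hq hq1 _ _ p

end QEuclid

namespace QEuclid

variable {q : ℝ}

/-! ### The connection generated by the Dirac operator -/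

section Associativity

variable {A M : Type} [Ring A] [Algebra ℂ A]
  [AddCommGroup M] [Module ℂ M] [Module A M] [Module Aᵐᵒᵖ M]
  [IsScalarTower ℂ A M] [IsScalarTower ℂ Aᵐᵒᵖ M] [SMulCommClass A Aᵐᵒᵖ M]

theorem g₂₃_mk (g : Metric A M) (α β γ : M) :
    g.g₂₃ (BTensor.mk A (BTensor.mk A α β) γ) = MulOpposite.op (g (BTensor.mk A β γ)) • α := by
  simp only [Metric.g₂₃, BTensor.mapRight, LinearMap.comp_apply, BTensor.assoc_mk,
    BTensor.lift_mk]
  exact BTensor.lift_mk (A := A) (M := M) (N := A) _ _ α _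

theorem σ₂₃_mk {d : A →ₗ[ℂ] M} (C : LinearConnection d) (α β γ : M) :
    C.σ₂₃ (BTensor.mk A (BTensor.mk A α β) γ) =
      BTensor.assocInv (BTensor.mk A α (C.σ (BTensor.mk A β γ))) := by
  simp [LinearConnection.σ₂₃, BTensor.mapRight]

theorem D₂_mk {d : A →ₗ[ℂ] M} (C : LinearConnection d) (ξ η : M) :
    C.D₂ (BTensor.mk A ξ η) = BTensor.mk A (C.D ξ) η +
      C.σ₁₂ (BTensor.assocInv (BTensor.mk A ξ (C.D η))) := by
  simp [LinearConnection.D₂]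

/-- If `d` is the commutator with `θ`, every generalized flip `σ` belongs to a linear connection,
`D ξ = -θ ⊗ ξ + σ (ξ ⊗ θ)`. -/
def commutatorConnection {d : A →ₗ[ℂ] M} (θ : M)
    (hd : ∀ f, d f = f • θ - MulOpposite.op f • θ)
    (σ : BimodHom A (BTensor A M M) (BTensor A M M)) : LinearConnection d where
  D := -BTensor.mk A θ + (σ.toLinearMap.restrictScalars ℂ) ∘ₗ (BTensor.mk A).flip θ
  σ := σ
  left_leibniz f ξ := by
    simp only [LinearMap.add_apply, LinearMap.neg_apply, LinearMap.comp_apply,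
      LinearMap.flip_apply, LinearMap.coe_restrictScalars, ← BTensor.smul_mk, map_smul, hd, map_sub,
      LinearMap.sub_apply, BTensor.mk_balanced, smul_add, smul_neg]
    abel
  right_leibniz f ξ := by
    simp only [LinearMap.add_apply, LinearMap.neg_apply, LinearMap.comp_apply,
      LinearMap.flip_apply, LinearMap.coe_restrictScalars, ← BTensor.op_smul_mk, hd, map_sub,
      BTensor.mk_balanced, smul_add, smul_neg, σ.map_right]
    abel

theorem commutatorConnection_D {d : A →ₗ[ℂ] M} (θ : M)
    (hd : ∀ f, d f = f • θ - MulOpposite.op f • θ)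
    (σ : BimodHom A (BTensor A M M) (BTensor A M M)) (ξ : M) :
    (commutatorConnection θ hd σ).D ξ = -BTensor.mk A θ ξ + σ (BTensor.mk A ξ θ) := rfl

/-- The two middle terms of `D₂ (ξ ⊗ η)` cancel, and only the commutator terms at both ends
survive. -/
theorem commutatorConnection_D₂ {d : A →ₗ[ℂ] M} (θ : M)
    (hd : ∀ f, d f = f • θ - MulOpposite.op f • θ)
    (σ : BimodHom A (BTensor A M M) (BTensor A M M)) (ξ η : M) :
    (commutatorConnection θ hd σ).D₂ (BTensor.mk A ξ η) =
      -BTensor.mk A (BTensor.mk A θ ξ) η +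
        (commutatorConnection θ hd σ).σ₁₂ ((commutatorConnection θ hd σ).σ₂₃
          (BTensor.mk A (BTensor.mk A ξ η) θ)) := by
  have e : (commutatorConnection θ hd σ).σ₁₂ (BTensor.mk A (BTensor.mk A ξ θ) η) =
      BTensor.mk A (σ (BTensor.mk A ξ θ)) η := BTensor.mapLeft_mk _ _ _
  rw [D₂_mk, σ₂₃_mk, commutatorConnection_D, commutatorConnection_D]
  simp only [map_add, map_neg, LinearMap.add_apply, LinearMap.neg_apply, BTensor.assocInv_mk, e]
  change _ = -BTensor.mk A (BTensor.mk A θ ξ) η + (commutatorConnection θ hd σ).σ₁₂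
    (BTensor.assocInv (BTensor.mk A ξ (σ (BTensor.mk A η θ))))
  abel

/-- If the metric absorbs the flips up to the factor `κ`, then the two end terms of `D₂ ω` become
`-θ g(ω) + κ g(ω) θ`, which is `d g(ω) + (κ - 1) g(ω) θ`. -/
theorem g₂₃_D₂_commutatorConnection {d : A →ₗ[ℂ] M} (θ : M)
    (hd : ∀ f, d f = f • θ - MulOpposite.op f • θ)
    (σ : BimodHom A (BTensor A M M) (BTensor A M M)) (g : Metric A M) (κ : ℂ)
    (hg : ∀ ω ζ, g.g₂₃ ((commutatorConnection θ hd σ).σ₁₂ ((commutatorConnection θ hd σ).σ₂₃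
      (BTensor.mk A ω ζ))) = κ • g ω • ζ) (ω : BTensor A M M) :
    g.g₂₃ ((commutatorConnection θ hd σ).D₂ ω) = d (g ω) + (κ - 1) • g ω • θ := by
  let f : BTensor A M M →ₗ[ℂ] M := g.g₂₃ ∘ₗ (commutatorConnection θ hd σ).D₂
  let gC : BTensor A M M →ₗ[ℂ] A := g.toLinearMap.restrictScalars ℂ
  let f' : BTensor A M M →ₗ[ℂ] M := d ∘ₗ gC +
    (κ - 1) • (LinearMap.toSpanSingleton A M θ).restrictScalars ℂ ∘ₗ gC
  have : f = f' := by
    refine BTensor.hom_ext fun ξ η => ?_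
    change g.g₂₃ ((commutatorConnection θ hd σ).D₂ (BTensor.mk A ξ η)) =
      d (g (BTensor.mk A ξ η)) + (κ - 1) • g (BTensor.mk A ξ η) • θ
    rw [commutatorConnection_D₂, map_add, map_neg, g₂₃_mk, hg, hd, sub_smul, one_smul]
    abel
  exact LinearMap.congr_fun this ω

end Associativity

theorem bimodHom_ext {Q : Type} [AddCommGroup Q] [Module ℂ Q] [Module (Alg q) Q]
    [Module (Alg q)ᵐᵒᵖ Q] [IsScalarTower ℂ (Alg q) Q] [IsScalarTower ℂ (Alg q)ᵐᵒᵖ Q]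
    [SMulCommClass (Alg q) (Alg q)ᵐᵒᵖ Q] (hq : 0 < q) (hq1 : q ≠ 1)
    {f g : BimodHom (Alg q) (BTensor (Alg q) (Form q) (Form q)) Q}
    (h : ∀ p, f (xiTens q p) = g (xiTens q p)) : f = g := by
  refine BimodHom.ext (funext fun τ => ?_)
  change f τ = g τ
  rw [bimodHom_apply_eq_sum hq hq1 f, bimodHom_apply_eq_sum hq hq1 g]
  simp only [h]

/-- A connection of the form `IsD0` is determined by the matrix `S`. -/
theorem IsD0.unique {S : Matrix (Fin 3 × Fin 3) (Fin 3 × Fin 3) ℂ} {C C' : LinearConnection (d q)}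
    (hq : 0 < q) (hq1 : q ≠ 1) (h : IsD0 q S C) (h' : IsD0 q S C') : C' = C := by
  have hσ : C'.σ = C.σ := by
    refine bimodHom_ext hq hq1 fun p => ?_
    exact (h'.1 p.1 p.2).trans (h.1 p.1 p.2).symm
  refine LinearConnection.ext ?_ hσ
  ext ξ
  rw [h.2, h'.2, hσ]

variable (hq : 0 < q) (hq1 : q ≠ 1)

/-- The connection attached to `S`. -/
def connection₀ (S : Matrix (Fin 3 × Fin 3) (Fin 3 × Fin 3) ℂ)
    (hS : ∀ a, Commute (comm2 hq a) (scalarMat S)) : LinearConnection (d q) :=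
  commutatorConnection (theta q) (d_eq_commutator hq hq1) (flip₀ hq hq1 S hS)

theorem isD0_connection₀ (S : Matrix (Fin 3 × Fin 3) (Fin 3 × Fin 3) ℂ)
    (hS : ∀ a, Commute (comm2 hq a) (scalarMat S)) : IsD0 q S (connection₀ hq hq1 S hS) := by
  refine ⟨fun i j => ?_, fun ξ => rfl⟩
  change flip₀ hq hq1 S hS (xiTens q (i, j)) = _
  rw [flip₀_xiTens, Fintype.sum_prod_type]
  rfl

/-- Passing a form `ζ` through the two slots of the metric by means of `σ` costs the factor `κ`:
on the basis this is the identity of matrix entries between `S` and the metric matrix. -/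
theorem g₂₃_σ₁₂_σ₂₃ (S : Matrix (Fin 3 × Fin 3) (Fin 3 × Fin 3) ℂ) (κ : ℂ)
    (hS : ∀ a, Commute (comm2 hq a) (scalarMat S))
    (hκ : ∀ i h m n, ∑ j, ∑ k, ∑ l, S (i, j) (h, k) * gMat q k l * S (m, n) (j, l) =
      κ * gMat q i m * (if n = h then 1 else 0))
    (ω : BTensor (Alg q) (Form q) (Form q)) (ζ : Form q) :
    (metric₀ hq hq1).g₂₃ ((connection₀ hq hq1 S hS).σ₁₂ ((connection₀ hq hq1 S hS).σ₂₃
      (BTensor.mk (Alg q) ω ζ))) = κ • metric₀ hq hq1 ω • ζ := by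
  set F : BTensor (Alg q) (BTensor (Alg q) (Form q) (Form q)) (Form q) →ₗ[ℂ] Form q :=
    (metric₀ hq hq1).g₂₃ ∘ₗ (connection₀ hq hq1 S hS).σ₁₂ ∘ₗ (connection₀ hq hq1 S hS).σ₂₃ with hF
  change F (BTensor.mk (Alg q) ω ζ) = _
  -- the value on `ξ^i ⊗ ξ^m ⊗ ξ^n c`
  have h1 : ∀ (i m n : Fin 3) (c : Alg q),
      F (BTensor.mk (Alg q) (xiTens q (i, m)) (MulOpposite.op c • xi q n)) =
        κ • gMat q i m • MulOpposite.op c • MulOpposite.op (weight q) • xi q n := by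
    intro i m n c
    have e1 : (connection₀ hq hq1 S hS).σ₂₃
        (BTensor.mk (Alg q) (xiTens q (i, m)) (MulOpposite.op c • xi q n)) =
        ∑ j, ∑ l, S (m, n) (j, l) • BTensor.mk (Alg q) (xiTens q (i, j))
          (MulOpposite.op c • xi q l) := by
      rw [xiTens, tens, σ₂₃_mk, ← BTensor.op_smul_mk]
      change BTensor.assocInv (BTensor.mk (Alg q) (xi q i) (flip₀ hq hq1 S hS
        (MulOpposite.op c • xiTens q (m, n)))) = _
      rw [(flip₀ hq hq1 S hS).map_right, flip₀_xiTens, Fintype.sum_prod_type]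
      simp only [Finset.smul_sum, map_sum, smul_comm (MulOpposite.op c), map_smul, xiTens, tens,
        BTensor.op_smul_mk, BTensor.assocInv_mk]
    have e2 : ∀ j l, (metric₀ hq hq1).g₂₃ ((connection₀ hq hq1 S hS).σ₁₂
        (BTensor.mk (Alg q) (xiTens q (i, j)) (MulOpposite.op c • xi q l))) =
        ∑ a, ∑ k, (S (i, j) (a, k) * gMat q k l) • MulOpposite.op c • MulOpposite.op (weight q) •
          xi q a := by
      intro j l
      change (metric₀ hq hq1).g₂₃ (BTensor.mapLeft (flip₀ hq hq1 S hS)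
        (BTensor.mk (Alg q) (xiTens q (i, j)) (MulOpposite.op c • xi q l))) = _
      rw [BTensor.mapLeft_mk, flip₀_xiTens, Fintype.sum_prod_type]
      simp only [map_sum, map_smul, LinearMap.sum_apply, LinearMap.smul_apply, xiTens, tens,
        g₂₃_mk]
      refine Finset.sum_congr rfl fun a _ => Finset.sum_congr rfl fun k _ => ?_
      rw [← BTensor.op_smul_mk]
      change S (i, j) (a, k) • MulOpposite.op (metric₀ hq hq1 (MulOpposite.op c • xiTens q (k, l)))
        • xi q a = _
      rw [(metric₀ hq hq1).map_right, metric₀_xiTens, op_smul_eq_mul, smul_mul_assoc,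
        MulOpposite.op_smul, MulOpposite.op_mul, smul_assoc]
      simp only [mul_smul]
    rw [hF, LinearMap.comp_apply, LinearMap.comp_apply, e1]
    simp only [map_sum, map_smul, e2]
    calc _ = ∑ a, (∑ j, ∑ k, ∑ l, S (i, j) (a, k) * gMat q k l * S (m, n) (j, l)) •
          MulOpposite.op c • MulOpposite.op (weight q) • xi q a := by
          simp only [Finset.smul_sum, Finset.sum_smul, smul_smul]
          conv_rhs => rw [Finset.sum_comm]
          refine Finset.sum_congr rfl fun j _ => ?_
          rw [Finset.sum_comm]
          refine Finset.sum_congr rfl fun a _ => ?_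
          rw [Finset.sum_comm]
          refine Finset.sum_congr rfl fun k _ => Finset.sum_congr rfl fun l _ => ?_
          rw [mul_comm (S (m, n) _)]
      _ = _ := by
          simp only [hκ, mul_ite, mul_one, mul_zero, ite_smul, zero_smul, Finset.sum_ite_eq,
            Finset.mem_univ, if_true, mul_smul]
  -- extension in the last factor
  have h2 : ∀ (p : Fin 3 × Fin 3) (ζ : Form q), F (BTensor.mk (Alg q) (xiTens q p) ζ) =
      κ • metric₀ hq hq1 (xiTens q p) • ζ := by
    intro p ζ
    conv_lhs => rw [eq_sum_xi hq hq1 ζ]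
    conv_rhs => rw [eq_sum_xi hq hq1 ζ]
    simp only [map_sum, Finset.smul_sum]
    refine Finset.sum_congr rfl fun n _ => ?_
    rw [h1, metric₀_xiTens, smul_assoc, smul_comm (weight q), weight_smul_xi hq]
  conv_lhs => rw [eq_sum_xiTens hq hq1 ω]
  conv_rhs => rw [eq_sum_xiTens hq hq1 ω]
  simp only [map_sum, LinearMap.sum_apply, BTensor.mk_balanced, h2, Finset.smul_sum,
    Finset.sum_smul]
  refine Finset.sum_congr rfl fun p _ => ?_
  rw [(metric₀ hq hq1).map_right, op_smul_eq_mul, mul_smul]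

/-- The Dirac operator does not vanish, since otherwise all coordinates, hence `r²`, would. -/
theorem theta_ne_zero (hq : 0 < q) (hq1 : q ≠ 1) [Nontrivial (Alg q)] : theta q ≠ 0 := by
  intro h
  have h0 := q_ne_zero hq
  have h1 := q_sub_one_ne_zero hq1
  have hx : ∀ k, xLow q k = 0 := by
    intro k
    have e := coord_theta hq hq1 k
    rw [h, map_zero, Pi.zero_apply, thetaCoord, eq_comm, smul_eq_zero] at e
    rcases e with e | e
    · exact absurd e (mul_ne_zero (inv_ne_zero h1) (inv_ne_zero h0))
    · rw [← mul_one (xLow q k), ← rInv2_mul_r2, ← mul_assoc, e, zero_mul]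
  have hr : r2 q = ∑ i, x q i * xLow q i := by
    simp only [r2, xLow_apply, Finset.mul_sum, mul_smul_comm]
  have : (1 : Alg q) = 0 := by
    rw [← rInv2_mul_r2, hr]
    simp [hx]
  exact one_ne_zero this

/-- The conformal factor `r² Λ²` is invertible, so it acts injectively. -/
theorem eq_zero_of_weight_smul_eq_zero (M : Type) [AddCommGroup M] [Module (Alg q) M] {m : M}
    (h : weight q • m = 0) : m = 0 := by
  have e : (lamInv q ^ 2 * rInv2 q) * weight q = 1 := by
    rw [weight, mul_assoc, ← mul_assoc (rInv2 q), rInv2_mul_r2, one_mul, _root_.sq, _root_.sq,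
      mul_assoc, ← mul_assoc (lamInv q) (lam q), lamInv_mul_lam, one_mul, lamInv_mul_lam]
  rw [← one_smul (Alg q) m, ← e, mul_smul, h, smul_zero]

end QEuclid

namespace QEuclid

variable {q : ℝ}

/-! ### A Poincaré–Birkhoff–Witt basis of the function algebra -/

section Shift

variable {I : Type}

/-- The weighted shift `e_i ↦ α_i e_{σ i}` of the vector space with basis `e_i`. -/
def shift (σ : I → I) (α : I → ℂ) : (I →₀ ℂ) →ₗ[ℂ] (I →₀ ℂ) :=
  Finsupp.linearCombination ℂ fun i => α i • Finsupp.single (σ i) 1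

theorem shift_single (σ : I → I) (α : I → ℂ) (i : I) :
    shift σ α (Finsupp.single i 1) = α i • Finsupp.single (σ i) 1 := by
  rw [shift, Finsupp.linearCombination_single, one_smul]

theorem shift_apply (σ : I → I) (hσ : Function.Injective σ) (α : I → ℂ) (g : I →₀ ℂ) (i : I) :
    shift σ α g (σ i) = α i * g i := by
  classical
  induction g using Finsupp.induction_linear with
  | zero => simp
  | add f g hf hg => rw [map_add, Finsupp.add_apply, hf, hg, Finsupp.add_apply, mul_add]
  | single j c =>
    rw [← mul_one c, ← smul_eq_mul, ← Finsupp.smul_single, map_smul, shift_single]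
    simp only [Finsupp.smul_apply, Finsupp.single_apply, smul_eq_mul]
    by_cases h : j = i
    · subst h; simp [mul_comm]
    · rw [if_neg h, if_neg fun h' => h (hσ h')]; simp

theorem shift_apply_eq_zero (σ : I → I) (α : I → ℂ) (g : I →₀ ℂ) (p : I)
    (h : ∀ i, σ i = p → α i * g i = 0) : shift σ α g p = 0 := by
  classical
  rw [shift, Finsupp.linearCombination_apply, Finsupp.sum, Finsupp.finsetSum_apply]
  refine Finset.sum_eq_zero fun i _ => ?_
  simp only [Finsupp.smul_apply, Finsupp.single_apply, smul_eq_mul]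
  by_cases hi : σ i = p
  · rw [if_pos hi, mul_one, mul_comm, h i hi]
  · rw [if_neg hi]; simp

end Shift

/-- The index `(k, b, n, m)` stands for the monomial `(x⁰)^b r^{2n} v^k Λ^m`, where `v^k` is a power
of `x⁺` for `k ≥ 0` and the power `(x⁻)^{-k}` for `k ≤ 0`. -/
abbrev Idx : Type := ℤ × ℕ × ℤ × ℤ

/-- The vector space with basis the monomials. -/
abbrev Mon : Type := Idx →₀ ℂ

/-- A basis vector. -/
def mono (k : ℤ) (b : ℕ) (n m : ℤ) : Mon := Finsupp.single (k, b, n, m) 1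

/-- The number `√q + 1/√q`. -/
def two (q : ℝ) : ℂ := sq q + (sq q)⁻¹

/-- The degree of a monomial in the coordinates. -/
def deg (i : Idx) : ℤ := i.2.1 + 2 * i.2.2.1 + |i.1|

/-- The main terms of multiplication by `x⁺`. -/
def plusMain (i : Idx) : Idx := (i.1 + 1, i.2.1, if 0 ≤ i.1 then i.2.2.1 else i.2.2.1 + 1, i.2.2.2)

/-- The correction terms of multiplication by `x⁺`, which occur next to a power of `x⁻`. -/
def plusCorr (i : Idx) : Idx := (i.1 + 1, i.2.1 + 2, i.2.2.1, i.2.2.2)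

/-- Left multiplication by `x⁺`. -/
def opPlus (q : ℝ) : Mon →ₗ[ℂ] Mon :=
  shift plusMain (fun i => ((q : ℂ) ^ i.2.1)⁻¹ * if 0 ≤ i.1 then 1 else (two q)⁻¹) +
  shift plusCorr (fun i => if 0 ≤ i.1 then 0 else -(((q : ℂ) ^ i.2.1)⁻¹ * (two q)⁻¹ * (q : ℂ)⁻¹))

/-- Right multiplication by `x⁺`. -/
def opPlusRight (q : ℝ) : Mon →ₗ[ℂ] Mon :=
  shift plusMain (fun i => ((q : ℂ) ^ i.2.2.2)⁻¹ * if 0 ≤ i.1 then 1 else (two q)⁻¹) +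
  shift plusCorr (fun i => if 0 ≤ i.1 then 0 else
    -(((q : ℂ) ^ i.2.2.2)⁻¹ * (two q)⁻¹ * (q : ℂ) ^ (-1 - 2 * i.1)))

/-- Left multiplication by `x⁻`. -/
def opMinus (q : ℝ) : Mon →ₗ[ℂ] Mon :=
  shift (fun i => (i.1 - 1, i.2.1, if i.1 ≤ 0 then i.2.2.1 else i.2.2.1 + 1, i.2.2.2))
    (fun i => (q : ℂ) ^ i.2.1 * if i.1 ≤ 0 then 1 else (two q)⁻¹) +
  shift (fun i => (i.1 - 1, i.2.1 + 2, i.2.2.1, i.2.2.2))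
    (fun i => if i.1 ≤ 0 then 0 else -((q : ℂ) ^ i.2.1 * (two q)⁻¹ * (q : ℂ)))

/-- The shift of the exponent of `x⁰`. -/
def zeroShift (i : Idx) : Idx := (i.1, i.2.1 + 1, i.2.2.1, i.2.2.2)

/-- The shift of the exponent of `r²`. -/
def r2Shift (i : Idx) : Idx := (i.1, i.2.1, i.2.2.1 + 1, i.2.2.2)

/-- The shift of the exponent of `Λ`. -/
def lamShift (i : Idx) : Idx := (i.1, i.2.1, i.2.2.1, i.2.2.2 + 1)

/-- Left multiplication by `x⁰`. -/
def opZero : Mon →ₗ[ℂ] Mon := shift zeroShift fun _ => 1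

/-- Right multiplication by `x⁰`. -/
def opZeroRight (q : ℝ) : Mon →ₗ[ℂ] Mon :=
  shift zeroShift fun i => (q : ℂ) ^ (-i.2.2.2 - i.1)

/-- Left multiplication by `r²`. -/
def opR2 : Mon →ₗ[ℂ] Mon := shift r2Shift fun _ => 1

/-- Right multiplication by `r²`. -/
def opR2Right (q : ℝ) : Mon →ₗ[ℂ] Mon := shift r2Shift fun i => (q : ℂ) ^ (-2 * i.2.2.2)

/-- Left multiplication by `r⁻²`. -/
def opRInv : Mon →ₗ[ℂ] Mon := shift (fun i => (i.1, i.2.1, i.2.2.1 - 1, i.2.2.2)) fun _ => 1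

/-- Left multiplication by `Λ`. -/
def opLam (q : ℝ) : Mon →ₗ[ℂ] Mon := shift lamShift fun i => (q : ℂ) ^ (-deg i)

/-- Right multiplication by `Λ`. -/
def opLamRight : Mon →ₗ[ℂ] Mon := shift lamShift fun _ => 1

/-- Left multiplication by `Λ⁻¹`. -/
def opLamInv (q : ℝ) : Mon →ₗ[ℂ] Mon :=
  shift (fun i => (i.1, i.2.1, i.2.2.1, i.2.2.2 - 1)) fun i => (q : ℂ) ^ deg i

theorem opPlus_nonneg {k : ℤ} (hk : 0 ≤ k) (b : ℕ) (n m : ℤ) :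
    opPlus q (mono k b n m) = ((q : ℂ) ^ b)⁻¹ • mono (k + 1) b n m := by
  simp [opPlus, mono, shift_single, plusMain, hk]

theorem opPlus_neg {k : ℤ} (hk : k < 0) (b : ℕ) (n m : ℤ) : opPlus q (mono k b n m) =
    (((q : ℂ) ^ b)⁻¹ * (two q)⁻¹) • (mono (k + 1) b (n + 1) m -
      (q : ℂ)⁻¹ • mono (k + 1) (b + 2) n m) := by
  simp only [opPlus, mono, LinearMap.add_apply, shift_single, plusMain, plusCorr, not_le.2 hk,
    if_false, smul_sub, smul_smul, neg_smul, ← sub_eq_add_neg]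

theorem opPlusRight_nonneg {k : ℤ} (hk : 0 ≤ k) (b : ℕ) (n m : ℤ) :
    opPlusRight q (mono k b n m) = ((q : ℂ) ^ m)⁻¹ • mono (k + 1) b n m := by
  simp [opPlusRight, mono, shift_single, plusMain, hk]

theorem opPlusRight_neg {k : ℤ} (hk : k < 0) (b : ℕ) (n m : ℤ) :
    opPlusRight q (mono k b n m) = (((q : ℂ) ^ m)⁻¹ * (two q)⁻¹) • (mono (k + 1) b (n + 1) m -
      (q : ℂ) ^ (-1 - 2 * k) • mono (k + 1) (b + 2) n m) := by
  simp only [opPlusRight, mono, LinearMap.add_apply, shift_single, plusMain, plusCorr, not_le.2 hk,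
    if_false, smul_sub, smul_smul, neg_smul, ← sub_eq_add_neg]

theorem opMinus_nonpos {k : ℤ} (hk : k ≤ 0) (b : ℕ) (n m : ℤ) :
    opMinus q (mono k b n m) = (q : ℂ) ^ b • mono (k - 1) b n m := by
  simp [opMinus, mono, shift_single, hk]

theorem opMinus_pos {k : ℤ} (hk : 0 < k) (b : ℕ) (n m : ℤ) : opMinus q (mono k b n m) =
    ((q : ℂ) ^ b * (two q)⁻¹) • (mono (k - 1) b (n + 1) m -
      (q : ℂ) • mono (k - 1) (b + 2) n m) := by
  simp only [opMinus, mono, LinearMap.add_apply, shift_single, not_le.2 hk,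
    if_false, smul_sub, smul_smul, neg_smul, ← sub_eq_add_neg]

theorem opZero_mono (k : ℤ) (b : ℕ) (n m : ℤ) : opZero (mono k b n m) = mono k (b + 1) n m := by
  simp [opZero, mono, shift_single, zeroShift]

theorem opZeroRight_mono (k : ℤ) (b : ℕ) (n m : ℤ) :
    opZeroRight q (mono k b n m) = (q : ℂ) ^ (-m - k) • mono k (b + 1) n m := by
  simp only [opZeroRight, mono, shift_single, zeroShift]

theorem opR2_mono (k : ℤ) (b : ℕ) (n m : ℤ) : opR2 (mono k b n m) = mono k b (n + 1) m := by
  simp [opR2, mono, shift_single, r2Shift]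

theorem opR2Right_mono (k : ℤ) (b : ℕ) (n m : ℤ) :
    opR2Right q (mono k b n m) = (q : ℂ) ^ (-2 * m) • mono k b (n + 1) m := by
  simp only [opR2Right, mono, shift_single, r2Shift]

theorem opRInv_mono (k : ℤ) (b : ℕ) (n m : ℤ) : opRInv (mono k b n m) = mono k b (n - 1) m := by
  simp [opRInv, mono, shift_single]

theorem opLam_mono (k : ℤ) (b : ℕ) (n m : ℤ) :
    opLam q (mono k b n m) = (q : ℂ) ^ (-(b + 2 * n + |k|)) • mono k b n (m + 1) := by
  simp only [opLam, mono, shift_single, lamShift, deg]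

theorem opLamRight_mono (k : ℤ) (b : ℕ) (n m : ℤ) :
    opLamRight (mono k b n m) = mono k b n (m + 1) := by
  simp [opLamRight, mono, shift_single, lamShift]

theorem opLamInv_mono (k : ℤ) (b : ℕ) (n m : ℤ) :
    opLamInv q (mono k b n m) = (q : ℂ) ^ ((b : ℤ) + 2 * n + |k|) • mono k b n (m - 1) := by
  simp only [opLamInv, mono, shift_single, deg]

theorem mon_ext {V : Type} [AddCommGroup V] [Module ℂ V] {f g : Mon →ₗ[ℂ] V}
    (h : ∀ k b n m, f (mono k b n m) = g (mono k b n m)) : f = g :=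
  Finsupp.lhom_ext' fun i => LinearMap.ext_ring (h i.1 i.2.1 i.2.2.1 i.2.2.2)

section Relations

theorem opPlus_opMinus (hq : 0 < q) (k : ℤ) (b : ℕ) (n m : ℤ) :
    opPlus q (opMinus q (mono k b n m)) =
    (two q)⁻¹ • (mono k b (n + 1) m - (q : ℂ)⁻¹ • mono k (b + 2) n m) := by
  have h0 := q_ne_zero hq
  rcases le_or_gt k 0 with hk | hk
  · rw [opMinus_nonpos hk, map_smul, opPlus_neg (by omega), smul_smul, sub_add_cancel]
    congr 1
    field_simp
  · rw [opMinus_pos hk, map_smul, map_sub, map_smul, opPlus_nonneg (by omega),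
      opPlus_nonneg (by omega), sub_add_cancel]
    simp only [smul_sub, smul_smul]
    match_scalars <;> field_simp <;> ring

theorem opMinus_opPlus (hq : 0 < q) (k : ℤ) (b : ℕ) (n m : ℤ) :
    opMinus q (opPlus q (mono k b n m)) =
    (two q)⁻¹ • (mono k b (n + 1) m - (q : ℂ) • mono k (b + 2) n m) := by
  have h0 := q_ne_zero hq
  rcases le_or_gt 0 k with hk | hk
  · rw [opPlus_nonneg hk, map_smul, opMinus_pos (by omega), smul_smul, add_sub_cancel_right]
    congr 1
    field_simp
  · rw [opPlus_neg hk, map_smul, map_sub, map_smul, opMinus_nonpos (by omega),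
      opMinus_nonpos (by omega), add_sub_cancel_right]
    simp only [smul_sub, smul_smul]
    match_scalars <;> field_simp <;> ring

/-- The combination of operators that represents `r²` is the shift of the exponent of `r²`. -/
theorem r2_op (hq : 0 < q) (k : ℤ) (b : ℕ) (n m : ℤ) :
    (sq q)⁻¹ • opMinus q (opPlus q (mono k b n m)) + opZero (opZero (mono k b n m)) +
      sq q • opPlus q (opMinus q (mono k b n m)) = mono k b (n + 1) m := by
  have h0 := sq_ne_zero hq
  have h1 := sq_add_inv_ne_zero hq
  have h2 : sq q ^ 2 + 1 ≠ 0 := by rw [sq_sq hq]; exact q_add_one_ne_zero hq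
  rw [opPlus_opMinus hq, opMinus_opPlus hq, opZero_mono, opZero_mono, two, ← sq_sq hq]
  match_scalars <;> field_simp <;> ring

theorem opMinus_opZero : opMinus q ∘ₗ opZero = (q : ℂ) • (opZero ∘ₗ opMinus q) := by
  refine mon_ext fun k b n m => ?_
  simp only [LinearMap.comp_apply, LinearMap.smul_apply, opZero_mono]
  rcases le_or_gt k 0 with hk | hk
  · rw [opMinus_nonpos hk, opMinus_nonpos hk, map_smul, opZero_mono, smul_smul, pow_succ']
  · rw [opMinus_pos hk, opMinus_pos hk, map_smul, map_sub, map_smul, opZero_mono, opZero_mono,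
      smul_smul, pow_succ', mul_assoc]

theorem opPlus_opZero : opPlus q ∘ₗ opZero = (q : ℂ)⁻¹ • (opZero ∘ₗ opPlus q) := by
  refine mon_ext fun k b n m => ?_
  simp only [LinearMap.comp_apply, LinearMap.smul_apply, opZero_mono]
  rcases le_or_gt 0 k with hk | hk
  · rw [opPlus_nonneg hk, opPlus_nonneg hk, map_smul, opZero_mono, smul_smul, pow_succ', mul_inv]
  · rw [opPlus_neg hk, opPlus_neg hk, map_smul, map_sub, map_smul, opZero_mono, opZero_mono,
      smul_smul, pow_succ', mul_inv, mul_assoc]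

theorem opPlus_opLam (hq : 0 < q) : opPlus q ∘ₗ opLam q = (q : ℂ) • (opLam q ∘ₗ opPlus q) := by
  have h0 := q_ne_zero hq
  refine mon_ext fun k b n m => ?_
  simp only [LinearMap.comp_apply, LinearMap.smul_apply, opLam_mono, map_smul]
  rcases le_or_gt 0 k with hk | hk
  · rw [opPlus_nonneg hk, opPlus_nonneg hk, map_smul, opLam_mono, abs_of_nonneg hk,
      abs_of_nonneg (by omega)]
    simp only [smul_smul]
    congr 1
    rw [show -((b : ℤ) + 2 * n + k) = 1 + -((b : ℤ) + 2 * n + (k + 1)) by ring, zpow_add₀ h0,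
      zpow_one]
    ring
  · rw [opPlus_neg hk, opPlus_neg hk, map_smul, map_sub, map_smul, opLam_mono, opLam_mono,
      abs_of_neg hk, abs_of_nonpos (by omega)]
    have e : (q : ℂ) ^ (-((b : ℤ) + 2 * n + -k)) =
        q * (q : ℂ) ^ (-((b : ℤ) + 2 * (n + 1) + -(k + 1))) := by
      rw [show -((b : ℤ) + 2 * n + -k) = 1 + -((b : ℤ) + 2 * (n + 1) + -(k + 1)) by ring,
        zpow_add₀ h0, zpow_one]
    have e' : -(((b + 2 : ℕ) : ℤ) + 2 * n + -(k + 1)) = -((b : ℤ) + 2 * (n + 1) + -(k + 1)) := by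
      push_cast; ring
    rw [e, e']
    module

theorem opMinus_opLam (hq : 0 < q) : opMinus q ∘ₗ opLam q = (q : ℂ) • (opLam q ∘ₗ opMinus q) := by
  have h0 := q_ne_zero hq
  refine mon_ext fun k b n m => ?_
  simp only [LinearMap.comp_apply, LinearMap.smul_apply, opLam_mono, map_smul]
  rcases le_or_gt k 0 with hk | hk
  · rw [opMinus_nonpos hk, opMinus_nonpos hk, map_smul, opLam_mono, abs_of_nonpos hk,
      abs_of_nonpos (by omega)]
    simp only [smul_smul]
    congr 1
    rw [show -((b : ℤ) + 2 * n + -k) = 1 + -((b : ℤ) + 2 * n + -(k - 1)) by ring, zpow_add₀ h0,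
      zpow_one]
    ring
  · rw [opMinus_pos hk, opMinus_pos hk, map_smul, map_sub, map_smul, opLam_mono, opLam_mono,
      abs_of_pos hk, abs_of_nonneg (by omega)]
    have e : (q : ℂ) ^ (-((b : ℤ) + 2 * n + k)) =
        q * (q : ℂ) ^ (-((b : ℤ) + 2 * (n + 1) + (k - 1))) := by
      rw [show -((b : ℤ) + 2 * n + k) = 1 + -((b : ℤ) + 2 * (n + 1) + (k - 1)) by ring,
        zpow_add₀ h0, zpow_one]
    have e' : -(((b + 2 : ℕ) : ℤ) + 2 * n + (k - 1)) = -((b : ℤ) + 2 * (n + 1) + (k - 1)) := by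
      push_cast; ring
    rw [e, e']
    module

theorem opZero_opLam (hq : 0 < q) : opZero ∘ₗ opLam q = (q : ℂ) • (opLam q ∘ₗ opZero) := by
  have h0 := q_ne_zero hq
  refine mon_ext fun k b n m => ?_
  simp only [LinearMap.comp_apply, LinearMap.smul_apply, opLam_mono, map_smul, opZero_mono,
    smul_smul]
  congr 1
  rw [← zpow_one_add₀ h0]
  congr 1
  push_cast
  ring

theorem opPlusRight_comm_opPlus (hq : 0 < q) :
    opPlusRight q ∘ₗ opPlus q = opPlus q ∘ₗ opPlusRight q := by
  have h0 := q_ne_zero hq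
  refine mon_ext fun k b n m => ?_
  simp only [LinearMap.comp_apply]
  rcases le_or_gt 0 k with hk | hk
  · rw [opPlus_nonneg hk, opPlusRight_nonneg hk, map_smul, map_smul, opPlus_nonneg (by omega),
      opPlusRight_nonneg (by omega), smul_comm]
  · rw [opPlus_neg hk, opPlusRight_neg hk]
    simp only [map_smul, map_sub]
    rcases eq_or_lt_of_le (Int.le_sub_one_of_lt hk) with hk1 | hk1
    · obtain rfl : k = -1 := by omega
      simp only [opPlus_nonneg (k := -1 + 1) (by norm_num),
        opPlusRight_nonneg (k := -1 + 1) (by norm_num)]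
      match_scalars <;> norm_num <;> field_simp <;> ring
    · simp only [opPlus_neg (k := k + 1) (by omega), opPlusRight_neg (k := k + 1) (by omega)]
      have e1 : (q : ℂ) ^ (-1 - 2 * k) = (q : ℂ) ^ 2 * (q : ℂ) ^ (-1 - 2 * (k + 1)) := by
        rw [← zpow_natCast, ← zpow_add₀ h0]; congr 1; push_cast; ring
      rw [e1]
      match_scalars <;> field_simp <;> ring

theorem opPlusRight_comm_opMinus (hq : 0 < q) :
    opPlusRight q ∘ₗ opMinus q = opMinus q ∘ₗ opPlusRight q := by
  have h0 := q_ne_zero hq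
  refine mon_ext fun k b n m => ?_
  simp only [LinearMap.comp_apply]
  rcases lt_trichotomy k 0 with hk | rfl | hk
  · rw [opMinus_nonpos hk.le, opPlusRight_neg hk]
    simp only [map_smul, map_sub]
    rw [opPlusRight_neg (by omega), opMinus_nonpos (by omega), opMinus_nonpos (by omega),
      sub_add_cancel, add_sub_cancel_right]
    have e1 : (q : ℂ) ^ (-1 - 2 * (k - 1)) = (q : ℂ) ^ 2 * (q : ℂ) ^ (-1 - 2 * k) := by
      rw [← zpow_natCast, ← zpow_add₀ h0]; congr 1; push_cast; ring
    rw [e1]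
    match_scalars <;> field_simp <;> ring
  · rw [opMinus_nonpos le_rfl, opPlusRight_nonneg le_rfl]
    simp only [map_smul]
    rw [opPlusRight_neg (by norm_num), opMinus_pos (by norm_num)]
    norm_num
    match_scalars <;> field_simp
  · rw [opMinus_pos hk, opPlusRight_nonneg hk.le]
    simp only [map_smul, map_sub]
    rw [opPlusRight_nonneg (by omega), opPlusRight_nonneg (by omega), opMinus_pos (by omega),
      sub_add_cancel, add_sub_cancel_right]
    module

theorem opPlusRight_comm_opZero : opPlusRight q ∘ₗ opZero = opZero ∘ₗ opPlusRight q := by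
  refine mon_ext fun k b n m => ?_
  simp only [LinearMap.comp_apply, opZero_mono]
  rcases le_or_gt 0 k with hk | hk
  · rw [opPlusRight_nonneg hk, opPlusRight_nonneg hk, map_smul, opZero_mono]
  · rw [opPlusRight_neg hk, opPlusRight_neg hk, map_smul, map_sub, map_smul, opZero_mono,
      opZero_mono]

theorem opPlusRight_comm_opLam (hq : 0 < q) :
    opPlusRight q ∘ₗ opLam q = opLam q ∘ₗ opPlusRight q := by
  have h0 := q_ne_zero hq
  refine mon_ext fun k b n m => ?_
  simp only [LinearMap.comp_apply, opLam_mono, map_smul]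
  rcases le_or_gt 0 k with hk | hk
  · rw [opPlusRight_nonneg hk, opPlusRight_nonneg hk, map_smul, opLam_mono, abs_of_nonneg hk,
      abs_of_nonneg (by omega), zpow_add_one₀ h0]
    simp only [smul_smul]
    congr 1
    rw [show -((b : ℤ) + 2 * n + k) = 1 + -((b : ℤ) + 2 * n + (k + 1)) by ring, zpow_add₀ h0,
      zpow_one]
    field_simp
  · rw [opPlusRight_neg hk, opPlusRight_neg hk, map_smul, map_sub, map_smul, opLam_mono, opLam_mono,
      abs_of_neg hk, abs_of_nonpos (by omega), zpow_add_one₀ h0]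
    have e : (q : ℂ) ^ (-((b : ℤ) + 2 * n + -k)) =
        q * (q : ℂ) ^ (-((b : ℤ) + 2 * (n + 1) + -(k + 1))) := by
      rw [show -((b : ℤ) + 2 * n + -k) = 1 + -((b : ℤ) + 2 * (n + 1) + -(k + 1)) by ring,
        zpow_add₀ h0, zpow_one]
    have e' : -(((b + 2 : ℕ) : ℤ) + 2 * n + -(k + 1)) = -((b : ℤ) + 2 * (n + 1) + -(k + 1)) := by
      push_cast; ring
    rw [e, e']
    match_scalars <;> field_simp

theorem opZeroRight_comm_opPlus (hq : 0 < q) :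
    opZeroRight q ∘ₗ opPlus q = opPlus q ∘ₗ opZeroRight q := by
  have h0 := q_ne_zero hq
  refine mon_ext fun k b n m => ?_
  simp only [LinearMap.comp_apply, opZeroRight_mono, map_smul]
  have e : (q : ℂ) ^ (-m - k) = q * (q : ℂ) ^ (-m - (k + 1)) := by
    rw [← zpow_one_add₀ h0]; congr 1; ring
  rcases le_or_gt 0 k with hk | hk
  · simp only [opPlus_nonneg hk, map_smul, opZeroRight_mono, e]
    match_scalars <;> field_simp <;> ring
  · simp only [opPlus_neg hk, map_smul, map_sub, opZeroRight_mono, e, add_right_comm b 1 2]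
    match_scalars <;> field_simp <;> ring

theorem opZeroRight_comm_opMinus (hq : 0 < q) :
    opZeroRight q ∘ₗ opMinus q = opMinus q ∘ₗ opZeroRight q := by
  have h0 := q_ne_zero hq
  refine mon_ext fun k b n m => ?_
  simp only [LinearMap.comp_apply, opZeroRight_mono, map_smul]
  have e : (q : ℂ) ^ (-m - (k - 1)) = q * (q : ℂ) ^ (-m - k) := by
    rw [← zpow_one_add₀ h0]; congr 1; ring
  rcases le_or_gt k 0 with hk | hk
  · simp only [opMinus_nonpos hk, map_smul, opZeroRight_mono, e]
    match_scalars <;> field_simp <;> ring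
  · simp only [opMinus_pos hk, map_smul, map_sub, opZeroRight_mono, e, add_right_comm b 1 2]
    match_scalars <;> field_simp <;> ring

theorem opZeroRight_comm_opZero : opZeroRight q ∘ₗ opZero = opZero ∘ₗ opZeroRight q := by
  refine mon_ext fun k b n m => ?_
  simp only [LinearMap.comp_apply, opZeroRight_mono, map_smul, opZero_mono]

theorem opZeroRight_comm_opLam (hq : 0 < q) :
    opZeroRight q ∘ₗ opLam q = opLam q ∘ₗ opZeroRight q := by
  have h0 := q_ne_zero hq
  refine mon_ext fun k b n m => ?_
  simp only [LinearMap.comp_apply, opZeroRight_mono, map_smul, opLam_mono, smul_smul]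
  rw [← zpow_add₀ h0, ← zpow_add₀ h0]
  congr 2
  push_cast
  ring

theorem opR2Right_comm_opPlus : opR2Right q ∘ₗ opPlus q = opPlus q ∘ₗ opR2Right q := by
  refine mon_ext fun k b n m => ?_
  simp only [LinearMap.comp_apply, opR2Right_mono, map_smul]
  rcases le_or_gt 0 k with hk | hk
  · simp only [opPlus_nonneg hk, map_smul, opR2Right_mono]
    module
  · simp only [opPlus_neg hk, map_smul, map_sub, opR2Right_mono]
    module

theorem opR2Right_comm_opMinus : opR2Right q ∘ₗ opMinus q = opMinus q ∘ₗ opR2Right q := by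
  refine mon_ext fun k b n m => ?_
  simp only [LinearMap.comp_apply, opR2Right_mono, map_smul]
  rcases le_or_gt k 0 with hk | hk
  · simp only [opMinus_nonpos hk, map_smul, opR2Right_mono]
    module
  · simp only [opMinus_pos hk, map_smul, map_sub, opR2Right_mono]
    module

theorem opR2Right_comm_opZero : opR2Right q ∘ₗ opZero = opZero ∘ₗ opR2Right q := by
  refine mon_ext fun k b n m => ?_
  simp only [LinearMap.comp_apply, opR2Right_mono, map_smul, opZero_mono]

theorem opR2Right_comm_opLam (hq : 0 < q) :
    opR2Right q ∘ₗ opLam q = opLam q ∘ₗ opR2Right q := by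
  have h0 := q_ne_zero hq
  refine mon_ext fun k b n m => ?_
  simp only [LinearMap.comp_apply, opR2Right_mono, map_smul, opLam_mono, smul_smul]
  rw [← zpow_add₀ h0, ← zpow_add₀ h0]
  congr 2
  ring

theorem opLamRight_comm_opPlus : opLamRight ∘ₗ opPlus q = opPlus q ∘ₗ opLamRight := by
  refine mon_ext fun k b n m => ?_
  simp only [LinearMap.comp_apply, opLamRight_mono]
  rcases le_or_gt 0 k with hk | hk
  · simp only [opPlus_nonneg hk, map_smul, opLamRight_mono]
  · simp only [opPlus_neg hk, map_smul, map_sub, opLamRight_mono]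

theorem opLamRight_comm_opMinus : opLamRight ∘ₗ opMinus q = opMinus q ∘ₗ opLamRight := by
  refine mon_ext fun k b n m => ?_
  simp only [LinearMap.comp_apply, opLamRight_mono]
  rcases le_or_gt k 0 with hk | hk
  · simp only [opMinus_nonpos hk, map_smul, opLamRight_mono]
  · simp only [opMinus_pos hk, map_smul, map_sub, opLamRight_mono]

theorem opLamRight_comm_opZero : opLamRight ∘ₗ opZero = opZero ∘ₗ opLamRight := by
  refine mon_ext fun k b n m => ?_
  simp only [LinearMap.comp_apply, opLamRight_mono, opZero_mono]

theorem opLamRight_comm_opLam : opLamRight ∘ₗ opLam q = opLam q ∘ₗ opLamRight := by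
  refine mon_ext fun k b n m => ?_
  simp only [LinearMap.comp_apply, opLamRight_mono, opLam_mono, map_smul]

end Relations

end QEuclid

namespace QEuclid

variable {q : ℝ}

/-! ### The regular representation on monomials -/

/-- The operators of left multiplication by the generators. -/
def genOp (q : ℝ) : Gen → Module.End ℂ Mon
  | .x i => ![opMinus q, opZero, opPlus q] i
  | .rInv => opRInv
  | .lam => opLam q
  | .lamInv => opLamInv q

theorem lift_genOp_freeR2 (hq : 0 < q) : FreeAlgebra.lift ℂ (genOp q) (freeR2 q) = opR2 := by
  refine mon_ext fun k b n m => ?_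
  rw [opR2_mono, ← r2_op hq]
  simp only [freeR2, map_add, map_smul, map_mul, FreeAlgebra.lift_ι_apply, genOp, gMat,
    Fin.sum_univ_three, Matrix.cons_val, Matrix.of_apply, Fin.isValue, zero_smul, one_smul,
    add_zero, zero_add, LinearMap.add_apply, LinearMap.smul_apply, Module.End.mul_apply]

/-- The representation of the function algebra on the space with basis the monomials. -/
def rep (hq : 0 < q) : Alg q →ₐ[ℂ] Module.End ℂ Mon :=
  RingQuot.liftAlgHom ℂ ⟨FreeAlgebra.lift ℂ (genOp q), by
    have h0 := q_ne_zero hq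
    intro a b hab
    cases hab with
    | minus_zero =>
      simp only [map_mul, map_smul, FreeAlgebra.lift_ι_apply]
      exact opMinus_opZero
    | plus_zero =>
      simp only [map_mul, map_smul, FreeAlgebra.lift_ι_apply]
      exact opPlus_opZero
    | plus_minus =>
      simp only [map_mul, map_smul, map_sub, map_pow, FreeAlgebra.lift_ι_apply]
      refine mon_ext fun k b n m => ?_
      change opPlus q (opMinus q _) - opMinus q (opPlus q _) = h q • (opZero ^ 2) _
      rw [_root_.sq, Module.End.mul_apply, opPlus_opMinus hq, opMinus_opPlus hq, opZero_mono,
        opZero_mono]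
      have h1 := sq_ne_zero hq
      have h2 : sq q ^ 2 + 1 ≠ 0 := by rw [sq_sq hq]; exact q_add_one_ne_zero hq
      rw [two, h, ← sq_sq hq]
      match_scalars <;> field_simp <;> ring
    | r2_rInv =>
      rw [map_mul, lift_genOp_freeR2 hq, FreeAlgebra.lift_ι_apply, genOp, map_one]
      refine mon_ext fun k b n m => ?_
      rw [Module.End.mul_apply, opRInv_mono, opR2_mono, sub_add_cancel, Module.End.one_apply]
    | rInv_r2 =>
      rw [map_mul, lift_genOp_freeR2 hq, FreeAlgebra.lift_ι_apply, genOp, map_one]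
      refine mon_ext fun k b n m => ?_
      rw [Module.End.mul_apply, opR2_mono, opRInv_mono, add_sub_cancel_right, Module.End.one_apply]
    | x_lam i =>
      simp only [map_mul, map_smul, FreeAlgebra.lift_ι_apply]
      fin_cases i
      · exact opMinus_opLam hq
      · exact opZero_opLam hq
      · exact opPlus_opLam hq
    | lam_lamInv =>
      rw [map_mul, FreeAlgebra.lift_ι_apply, FreeAlgebra.lift_ι_apply, genOp, genOp, map_one]
      refine mon_ext fun k b n m => ?_
      rw [Module.End.mul_apply, opLamInv_mono, map_smul, opLam_mono, sub_add_cancel, smul_smul,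
        ← zpow_add₀ h0, add_neg_cancel, zpow_zero, one_smul, Module.End.one_apply]
    | lamInv_lam =>
      rw [map_mul, FreeAlgebra.lift_ι_apply, FreeAlgebra.lift_ι_apply, genOp, genOp, map_one]
      refine mon_ext fun k b n m => ?_
      rw [Module.End.mul_apply, opLam_mono, map_smul, opLamInv_mono, add_sub_cancel_right,
        smul_smul, ← zpow_add₀ h0, neg_add_cancel, zpow_zero, one_smul, Module.End.one_apply]⟩

theorem rep_gen (hq : 0 < q) (s : Gen) : rep hq (gen q s) = genOp q s :=
  (RingQuot.liftAlgHom_mkAlgHom_apply ..).trans (FreeAlgebra.lift_ι_apply ..)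

theorem rep_minus (hq : 0 < q) : rep hq (x q 0) = opMinus q := rep_gen hq _

theorem rep_zero (hq : 0 < q) : rep hq (x q 1) = opZero := rep_gen hq _

theorem rep_plus (hq : 0 < q) : rep hq (x q 2) = opPlus q := rep_gen hq _

theorem rep_lam (hq : 0 < q) : rep hq (lam q) = opLam q := rep_gen hq _

theorem rep_r2 (hq : 0 < q) : rep hq (r2 q) = opR2 := by
  refine mon_ext fun k b n m => ?_
  rw [opR2_mono, ← r2_op hq, r2_eq]
  simp only [map_add, map_smul, map_mul, rep_minus, rep_zero, rep_plus, LinearMap.add_apply,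
    LinearMap.smul_apply, Module.End.mul_apply]

theorem nontrivial_alg (hq : 0 < q) : Nontrivial (Alg q) := by
  refine nontrivial_of_ne (1 : Alg q) 0 fun h => ?_
  have := LinearMap.congr_fun (congrArg (rep hq) h) (mono 0 0 0 0)
  rw [map_one, map_zero, Module.End.one_apply, LinearMap.zero_apply, mono,
    Finsupp.single_eq_zero] at this
  exact one_ne_zero this

section Powers

variable {A : Type} [Ring A] [Algebra ℂ A]

theorem mul_pow_of_mul_eq_smul {a y : A} {c : ℂ} (h : a * y = c • (y * a)) (n : ℕ) :
    a * y ^ n = c ^ n • (y ^ n * a) := by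
  induction n with
  | zero => simp
  | succ n ih =>
    rw [pow_succ, ← mul_assoc, ih, smul_mul_assoc, mul_assoc, h, mul_smul_comm, smul_smul,
      mul_assoc, pow_succ]

theorem mul_zpow_of_mul_eq_smul {a : A} {y : Aˣ} {c : ℂ} (hc : c ≠ 0)
    (h : a * y = c • (y * a)) (n : ℤ) : a * ↑(y ^ n) = c ^ n • (↑(y ^ n) * a) := by
  have h' : a * ↑y⁻¹ = c⁻¹ • (↑y⁻¹ * a) := by
    rw [eq_inv_smul_iff₀ hc]
    calc c • (a * ↑y⁻¹) = ↑y⁻¹ * (c • (y * a)) * ↑y⁻¹ := by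
          rw [mul_smul_comm, Units.inv_mul_cancel_left, smul_mul_assoc]
      _ = ↑y⁻¹ * a := by rw [← h, mul_assoc, Units.mul_inv_cancel_right]
  induction n with
  | zero => simp
  | succ n ih =>
    rw [zpow_add_one, Units.val_mul, ← mul_assoc, ih, smul_mul_assoc, mul_assoc, h, mul_smul_comm,
      smul_smul, mul_assoc, zpow_add_one₀ hc]
  | pred n ih =>
    rw [zpow_sub_one, Units.val_mul, ← mul_assoc, ih, smul_mul_assoc, mul_assoc, h', mul_smul_comm,
      smul_smul, mul_assoc, zpow_sub_one₀ hc]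

end Powers

/-- `r²` as a unit. -/
def r2Unit (q : ℝ) : (Alg q)ˣ := ⟨r2 q, rInv2 q, r2_mul_rInv2 q, rInv2_mul_r2 q⟩

/-- `Λ` as a unit. -/
def lamUnit (q : ℝ) : (Alg q)ˣ := ⟨lam q, lamInv q, lam_mul_lamInv q, lamInv_mul_lam q⟩

/-- The element `v^k`: a power of `x⁺` for `k ≥ 0` and of `x⁻` for `k ≤ 0`. -/
def weightPow (q : ℝ) (k : ℤ) : Alg q := x q 2 ^ k.toNat * x q 0 ^ (-k).toNat

theorem plus_mul_weightPow {k : ℤ} (hk : 0 ≤ k) : x q 2 * weightPow q k = weightPow q (k + 1) := by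
  lift k to ℕ using hk
  rw [weightPow, weightPow, ← mul_assoc, ← pow_succ']
  congr 2 <;> omega

theorem minus_mul_weightPow {k : ℤ} (hk : k ≤ 0) :
    x q 0 * weightPow q k = weightPow q (k - 1) := by
  obtain ⟨j, rfl⟩ : ∃ j : ℕ, k = -j := ⟨(-k).toNat, by omega⟩
  rw [weightPow, weightPow, show (-(j : ℤ)).toNat = 0 by omega,
    show (-(j : ℤ) - 1).toNat = 0 by omega, pow_zero, one_mul, one_mul, ← pow_succ']
  congr 1
  omega

theorem lam_mul_x (hq : 0 < q) (i : Fin 3) : lam q * x q i = (q : ℂ)⁻¹ • (x q i * lam q) := by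
  rw [x_mul_lam, inv_smul_smul₀ (q_ne_zero hq)]

theorem lam_mul_weightPow (hq : 0 < q) (k : ℤ) :
    lam q * weightPow q k = (q : ℂ) ^ (-|k|) • (weightPow q k * lam q) := by
  rw [weightPow, ← mul_assoc, mul_pow_of_mul_eq_smul (lam_mul_x hq 2), smul_mul_assoc, mul_assoc,
    mul_pow_of_mul_eq_smul (lam_mul_x hq 0), mul_smul_comm, smul_smul, mul_assoc, ← pow_add,
    show k.toNat + (-k).toNat = k.natAbs by omega, inv_pow, zpow_neg, Int.abs_eq_natAbs,
    zpow_natCast]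

/-- The element of the algebra with given coefficients. -/
def ofMon (q : ℝ) : Mon →ₗ[ℂ] Alg q :=
  Finsupp.linearCombination ℂ fun i =>
    x q 1 ^ i.2.1 * (↑(r2Unit q ^ i.2.2.1) * (weightPow q i.1 * ↑(lamUnit q ^ i.2.2.2)))

theorem ofMon_mono (k : ℤ) (b : ℕ) (n m : ℤ) : ofMon q (mono k b n m) =
    x q 1 ^ b * (↑(r2Unit q ^ n) * (weightPow q k * ↑(lamUnit q ^ m))) := by
  rw [ofMon, mono, Finsupp.linearCombination_single, one_smul]

theorem x_mul_r2Unit_zpow (hq : 0 < q) (i : Fin 3) (n : ℤ) :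
    x q i * ↑(r2Unit q ^ n) = ↑(r2Unit q ^ n) * x q i :=
  Commute.units_zpow_right (a := x q i) (u := r2Unit q) (x_mul_r2 hq i) n

theorem minus_mul_zero_pow (b : ℕ) : x q 0 * x q 1 ^ b = (q : ℂ) ^ b • (x q 1 ^ b * x q 0) :=
  mul_pow_of_mul_eq_smul (minus_zero q) b

theorem plus_mul_zero_pow (b : ℕ) : x q 2 * x q 1 ^ b = ((q : ℂ) ^ b)⁻¹ • (x q 1 ^ b * x q 2) := by
  rw [mul_pow_of_mul_eq_smul (plus_zero q) b, inv_pow]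

theorem mul_ofMon_zero (v : Mon) : ofMon q (opZero v) = x q 1 * ofMon q v := by
  refine LinearMap.congr_fun (f := ofMon q ∘ₗ opZero)
    (g := LinearMap.mulLeft ℂ (x q 1) ∘ₗ ofMon q) (mon_ext fun k b n m => ?_) v
  simp only [LinearMap.comp_apply, LinearMap.mulLeft_apply, opZero_mono, ofMon_mono, pow_succ',
    mul_assoc]

theorem zero_pow_mul_r2 (b : ℕ) (n : ℤ) (a : Alg q) :
    x q 1 ^ b * (↑(r2Unit q ^ n) * (r2 q * a)) = x q 1 ^ b * (↑(r2Unit q ^ (n + 1)) * a) := by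
  rw [zpow_add_one, Units.val_mul]
  simp only [mul_assoc]
  rfl

theorem zero_pow_mul_zero_sq (hq : 0 < q) (b : ℕ) (n : ℤ) (a : Alg q) :
    x q 1 ^ b * (↑(r2Unit q ^ n) * (x q 1 * x q 1 * a)) =
      x q 1 ^ (b + 2) * (↑(r2Unit q ^ n) * a) := by
  rw [← mul_assoc _ _ a, ← mul_assoc _ (x q 1) (x q 1), ← x_mul_r2Unit_zpow hq,
    mul_assoc _ _ (x q 1), ← x_mul_r2Unit_zpow hq, pow_add, _root_.sq]
  simp only [mul_assoc]

theorem mul_ofMon_plus (hq : 0 < q) (v : Mon) : ofMon q (opPlus q v) = x q 2 * ofMon q v := by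
  refine LinearMap.congr_fun (f := ofMon q ∘ₗ opPlus q)
    (g := LinearMap.mulLeft ℂ (x q 2) ∘ₗ ofMon q) (mon_ext fun k b n m => ?_) v
  simp only [LinearMap.comp_apply, LinearMap.mulLeft_apply]
  have e : x q 2 * ofMon q (mono k b n m) = ((q : ℂ) ^ b)⁻¹ •
      (x q 1 ^ b * (↑(r2Unit q ^ n) * (x q 2 * weightPow q k * ↑(lamUnit q ^ m)))) := by
    rw [ofMon_mono, ← mul_assoc, plus_mul_zero_pow, smul_mul_assoc, mul_assoc,
      ← mul_assoc (x q 2) (↑(r2Unit q ^ n)), x_mul_r2Unit_zpow hq]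
    simp only [mul_assoc]
  rw [e]
  rcases le_or_gt 0 k with hk | hk
  · rw [opPlus_nonneg hk, map_smul, ofMon_mono, plus_mul_weightPow hk]
  · rw [opPlus_neg hk, map_smul, map_sub, map_smul, ofMon_mono, ofMon_mono,
      ← sub_add_cancel k (-1), ← sub_eq_add_neg, sub_neg_eq_add, ← minus_mul_weightPow (by omega),
      ← mul_assoc (x q 2) (x q 0), plus_mul_minus hq, two]
    simp only [smul_mul_assoc, sub_mul, mul_smul_comm, mul_sub, smul_sub, mul_assoc (r2 q),
      mul_assoc (x q 1 * x q 1), zero_pow_mul_r2, zero_pow_mul_zero_sq hq, smul_smul,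
      add_sub_cancel_right, mul_assoc ((q : ℂ) ^ b)⁻¹]

theorem mul_ofMon_minus (hq : 0 < q) (v : Mon) : ofMon q (opMinus q v) = x q 0 * ofMon q v := by
  refine LinearMap.congr_fun (f := ofMon q ∘ₗ opMinus q)
    (g := LinearMap.mulLeft ℂ (x q 0) ∘ₗ ofMon q) (mon_ext fun k b n m => ?_) v
  simp only [LinearMap.comp_apply, LinearMap.mulLeft_apply]
  have e : x q 0 * ofMon q (mono k b n m) = (q : ℂ) ^ b •
      (x q 1 ^ b * (↑(r2Unit q ^ n) * (x q 0 * weightPow q k * ↑(lamUnit q ^ m)))) := by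
    rw [ofMon_mono, ← mul_assoc, minus_mul_zero_pow, smul_mul_assoc, mul_assoc,
      ← mul_assoc (x q 0) (↑(r2Unit q ^ n)), x_mul_r2Unit_zpow hq]
    simp only [mul_assoc]
  rw [e]
  rcases le_or_gt k 0 with hk | hk
  · rw [opMinus_nonpos hk, map_smul, ofMon_mono, minus_mul_weightPow hk]
  · have ek : weightPow q k = x q 2 * weightPow q (k - 1) := by
      rw [plus_mul_weightPow (by omega), sub_add_cancel]
    rw [opMinus_pos hk, map_smul, map_sub, map_smul, ofMon_mono, ofMon_mono, ek,
      ← mul_assoc (x q 0) (x q 2), minus_mul_plus hq, two]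
    simp only [smul_mul_assoc, sub_mul, mul_smul_comm, mul_sub, smul_sub, mul_assoc (r2 q),
      mul_assoc (x q 1 * x q 1), zero_pow_mul_r2, zero_pow_mul_zero_sq hq, smul_smul,
      mul_assoc ((q : ℂ) ^ b)]

theorem mul_ofMon_lam (hq : 0 < q) (v : Mon) : ofMon q (opLam q v) = lam q * ofMon q v := by
  have h0 := q_ne_zero hq
  refine LinearMap.congr_fun (f := ofMon q ∘ₗ opLam q)
    (g := LinearMap.mulLeft ℂ (lam q) ∘ₗ ofMon q) (mon_ext fun k b n m => ?_) v
  simp only [LinearMap.comp_apply, LinearMap.mulLeft_apply]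
  have hr : lam q * ↑(r2Unit q ^ n) = (((q : ℂ) ^ 2)⁻¹) ^ n • (↑(r2Unit q ^ n) * lam q) := by
    refine mul_zpow_of_mul_eq_smul (inv_ne_zero (pow_ne_zero 2 h0)) ?_ n
    change lam q * r2 q = _ • (r2 q * lam q)
    rw [r2_mul_lam, inv_smul_smul₀ (pow_ne_zero 2 h0)]
  rw [opLam_mono, map_smul, ofMon_mono, ofMon_mono, ← mul_assoc (lam q),
    mul_pow_of_mul_eq_smul (lam_mul_x hq 1), smul_mul_assoc, mul_assoc, ← mul_assoc (lam q), hr,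
    smul_mul_assoc, mul_assoc _ (lam q), ← mul_assoc (lam q), lam_mul_weightPow hq,
    add_comm m, zpow_one_add, Units.val_mul]
  simp only [smul_mul_assoc, mul_smul_comm, smul_smul, mul_assoc]
  congr 1
  rw [← zpow_natCast, inv_zpow', ← zpow_natCast, inv_zpow', ← zpow_mul, ← zpow_add₀ h0,
    ← zpow_add₀ h0]
  congr 1
  push_cast
  ring

/-- `ofMon` intertwines the representation with left multiplication. -/
theorem ofMon_rep (hq : 0 < q) (a : Alg q) : ∀ v, ofMon q (rep hq a v) = a * ofMon q v := by
  induction a using alg_induction with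
  | hx i =>
    intro v
    fin_cases i
    · exact (congrArg (fun f : Module.End ℂ Mon => ofMon q (f v)) (rep_minus hq)).trans
        (mul_ofMon_minus hq v)
    · exact (congrArg (fun f : Module.End ℂ Mon => ofMon q (f v)) (rep_zero hq)).trans
        (mul_ofMon_zero v)
    · exact (congrArg (fun f : Module.End ℂ Mon => ofMon q (f v)) (rep_plus hq)).trans
        (mul_ofMon_plus hq v)
  | hlam => intro v; rw [rep_lam, mul_ofMon_lam hq]
  | hC c =>
    intro v
    rw [AlgHom.commutes, Module.algebraMap_end_apply, map_smul, Algebra.smul_def]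
  | hadd a b ha hb => intro v; rw [map_add, LinearMap.add_apply, map_add, ha, hb, add_mul]
  | hmul a b ha hb => intro v; rw [map_mul, Module.End.mul_apply, ha, hb, mul_assoc]
  | hinv a b hab hba ha =>
    intro v
    have e : v = rep hq a (rep hq b v) := by
      rw [← Module.End.mul_apply, ← map_mul, hab, map_one, Module.End.one_apply]
    conv_rhs => rw [e, ha, ← mul_assoc, hba, one_mul]

/-- The coefficients of an element with respect to the basis of monomials. -/
def monCoord (hq : 0 < q) (a : Alg q) : Mon := rep hq a (mono 0 0 0 0)

/-- The monomials span the algebra: an element is recovered from its coefficients by `ofMon`. -/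
theorem monCoord_injective (hq : 0 < q) : Function.Injective (monCoord hq) := by
  refine Function.LeftInverse.injective (g := ofMon q) fun a => ?_
  rw [monCoord, ofMon_rep, ofMon_mono]
  simp [weightPow]

theorem monCoord_smul (hq : 0 < q) (c : ℂ) (a : Alg q) :
    monCoord hq (c • a) = c • monCoord hq a := by
  rw [monCoord, map_smul, LinearMap.smul_apply]
  rfl

theorem monCoord_mul (hq : 0 < q) (a b : Alg q) :
    monCoord hq (a * b) = rep hq a (monCoord hq b) := by
  rw [monCoord, map_mul, Module.End.mul_apply]
  rfl

/-- An operator on monomials that commutes with the left multiplications by the coordinates and by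
`Λ` commutes with all left multiplications. -/
theorem rep_comm (hq : 0 < q) (R : Module.End ℂ Mon) (hplus : R ∘ₗ opPlus q = opPlus q ∘ₗ R)
    (hminus : R ∘ₗ opMinus q = opMinus q ∘ₗ R) (hzero : R ∘ₗ opZero = opZero ∘ₗ R)
    (hlam : R ∘ₗ opLam q = opLam q ∘ₗ R) (a : Alg q) : Commute (rep hq a) R := by
  induction a using alg_induction with
  | hx i =>
    fin_cases i
    · exact (congrArg (Commute · R) (rep_minus hq)).mpr hminus.symm
    · exact (congrArg (Commute · R) (rep_zero hq)).mpr hzero.symm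
    · exact (congrArg (Commute · R) (rep_plus hq)).mpr hplus.symm
  | hlam => rw [rep_lam]; exact hlam.symm
  | hC c => rw [AlgHom.commutes]; exact Algebra.commute_algebraMap_left _ _
  | hadd a b ha hb => rw [map_add]; exact ha.add_left hb
  | hmul a b ha hb => rw [map_mul]; exact ha.mul_left hb
  | hinv a b hab hba ha =>
    let u : (Module.End ℂ Mon)ˣ :=
      ⟨rep hq a, rep hq b, by rw [← map_mul, hab, map_one], by rw [← map_mul, hba, map_one]⟩
    exact Commute.units_inv_left (u := u) ha

/-- A right multiplication is determined by its value on the empty monomial. -/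
theorem monCoord_mul_right (hq : 0 < q) (R : Module.End ℂ Mon) {b : Alg q}
    (hR : ∀ a, Commute (rep hq a) R) (hb : monCoord hq b = R (mono 0 0 0 0)) (a : Alg q) :
    monCoord hq (a * b) = R (monCoord hq a) := by
  rw [monCoord_mul, hb, ← Module.End.mul_apply, (hR a).eq]
  rfl

theorem monCoord_mul_plus (hq : 0 < q) (a : Alg q) :
    monCoord hq (a * x q 2) = opPlusRight q (monCoord hq a) := by
  refine monCoord_mul_right hq _ (rep_comm hq _ (opPlusRight_comm_opPlus hq)
    (opPlusRight_comm_opMinus hq) opPlusRight_comm_opZero (opPlusRight_comm_opLam hq)) ?_ a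
  rw [monCoord, rep_plus, opPlus_nonneg le_rfl, opPlusRight_nonneg le_rfl, pow_zero, zpow_zero]

theorem monCoord_mul_zero (hq : 0 < q) (a : Alg q) :
    monCoord hq (a * x q 1) = opZeroRight q (monCoord hq a) := by
  refine monCoord_mul_right hq _ (rep_comm hq _ (opZeroRight_comm_opPlus hq)
    (opZeroRight_comm_opMinus hq) opZeroRight_comm_opZero (opZeroRight_comm_opLam hq)) ?_ a
  rw [monCoord, rep_zero, opZero_mono, opZeroRight_mono, neg_zero, sub_zero, zpow_zero, one_smul]

theorem monCoord_mul_lam (hq : 0 < q) (a : Alg q) :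
    monCoord hq (a * lam q) = opLamRight (monCoord hq a) := by
  refine monCoord_mul_right hq _ (rep_comm hq _ opLamRight_comm_opPlus
    opLamRight_comm_opMinus opLamRight_comm_opZero opLamRight_comm_opLam) ?_ a
  rw [monCoord, rep_lam, opLam_mono, opLamRight_mono]
  simp

theorem monCoord_mul_r2 (hq : 0 < q) (a : Alg q) :
    monCoord hq (a * r2 q) = opR2Right q (monCoord hq a) := by
  refine monCoord_mul_right hq _ (rep_comm hq _ opR2Right_comm_opPlus
    opR2Right_comm_opMinus opR2Right_comm_opZero (opR2Right_comm_opLam hq)) ?_ a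
  rw [monCoord, rep_r2, opR2_mono, opR2Right_mono, mul_zero, zpow_zero, one_smul]

theorem monCoord_weight (hq : 0 < q) : monCoord hq (weight q) = mono 0 0 1 2 := by
  rw [weight, monCoord_mul, rep_r2, _root_.sq, monCoord_mul_lam, monCoord, rep_lam, opLam_mono]
  simp [opLamRight_mono, opR2_mono]

end QEuclid

namespace QEuclid

variable {q : ℝ}

/-! ### Solving commutation equations in the monomial basis -/

theorem two_q_ne_zero (hq : 0 < q) : two q ≠ 0 := sq_add_inv_ne_zero hq

theorem plusMain_injective : Function.Injective plusMain := by
  rintro ⟨k, b, n, m⟩ ⟨k', b', n', m'⟩ e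
  simp only [plusMain, Prod.mk.injEq, add_left_inj] at e
  obtain ⟨rfl, rfl, h, rfl⟩ := e
  split_ifs at h
  · rw [h]
  · rw [add_right_cancel h]

/-- The coefficient of left multiplication by `x⁺` at the main term of a monomial, when no
correction term interferes. -/
theorem opPlus_apply_plusMain (u : Mon) (i : Idx)
    (hu : ∀ j, plusCorr j = plusMain i → 0 ≤ j.1 ∨ u j = 0) :
    opPlus q u (plusMain i) =
      (((q : ℂ) ^ i.2.1)⁻¹ * if 0 ≤ i.1 then 1 else (two q)⁻¹) * u i := by
  rw [opPlus, LinearMap.add_apply, Finsupp.add_apply, shift_apply _ plusMain_injective,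
    shift_apply_eq_zero _ _ _ _ fun j hj => ?_, add_zero]
  rcases hu j hj with h | h
  · rw [if_pos h, zero_mul]
  · rw [h, mul_zero]

/-- The coefficient of right multiplication by `x⁺` at the main term of a monomial, when no
correction term interferes. -/
theorem opPlusRight_apply_plusMain (u : Mon) (i : Idx)
    (hu : ∀ j, plusCorr j = plusMain i → 0 ≤ j.1 ∨ u j = 0) :
    opPlusRight q u (plusMain i) =
      (((q : ℂ) ^ i.2.2.2)⁻¹ * if 0 ≤ i.1 then 1 else (two q)⁻¹) * u i := by
  rw [opPlusRight, LinearMap.add_apply, Finsupp.add_apply, shift_apply _ plusMain_injective,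
    shift_apply_eq_zero _ _ _ _ fun j hj => ?_, add_zero]
  rcases hu j hj with h | h
  · rw [if_pos h, zero_mul]
  · rw [h, mul_zero]

/-- If `μ x⁺ u = ν u x⁺`, then `u` contains only monomials whose own main terms satisfy this
equation. Correction terms raise the exponent of `x⁰`, whence the induction on it. -/
theorem apply_eq_zero_of_opPlus (hq : 0 < q) {u : Mon} {μ ν : ℂ}
    (h : μ • opPlus q u = ν • opPlusRight q u)
    (hi : ∀ i, u i ≠ 0 → μ * ((q : ℂ) ^ i.2.1)⁻¹ ≠ ν * ((q : ℂ) ^ i.2.2.2)⁻¹) : u = 0 := by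
  have key : ∀ (b : ℕ) (i : Idx), i.2.1 = b → u i = 0 := by
    intro b
    induction b using Nat.strong_induction_on with
    | _ b ih =>
      intro i hb
      have hu : ∀ j, plusCorr j = plusMain i → 0 ≤ j.1 ∨ u j = 0 := by
        intro j hj
        have e : j.2.1 + 2 = i.2.1 := congrArg (fun p : Idx => p.2.1) hj
        exact Or.inr (ih j.2.1 (by omega) j rfl)
      have e := DFunLike.congr_fun h (plusMain i)
      rw [Finsupp.smul_apply, Finsupp.smul_apply, opPlus_apply_plusMain u i hu,
        opPlusRight_apply_plusMain u i hu, smul_eq_mul, smul_eq_mul] at e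
      by_contra hne
      refine hi i hne ?_
      have hs : (if 0 ≤ i.1 then (1 : ℂ) else (two q)⁻¹) ≠ 0 := by
        split_ifs
        · exact one_ne_zero
        · exact inv_ne_zero (two_q_ne_zero hq)
      refine mul_right_cancel₀ (mul_ne_zero hs hne) ?_
      linear_combination e
  exact Finsupp.ext fun i => key _ i rfl

theorem monCoord_eq_zero (hq : 0 < q) {a : Alg q} (h : monCoord hq a = 0) : a = 0 := by
  refine monCoord_injective hq (h.trans ?_)
  rw [monCoord, map_zero, LinearMap.zero_apply]

/-- The generator `x⁺` is not a right zero divisor. -/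
theorem eq_zero_of_mul_plus_eq_zero (hq : 0 < q) {a : Alg q} (h : a * x q 2 = 0) : a = 0 := by
  have h0 := q_ne_zero hq
  refine monCoord_eq_zero hq (apply_eq_zero_of_opPlus hq (μ := 0) (ν := 1) ?_ fun i _ => ?_)
  · rw [← monCoord_mul_plus, h, zero_smul, one_smul, monCoord, map_zero, LinearMap.zero_apply]
  · rw [zero_mul, one_mul]
    exact (inv_ne_zero (zpow_ne_zero _ h0)).symm

/-- An element that commutes with `Λ` as `r² Λ²` does has degree two in the coordinates. -/
theorem deg_eq_two (hq : 0 < q) (hq1 : q ≠ 1) {a : Alg q}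
    (h : (q : ℂ) ^ 2 • (lam q * a) = a * lam q) {i : Idx} (hi : monCoord hq a i ≠ 0) :
    deg i = 2 := by
  have h0 := q_ne_zero hq
  have hinj : Function.Injective lamShift := by
    rintro ⟨k, b, n, m⟩ ⟨k', b', n', m'⟩ e
    simpa [lamShift] using e
  have e := DFunLike.congr_fun (congrArg (monCoord hq) h) (lamShift i)
  rw [monCoord_smul, monCoord_mul, rep_lam, monCoord_mul_lam, Finsupp.smul_apply, opLam,
    opLamRight, shift_apply _ hinj, shift_apply _ hinj, smul_eq_mul, ← mul_assoc] at e
  have e1 := mul_right_cancel₀ hi e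
  rw [← zpow_natCast, ← zpow_add₀ h0, ← zpow_zero (q : ℂ)] at e1
  have := q_zpow_injective hq hq1 e1
  push_cast at this
  omega

/-- An element that commutes with `r²` as `r² Λ²` does is of second order in `Λ`. -/
theorem lam_exponent_eq_two (hq : 0 < q) (hq1 : q ≠ 1) {a : Alg q}
    (h : r2 q * a = (q : ℂ) ^ 4 • (a * r2 q)) {i : Idx} (hi : monCoord hq a i ≠ 0) :
    i.2.2.2 = 2 := by
  have h0 := q_ne_zero hq
  have hinj : Function.Injective r2Shift := by
    rintro ⟨k, b, n, m⟩ ⟨k', b', n', m'⟩ e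
    simpa [r2Shift] using e
  have e := DFunLike.congr_fun (congrArg (monCoord hq) h) (r2Shift i)
  rw [monCoord_smul, monCoord_mul, rep_r2, monCoord_mul_r2, Finsupp.smul_apply, opR2,
    opR2Right, shift_apply _ hinj, shift_apply _ hinj, smul_eq_mul, ← mul_assoc] at e
  have e1 := mul_right_cancel₀ hi e
  rw [← zpow_natCast, ← zpow_add₀ h0, ← zpow_zero (q : ℂ)] at e1
  have := q_zpow_injective hq hq1 e1
  push_cast at this
  omega

/-- An element that commutes with `Λ`, `r²`, `x⁰` and `x⁺` as `r² Λ²` does is a multiple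
of `r² Λ²`. -/
theorem eq_smul_weight (hq : 0 < q) (hq1 : q ≠ 1) {a : Alg q}
    (hlam : (q : ℂ) ^ 2 • (lam q * a) = a * lam q) (hr : r2 q * a = (q : ℂ) ^ 4 • (a * r2 q))
    (hzero : x q 1 * a = (q : ℂ) ^ 2 • (a * x q 1))
    (hplus : x q 2 * a = (q : ℂ) ^ 2 • (a * x q 2)) :
    ∃ c : ℂ, a = c • weight q := by
  have h0 := q_ne_zero hq
  have hk : ∀ i, monCoord hq a i ≠ 0 → i.1 = 0 := by
    intro i hi
    have hinj : Function.Injective zeroShift := by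
      rintro ⟨k, b, n, m⟩ ⟨k', b', n', m'⟩ e
      simpa [zeroShift] using e
    have hm := lam_exponent_eq_two hq hq1 hr hi
    have e := DFunLike.congr_fun (congrArg (monCoord hq) hzero) (zeroShift i)
    rw [monCoord_smul, monCoord_mul, rep_zero, monCoord_mul_zero, Finsupp.smul_apply, opZero,
      opZeroRight, shift_apply _ hinj, shift_apply _ hinj, smul_eq_mul, ← mul_assoc, hm] at e
    have e1 := mul_right_cancel₀ hi e
    rw [← zpow_natCast, ← zpow_add₀ h0, ← zpow_zero (q : ℂ)] at e1
    have := q_zpow_injective hq hq1 e1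
    push_cast at this
    omega
  have hb : ∀ i, monCoord hq a i ≠ 0 → i.2.1 = 0 := by
    intro i hi
    have hm := lam_exponent_eq_two hq hq1 hr hi
    have hu : ∀ j, plusCorr j = plusMain i → 0 ≤ j.1 ∨ monCoord hq a j = 0 := fun j _ => by
      by_cases hj : monCoord hq a j = 0
      · exact Or.inr hj
      · exact Or.inl (hk j hj).ge
    have e := DFunLike.congr_fun (congrArg (monCoord hq) hplus) (plusMain i)
    rw [monCoord_smul, monCoord_mul, rep_plus, monCoord_mul_plus, Finsupp.smul_apply,
      opPlus_apply_plusMain _ i hu, opPlusRight_apply_plusMain _ i hu, if_pos (hk i hi).ge,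
      smul_eq_mul, ← mul_assoc, hm] at e
    have e1 := mul_right_cancel₀ hi e
    rw [mul_one, mul_one, ← zpow_natCast, ← zpow_natCast, ← zpow_neg, ← zpow_neg,
      ← zpow_add₀ h0] at e1
    have := q_zpow_injective hq hq1 e1
    push_cast at this
    omega
  refine ⟨monCoord hq a (0, 0, 1, 2), monCoord_injective hq ?_⟩
  rw [monCoord_smul, monCoord_weight]
  refine Finsupp.ext fun i => ?_
  rw [Finsupp.smul_apply, mono, Finsupp.single_apply, smul_eq_mul]
  split_ifs with hi
  · rw [← hi, mul_one]
  · rw [mul_zero]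
    by_contra hne
    have h1 := hk i hne
    have h2 := hb i hne
    have h3 := lam_exponent_eq_two hq hq1 hr hne
    have h4 := deg_eq_two hq hq1 hlam hne
    obtain ⟨k, b, n, m⟩ := i
    simp only [deg] at h1 h2 h3 h4
    subst h1 h2 h3
    norm_num at h4
    exact hi (by rw [h4])

/-! ### Uniqueness of the metric -/

/-- The factors with `x⁺ ξ^j = (plusFactor j) ξ^j x⁺`. -/
def plusFactor (q : ℝ) : Fin 3 → ℂ := ![1, q, (q : ℂ) ^ 2]

/-- The factors with `x⁰ ξ^j = q ξ^j x⁰ + (lowerFactor j) ξ^{j-1} x⁺`. -/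
def lowerFactor (q : ℝ) : Fin 3 → ℂ := ![0, -(h q * (q + 1)), (q : ℂ) ^ 2 - 1]

/-- The index below `j`; its value at `-` is immaterial. -/
def lower : Fin 3 → Fin 3 := ![0, 0, 1]

theorem plus_smul_xi (hq : 0 < q) (j : Fin 3) :
    x q 2 • xi q j = plusFactor q j • MulOpposite.op (x q 2) • xi q j := by
  rw [x_smul_xi hq, Fin.sum_univ_three]
  fin_cases j <;>
    simp only [commX, plusFactor, Matrix.cons_val, Matrix.of_apply, Fin.isValue, Fin.reduceFinMk,
      Fin.zero_eta, Fin.mk_one, MulOpposite.op_zero, MulOpposite.op_smul, smul_assoc, zero_smul,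
      one_smul, add_zero, zero_add]

theorem zero_smul_xi (hq : 0 < q) (j : Fin 3) :
    x q 1 • xi q j = (q : ℂ) • MulOpposite.op (x q 1) • xi q j +
      lowerFactor q j • MulOpposite.op (x q 2) • xi q (lower j) := by
  rw [x_smul_xi hq, Fin.sum_univ_three]
  fin_cases j <;>
    simp only [commX, lowerFactor, lower, Matrix.cons_val, Matrix.of_apply, Fin.isValue,
      Fin.reduceFinMk, Fin.zero_eta, Fin.mk_one, MulOpposite.op_zero, MulOpposite.op_smul,
      smul_assoc, zero_smul, add_zero, zero_add]
  all_goals exact add_comm _ _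

theorem lam_smul_xi (hq : 0 < q) (j : Fin 3) :
    lam q • xi q j = (q : ℂ)⁻¹ • MulOpposite.op (lam q) • xi q j := by
  rw [xi_lam, inv_smul_smul₀ (q_ne_zero hq)]

theorem r2_smul_xi (hq : 0 < q) (j : Fin 3) :
    r2 q • xi q j = (q : ℂ) ^ 2 • MulOpposite.op (r2 q) • xi q j := by
  rw [smul_xi hq, comm_r2, Finset.sum_eq_single j]
  · rw [Matrix.diagonal_apply_eq, MulOpposite.op_smul, smul_assoc]
  · intro k _ hk
    rw [Matrix.diagonal_apply_ne _ hk, MulOpposite.op_zero, zero_smul]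
  · simp

section Metric

variable (g : Metric (Alg q) (Form q))

theorem mul_metric (a : Alg q) (ξ η : Form q) : a * g (tens q ξ η) = g (tens q (a • ξ) η) := by
  rw [← smul_eq_mul, ← map_smul, BTensor.smul_mk]

theorem metric_mul (a : Alg q) (ξ η : Form q) :
    g (tens q ξ η) * a = g (tens q ξ (MulOpposite.op a • η)) := by
  rw [← op_smul_eq_mul, ← g.map_right, BTensor.op_smul_mk]

theorem metric_balanced (a : Alg q) (ξ η : Form q) :
    g (tens q (MulOpposite.op a • ξ) η) = g (tens q ξ (a • η)) := by
  rw [tens, BTensor.mk_balanced]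

theorem metric_smul_left (c : ℂ) (ξ η : Form q) :
    g (tens q (c • ξ) η) = c • g (tens q ξ η) := by
  rw [tens, map_smul, LinearMap.smul_apply, LinearMap.map_smul_of_tower]

theorem metric_smul_right (c : ℂ) (ξ η : Form q) :
    g (tens q ξ (c • η)) = c • g (tens q ξ η) := by
  rw [tens, map_smul, LinearMap.map_smul_of_tower]

theorem metric_add_left (ξ ξ' η : Form q) :
    g (tens q (ξ + ξ') η) = g (tens q ξ η) + g (tens q ξ' η) := by
  rw [tens, map_add, LinearMap.add_apply, map_add]

theorem metric_add_right (ξ η η' : Form q) :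
    g (tens q ξ (η + η')) = g (tens q ξ η) + g (tens q ξ η') := by
  rw [tens, map_add, map_add]

/-- If `a` commutes with `ξ` and with `η` up to factors, then it does so with `g (ξ ⊗ η)`. -/
theorem mul_metric_of_smul {a : Alg q} {ξ η : Form q} {c c' : ℂ}
    (h : a • ξ = c • MulOpposite.op a • ξ) (h' : a • η = c' • MulOpposite.op a • η) :
    a * g (tens q ξ η) = (c * c') • (g (tens q ξ η) * a) := by
  rw [mul_metric, h, metric_smul_left, metric_balanced, h', metric_smul_right, metric_mul,
    smul_smul]

theorem zero_mul_metric (hq : 0 < q) (i j : Fin 3) :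
    x q 1 * g (tens q (xi q i) (xi q j)) =
      (q : ℂ) ^ 2 • (g (tens q (xi q i) (xi q j)) * x q 1) +
      ((q : ℂ) * lowerFactor q j) • (g (tens q (xi q i) (xi q (lower j))) * x q 2) +
      (lowerFactor q i * plusFactor q j) • (g (tens q (xi q (lower i)) (xi q j)) * x q 2) := by
  rw [mul_metric, zero_smul_xi hq, metric_add_left, metric_smul_left, metric_smul_left,
    metric_balanced, metric_balanced, zero_smul_xi hq, plus_smul_xi hq, metric_add_right]
  simp only [metric_smul_right, ← metric_mul, smul_add, smul_smul, _root_.sq]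

theorem lam_mul_metric (hq : 0 < q) (i j : Fin 3) :
    (q : ℂ) ^ 2 • (lam q * g (tens q (xi q i) (xi q j))) =
      g (tens q (xi q i) (xi q j)) * lam q := by
  have h0 := q_ne_zero hq
  rw [mul_metric_of_smul g (lam_smul_xi hq i) (lam_smul_xi hq j), smul_smul, ← mul_inv, _root_.sq,
    mul_inv_cancel₀ (mul_ne_zero h0 h0), one_smul]

theorem r2_mul_metric (hq : 0 < q) (i j : Fin 3) :
    r2 q * g (tens q (xi q i) (xi q j)) =
      (q : ℂ) ^ 4 • (g (tens q (xi q i) (xi q j)) * r2 q) := by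
  rw [mul_metric_of_smul g (r2_smul_xi hq i) (r2_smul_xi hq j), ← pow_add]

/-- Components of positive total weight vanish: for a monomial occurring in them the equation with
`x⁺` would force a negative exponent of `x⁰`. -/
theorem metric_eq_zero_of_plusFactor (hq : 0 < q) (hq1 : q ≠ 1) {i j : Fin 3} {e : ℕ}
    (he : plusFactor q i * plusFactor q j = (q : ℂ) ^ (e + 3)) :
    g (tens q (xi q i) (xi q j)) = 0 := by
  have h0 := q_ne_zero hq
  refine monCoord_eq_zero hq (apply_eq_zero_of_opPlus hq (μ := 1) (ν := (q : ℂ) ^ (e + 3)) ?_ ?_)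
  · rw [one_smul, ← rep_plus hq, ← monCoord_mul, ← monCoord_mul_plus, ← monCoord_smul, ← he,
      mul_metric_of_smul g (plus_smul_xi hq i) (plus_smul_xi hq j)]
  · intro p hp h
    rw [lam_exponent_eq_two hq hq1 (r2_mul_metric g hq i j) hp, one_mul, ← zpow_natCast,
      ← zpow_natCast, ← zpow_neg, ← zpow_neg, ← zpow_add₀ h0] at h
    have := q_zpow_injective hq hq1 h
    push_cast at this
    omega

/-- The commutation rules leave only one free component `g (ξ⁰ ⊗ ξ⁰)`. -/
theorem metric_eq_smul_gMat (hq : 0 < q) (hq1 : q ≠ 1) (i j : Fin 3) :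
    g (tens q (xi q i) (xi q j)) = gMat q i j • g (tens q (xi q 1) (xi q 1)) ∧
      x q 1 * g (tens q (xi q 1) (xi q 1)) =
        (q : ℂ) ^ 2 • (g (tens q (xi q 1) (xi q 1)) * x q 1) := by
  have h0 := q_ne_zero hq
  have hs := sq_ne_zero hq
  have h1 := q_sub_one_ne_zero hq1
  have h2 := q_add_one_ne_zero hq
  have hqs := sq_sq hq
  have hh : h q * sq q = q - 1 := by rw [h, sub_mul, inv_mul_cancel₀ hs, ← _root_.sq, hqs]
  have hs1 : sq q * (sq q)⁻¹ = 1 := mul_inv_cancel₀ hs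
  have hs2 : (sq q)⁻¹ * (sq q)⁻¹ = (q : ℂ)⁻¹ := by rw [← mul_inv, ← _root_.sq, hqs]
  have hv : h q = (q - 1) * (sq q)⁻¹ := by rw [← hh, mul_assoc, hs1, mul_one]
  have hi : h q * (sq q)⁻¹ * q = q - 1 := by
    rw [hv, mul_assoc ((q : ℂ) - 1), hs2, mul_assoc, inv_mul_cancel₀ h0, mul_one]
  have hh0 : h q ≠ 0 := fun e => h1 (by rw [← hh, e, zero_mul])
  have z12 : g (tens q (xi q 1) (xi q 2)) = 0 :=
    metric_eq_zero_of_plusFactor g hq hq1 (e := 0) (by simp [plusFactor]; ring)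
  have z21 : g (tens q (xi q 2) (xi q 1)) = 0 :=
    metric_eq_zero_of_plusFactor g hq hq1 (e := 0) (by simp [plusFactor]; ring)
  have z22 : g (tens q (xi q 2) (xi q 2)) = 0 :=
    metric_eq_zero_of_plusFactor g hq hq1 (e := 1) (by simp [plusFactor]; ring)
  have E := zero_mul_metric g hq
  have E12 := E 1 2
  have E21 := E 2 1
  have E11 := E 1 1
  have E02 := E 0 2
  have E20 := E 2 0
  have E01 := E 0 1
  simp only [lowerFactor, plusFactor, lower, Matrix.cons_val, Fin.isValue, z12, z21, mul_zero,
    zero_mul, smul_zero, zero_smul, add_zero, zero_add] at E12 E21 E11 E02 E20 E01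
  have e02 : g (tens q (xi q 0) (xi q 2)) = (sq q)⁻¹ • g (tens q (xi q 1) (xi q 1)) := by
    rw [← sub_eq_zero]
    refine eq_zero_of_mul_plus_eq_zero hq
      ((smul_eq_zero_iff_right (mul_ne_zero (mul_ne_zero hh0 h2) (pow_ne_zero 2 h0))).1 ?_)
    rw [sub_mul, smul_mul_assoc]
    linear_combination (norm := skip) E12
    match_scalars
    · ring
    · linear_combination -(q + 1) * q * hi
  have e20 : g (tens q (xi q 2) (xi q 0)) = sq q • g (tens q (xi q 1) (xi q 1)) := by
    rw [← sub_eq_zero]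
    refine eq_zero_of_mul_plus_eq_zero hq
      ((smul_eq_zero_iff_right (mul_ne_zero (mul_ne_zero hh0 h2) h0)).1 ?_)
    rw [sub_mul, smul_mul_assoc]
    linear_combination (norm := skip) E21
    match_scalars
    · ring
    · linear_combination -(q + 1) * q * hh
  rw [e02, mul_smul_comm, smul_mul_assoc] at E02
  rw [e20, mul_smul_comm, smul_mul_assoc] at E20
  -- the defect of the commutation of `x⁰` with `g (ξ⁰ ⊗ ξ⁰)` is a multiple of itself
  have hF : x q 1 * g (tens q (xi q 1) (xi q 1)) -
      (q : ℂ) ^ 2 • (g (tens q (xi q 1) (xi q 1)) * x q 1) = 0 := by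
    have hne : (1 : ℂ) + q + (q : ℂ)⁻¹ ≠ 0 := by
      exact_mod_cast (by positivity : (1 : ℝ) + q + q⁻¹ ≠ 0)
    refine (smul_eq_zero_iff_right hne).1 ?_
    linear_combination (norm := skip) E11 + (q * (sq q)⁻¹) • E20 + (sq q)⁻¹ • E02
    match_scalars
    · linear_combination -(q : ℂ) * hs1 - hs2
    · linear_combination (q : ℂ) ^ 2 * (q * hs1 + hs2)
    · rw [hv]; ring
    · rw [hv]; ring
  have hq2 : (q : ℂ) ^ 2 - 1 ≠ 0 := by
    rw [show (q : ℂ) ^ 2 - 1 = (q - 1) * (q + 1) by ring]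
    exact mul_ne_zero h1 h2
  have z10 : g (tens q (xi q 1) (xi q 0)) = 0 := by
    refine eq_zero_of_mul_plus_eq_zero hq ((smul_eq_zero_iff_right hq2).1 ?_)
    linear_combination (norm := module) sq q • hF - E20
  have z01 : g (tens q (xi q 0) (xi q 1)) = 0 := by
    refine eq_zero_of_mul_plus_eq_zero hq ((smul_eq_zero_iff_right (mul_ne_zero h0 hq2)).1 ?_)
    linear_combination (norm := module) (sq q)⁻¹ • hF - E02
  have z00 : g (tens q (xi q 0) (xi q 0)) = 0 := by
    rw [z01, mul_zero, zero_mul, smul_zero, zero_add] at E01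
    refine eq_zero_of_mul_plus_eq_zero hq ((smul_eq_zero_iff_right ?_).1 E01.symm)
    exact mul_ne_zero h0 (neg_ne_zero.2 (mul_ne_zero hh0 h2))
  refine ⟨?_, sub_eq_zero.1 hF⟩
  fin_cases i <;> fin_cases j <;>
    simp only [gMat, Matrix.cons_val, Matrix.of_apply, Fin.isValue, Fin.reduceFinMk,
      Fin.zero_eta, Fin.mk_one, zero_smul, one_smul, z00, z01, z10, z12, z21, z22, e02, e20]

/-- Every metric is a multiple of `g₀`. -/
theorem exists_eq_smul_metric₀ (hq : 0 < q) (hq1 : q ≠ 1) :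
    ∃ c : ℂ, ∀ ω, g ω = c • metric₀ hq hq1 ω := by
  have hplus : x q 2 * g (tens q (xi q 1) (xi q 1)) =
      (q : ℂ) ^ 2 • (g (tens q (xi q 1) (xi q 1)) * x q 2) :=
    (mul_metric_of_smul g (plus_smul_xi hq 1) (plus_smul_xi hq 1)).trans
      (by simp [plusFactor, _root_.sq])
  obtain ⟨c, hc⟩ := eq_smul_weight hq hq1 (lam_mul_metric g hq 1 1) (r2_mul_metric g hq 1 1)
    (metric_eq_smul_gMat g hq hq1 1 1).2 hplus
  refine ⟨c, fun ω => ?_⟩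
  rw [bimodHom_apply_eq_sum hq hq1 g, bimodHom_apply_eq_sum hq hq1 (metric₀ hq hq1),
    Finset.smul_sum]
  refine Finset.sum_congr rfl fun p _ => ?_
  rw [metric₀_xiTens, xiTens, (metric_eq_smul_gMat g hq hq1 p.1 p.2).1, hc, smul_comm c,
    smul_comm c]

end Metric

end QEuclid

end

open QEuclid in
theorem mainTheorem2 (q : ℝ) (hq : 0 < q) (hq1 : q ≠ 1) :
    ∃ g₀ : Metric (Alg q) (Form q),
      (∀ i j, g₀ (tens q (xi q i) (xi q j)) = gMat q i j • (r2 q * lam q ^ 2)) ∧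
      (∃ ω, g₀ ω ≠ 0) ∧
      (∀ g : Metric (Alg q) (Form q), ∃ c : ℂ, ∀ ω, g ω = c • g₀ ω) ∧
      ∀ (S : Matrix (Fin 3 × Fin 3) (Fin 3 × Fin 3) ℂ) (κ : ℂ),
        (S = (q : ℂ) • Rhat q ∧ κ = (q : ℂ) ^ 2) ∨
          (S = ((q : ℂ) • Rhat q)⁻¹ ∧ κ = ((q : ℂ) ^ 2)⁻¹) →
        (∀ i h m n, ∑ j, ∑ k, ∑ l, S (i, j) (h, k) * gMat q k l * S (m, n) (j, l) =
          κ * gMat q i m * (if n = h then 1 else 0)) ∧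
        ∃ C : LinearConnection (d q), IsD0 q S C ∧ (∀ C', IsD0 q S C' → C' = C) ∧
          (∀ ω ζ, g₀.g₂₃ (C.σ₁₂ (C.σ₂₃ (BTensor.mk (Alg q) ω ζ))) = κ • g₀ ω • ζ) ∧
          (∀ ω, g₀.g₂₃ (C.D₂ ω) = d q (g₀ ω) + (κ - 1) • g₀ ω • theta q) ∧
          ¬ C.IsCompatible g₀ := by
  have := nontrivial_alg hq
  have hw : metric₀ hq hq1 (xiTens q (1, 1)) = weight q := by
    rw [metric₀_xiTens]
    simp [gMat]
  refine ⟨metric₀ hq hq1, fun i j => metric₀_xiTens hq hq1 (i, j), ⟨xiTens q (1, 1), ?_⟩,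
    fun g => exists_eq_smul_metric₀ g hq hq1, fun S κ hSκ => ?_⟩
  · rw [hw]
    intro h0
    exact one_ne_zero (eq_zero_of_weight_smul_eq_zero (Alg q) (m := (1 : Alg q)) (by
      rw [h0, zero_smul]))
  have hκ1 : κ - 1 ≠ 0 := by
    have h2 : (q : ℂ) ^ 2 ≠ 1 := fun h => by
      have := q_zpow_injective hq hq1 (m := 2) (n := 0) (by rw [zpow_zero]; exact_mod_cast h)
      omega
    rcases hSκ with ⟨-, rfl⟩ | ⟨-, rfl⟩
    · exact sub_ne_zero.2 h2
    · exact sub_ne_zero.2 fun h => h2 (inv_eq_one.1 h)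
  obtain ⟨hS, hg⟩ : (∀ a, Commute (comm2 hq a) (scalarMat S)) ∧
      ∀ i h m n, ∑ j, ∑ k, ∑ l, S (i, j) (h, k) * gMat q k l * S (m, n) (j, l) =
        κ * gMat q i m * (if n = h then 1 else 0) := by
    rcases hSκ with ⟨rfl, rfl⟩ | ⟨rfl, rfl⟩
    · rw [smul_Rhat hq]
      exact ⟨commute_comm2_qRhat hq, metric_through_qRhat hq⟩
    · rw [inv_smul_Rhat hq]
      exact ⟨commute_comm2_qRhatInv hq, metric_through_qRhatInv hq⟩
  have hσ := g₂₃_σ₁₂_σ₂₃ hq hq1 S κ hS hg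
  have hD := g₂₃_D₂_commutatorConnection (theta q) (d_eq_commutator hq hq1)
    (flip₀ hq hq1 S hS) (metric₀ hq hq1) κ hσ
  refine ⟨hg, connection₀ hq hq1 S hS, isD0_connection₀ hq hq1 S hS,
    fun C' hC' => (isD0_connection₀ hq hq1 S hS).unique hq hq1 hC', hσ, hD, fun hc => ?_⟩
  have e := (hD (xiTens q (1, 1))).symm.trans (hc (xiTens q (1, 1)))
  rw [add_eq_left, hw, smul_eq_zero_iff_right hκ1] at e
  exact theta_ne_zero hq hq1 (eq_zero_of_weight_smul_eq_zero (Form q) e)
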